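/- **Setting.** Let $G$ be a split connected reductive linear algebraic group over $\mathbb{R}$ of semisimple rank $1$ (identified with its group of complex points, $\sigma$ being complex conjugation; for a subgroup $K$ of $G$ defined over $\mathbb R$ write $K^\sigma=K(\mathbb{R})$). Thus $G=[G,G]\cdot Z(G)^\circ$, where $Z(G)^\circ$ is a split torus and $[G,G]$ is the image of $SL_2(\mathbb{C})$ under a homomorphism defined over $\mathbb{R}$ with kernel in $\{\pm1\}$. Let $B=TU\subset G$ be the Borel subgroup containing the image of the upper triangular matrices, $T$ the split maximal torus containing the image of the diagonal matrices, $U$ the unipotent radical of $B$, $\alpha$ the simple root and $s_\alpha$ the simple reflection. German letters denote Lie algebras. Fix a $G$-invariant inner product on $\mathfrak g$ (symmetric and bilinear, real on $\mathfrak g^\sigma$, positive definite on $\mathfrak t^\sigma$), and use it to identify $\mathfrak g^*\simeq\mathfrak g$ and $\mathfrak t^*\simeq\mathfrak t$. Let $H\subset G$ be an algebraic subgroup defined over $\mathbb{R}$, $X=G/H$ with base point $x_0=eH$ and real structure $\mu(gx_0)=\sigma(g)x_0$, and $X^\mu=X(\mathbb R)$. Write $G_x$ for the stabilizer of $x\in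 X$ and $\mathfrak g_x$ for its Lie algebra. Assume that $\mathcal O=B^\sigma x_0$ is open in $G^\sigma x_0$ and that $\alpha$ is of type (T2) with respect to $\mathcal O$: up to conjugation, the image of $H$ in $G/Z(G)\simeq PGL_2(\mathbb C)$ is $PSO_{1,1}(\mathbb{C})$ and the image of $H^\sigma$ in $PGL_2(\mathbb{R})$ is $PSO_{1,1}(\mathbb{R})=\left\{\pm\begin{pmatrix}p&q\\q&p\end{pmatrix}:p,q\in\mathbb R,\ p^2-q^2=1\right\}$. The reflection operator of $\alpha$ on the $B^\sigma$-orbits in $X^\mu$ acts on those contained in a given $G^\sigma$-orbit as follows. If the image in $PGL_2(\mathbb C)$ of the stabilizer of a point lies, up to conjugation, between the upper unitriangular and the upper triangular group, there are exactly two such $B^\sigma$-orbits, and they are interchanged. Otherwise a $B^\sigma$-orbit goes to the unique other $B^\sigma$-orbit in the same $G^\sigma$-orbit which is open, respectively not open, there just as it is, if exactly one such orbit exists, and is fixed if not. Let $\mathring X$ be the open $B$-orbit in $X$, let $T_0$ be the subgroup of those $t\in T$ with $tx\in Ux$ for all $x\in\mathring X$, and let $\mathfrak a^*\subseteq\mathfrak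 t^*\simeq\mathfrak t$ be the annihilator of its Lie algebra. Realize $T^*X=\{(x,\xi)\in X\times\mathfrak g:\xi\perp\mathfrak g_x\}$, with moment map $\Phi(x,\xi)=\xi$. For $\zeta\in\mathfrak a^*$ put $Z(\zeta)=\{x\in\mathring X:\zeta\perp\mathfrak g_x\}$. Let $\mathfrak a^{\rm pr}\subset\mathfrak a^*$ be the set of those $\zeta$ which lie in no proper intersection of $\mathfrak a^*$ with the kernel of the coroot $\alpha^\vee$ or with $s_\alpha\mathfrak a^*$, and for which $Z(\zeta)$ is a single $T$-orbit that is closed in $X$. Let $$\widetilde T^{\rm pr}X^\mu\subset T^*X\times_{\mathfrak t^*/W}\mathfrak t^*,\qquad \mathfrak t^*/W\simeq\mathfrak g^*/\!\!/G,\quad W=\{1,s_\alpha\},$$ be the set of real points $(x,\xi,\zeta)$ with $\zeta\in\mathfrak a^{\rm pr}\cup s_\alpha\mathfrak a^{\rm pr}$, on which $s_\alpha$ acts through $\zeta$ alone. For an open $B^\sigma$-orbit $\mathcal Q\subset X^\mu$ let $\widetilde{\mathcal U}^{\rm pr}_{\mathcal Q}$ be the set of $(x,\xi,\zeta)\in\widetilde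 T^{\rm pr}X^\mu$ with $x\in\mathcal Q$ and $\xi\in\zeta+\mathfrak u$; the cell of $\mathcal Q$ in the partition (P) is $G^\sigma\widetilde{\mathcal U}^{\rm pr}_{\mathcal Q}$. Finally let $\mathfrak t_\perp$ be the orthocomplement of $\mathfrak h\cap\mathfrak z(\mathfrak g)$ in $\mathfrak z(\mathfrak g)=\operatorname{Lie}Z(G)^\circ$, let $\mathfrak s=\mathfrak h^\perp\cap[\mathfrak g,\mathfrak g]$, and let $\mathfrak s^\perp$ be the orthocomplement of $\mathfrak s$ in $\mathfrak h^\perp$. **Proposition.** There are exactly two open $B^\sigma$-orbits in $G^\sigma x_0$, namely $\mathcal O$ and another one $\mathcal O'$, and the reflection operator of $\alpha$ interchanges $\mathcal O$ and $\mathcal O'$. The action of $s_\alpha$ on $\widetilde T^{\rm pr}X^\mu$ interchanges the cells $G^\sigma\widetilde{\mathcal U}^{\rm pr}_{\mathcal O}$ and $G^\sigma\widetilde{\mathcal U}^{\rm pr}_{\mathcal O'}$ if and only if $\mathfrak s^\perp\subseteq\mathfrak t_\perp$. -/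

import Mathlib

open scoped MatrixGroups

noncomputable section

/-- Complex conjugation on `GL_N(ℂ)`. -/
def conjGL (N : ℕ) : GL (Fin N) ℂ →* GL (Fin N) ℂ :=
  Matrix.GeneralLinearGroup.map (starRingEnd ℂ)

/-- The subgroup `GL_N(ℝ)` of `GL_N(ℂ)`: the fixed points of complex conjugation. -/
def realGL (N : ℕ) : Subgroup (GL (Fin N) ℂ) :=
  MonoidHom.eqLocus (conjGL N) (MonoidHom.id _)

/-- A matrix with real entries. -/
def IsRealMatrix {N : ℕ} (ξ : Matrix (Fin N) (Fin N) ℂ) : Prop :=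
  ∀ i j, (starRingEnd ℂ) (ξ i j) = ξ i j

/-- A Zariski closed subgroup of `GL_N(ℂ)` defined over `ℝ`: it is cut out in `GL_N(ℂ)` by
polynomials with real coefficients in the matrix entries. -/
def IsRealAlgebraic {N : ℕ} (K : Subgroup (GL (Fin N) ℂ)) : Prop :=
  ∃ S : Set (MvPolynomial (Fin N × Fin N) ℝ), ∀ g : GL (Fin N) ℂ,
    g ∈ K ↔ ∀ f ∈ S, MvPolynomial.aeval
      (fun ij : Fin N × Fin N => (g : Matrix (Fin N) (Fin N) ℂ) ij.1 ij.2) f = 0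

/-- A split torus over `ℝ` inside `GL_N(ℂ)`: the image of some `(ℂˣ)^k` under a homomorphism
which, in a suitable real basis of `ℂ^N`, is given by diagonal matrices of Laurent monomials
(characters). -/
def IsSplitTorus {N : ℕ} (C : Subgroup (GL (Fin N) ℂ)) : Prop :=
  ∃ (k : ℕ) (P : GL (Fin N) ℝ) (m : Fin N → Fin k → ℤ), ∀ g : GL (Fin N) ℂ,
    g ∈ C ↔ ∃ t : Fin k → ℂˣ,
      (g : Matrix (Fin N) (Fin N) ℂ) =
        (P : Matrix (Fin N) (Fin N) ℝ).map Complex.ofReal *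
          Matrix.diagonal (fun i => ∏ j, ((t j ^ m i j : ℂˣ) : ℂ)) *
          ((P⁻¹ : GL (Fin N) ℝ) : Matrix (Fin N) (Fin N) ℝ).map Complex.ofReal

/-- The Lie algebra of a (closed) subgroup `K` of `GL_N(ℂ)`: the matrices `ξ` all of whose
one-parameter subgroups `exp (s ξ)` lie in `K`. -/
def lieAlg {N : ℕ} (K : Set (GL (Fin N) ℂ)) : Set (Matrix (Fin N) (Fin N) ℂ) :=
  {ξ | ∀ s : ℂ, ∃ g ∈ K, (g : Matrix (Fin N) (Fin N) ℂ) = NormedSpace.exp (s • ξ)}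

/-- The (co)adjoint action of `GL_N(ℂ)` on matrices. -/
def Ad {N : ℕ} (g : GL (Fin N) ℂ) (ξ : Matrix (Fin N) (Fin N) ℂ) : Matrix (Fin N) (Fin N) ℂ :=
  (g : Matrix (Fin N) (Fin N) ℂ) * ξ * ((g⁻¹ : GL (Fin N) ℂ) : Matrix (Fin N) (Fin N) ℂ)

/-- A split connected reductive group over `ℝ` of semisimple rank one, realised in `GL_N(ℂ)`:
`G = [G, G] · Z(G)°`, where `Z(G)°` is a split torus `C` and `[G, G]` is the image of `SL₂` under
a homomorphism `φ` defined over `ℝ` with kernel contained in `{±1}`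
(so that `[G, G]` is `SL₂` or `PGL₂`). -/
structure SplitRankOneGroup (N : ℕ) where
  /-- the group of complex points -/
  G : Subgroup (GL (Fin N) ℂ)
  /-- the connected centre -/
  C : Subgroup (GL (Fin N) ℂ)
  /-- the parametrisation of the derived group -/
  φ : SL(2, ℂ) →* GL (Fin N) ℂ
  φ_algebraic : ∃ p : Fin N → Fin N → MvPolynomial (Fin 2 × Fin 2) ℝ, ∀ (A : SL(2, ℂ)) (i j),
    (φ A : Matrix (Fin N) (Fin N) ℂ) i j =
      MvPolynomial.aeval (fun ab : Fin 2 × Fin 2 => (A : Matrix (Fin 2) (Fin 2) ℂ) ab.1 ab.2) (p i j)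
  φ_ker : φ.ker ≤ Subgroup.center SL(2, ℂ)
  C_split : IsSplitTorus C
  C_central : ∀ c ∈ C, ∀ A : SL(2, ℂ), c * φ A = φ A * c
  G_eq : G = φ.range ⊔ C

namespace SplitRankOneGroup

variable {N : ℕ} (𝒢 : SplitRankOneGroup N)

/-- The unipotent radical `U` of the Borel subgroup: the image of the upper unitriangular
matrices. -/
def U : Subgroup (GL (Fin N) ℂ) :=
  Subgroup.closure {g | ∃ A : SL(2, ℂ), A 1 0 = 0 ∧ A 0 0 = 1 ∧ A 1 1 = 1 ∧ g = 𝒢.φ A}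

/-- The split maximal torus `T`, generated by the image of the diagonal torus and the centre. -/
def T : Subgroup (GL (Fin N) ℂ) :=
  Subgroup.closure {g | ∃ A : SL(2, ℂ), A 1 0 = 0 ∧ A 0 1 = 0 ∧ g = 𝒢.φ A} ⊔ 𝒢.C

/-- The Borel subgroup `B`, generated by the image of the upper triangular matrices and the
centre. -/
def B : Subgroup (GL (Fin N) ℂ) :=
  Subgroup.closure {g | ∃ A : SL(2, ℂ), A 1 0 = 0 ∧ g = 𝒢.φ A} ⊔ 𝒢.C

/-- The representative `n_α` of the simple reflection `s_α`, the image of `(0, -1; 1, 0)`. -/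
def nα : GL (Fin N) ℂ := 𝒢.φ ⟨!![0, -1; 1, 0], by simp [Matrix.det_fin_two]⟩

/-- The action of the simple reflection `s_α` on the Lie algebra of `T`. -/
def sα (ζ : Matrix (Fin N) (Fin N) ℂ) : Matrix (Fin N) (Fin N) ℂ := Ad 𝒢.nα ζ

/-- The real points of a subgroup of `GL_N(ℂ)`, as a subgroup of `G`. -/
def realPts (K : Subgroup (GL (Fin N) ℂ)) : Subgroup 𝒢.G := (K ⊓ realGL N).subgroupOf 𝒢.G

/-- An invariant inner product on the Lie algebra of `G`: a symmetric bilinear form, invariant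
under `G`, real on the real Lie algebra and positive definite on the real Lie algebra of the split
torus `T`.  (It is given as a form on all matrices, but only its restriction to the
Lie algebra of `G` is ever used.) -/
structure IsInvariantInnerProduct
    (β : LinearMap.BilinForm ℂ (Matrix (Fin N) (Fin N) ℂ)) : Prop where
  symm : ∀ ξ ∈ lieAlg (𝒢.G : Set (GL (Fin N) ℂ)), ∀ η ∈ lieAlg (𝒢.G : Set (GL (Fin N) ℂ)),
    β ξ η = β η ξ
  invariant : ∀ g ∈ 𝒢.G, ∀ ξ ∈ lieAlg (𝒢.G : Set (GL (Fin N) ℂ)),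
    ∀ η ∈ lieAlg (𝒢.G : Set (GL (Fin N) ℂ)), β (Ad g ξ) (Ad g η) = β ξ η
  real : ∀ ξ ∈ lieAlg (𝒢.G : Set (GL (Fin N) ℂ)), ∀ η ∈ lieAlg (𝒢.G : Set (GL (Fin N) ℂ)),
    IsRealMatrix ξ → IsRealMatrix η → (β ξ η).im = 0
  pos : ∀ ζ ∈ lieAlg (𝒢.T : Set (GL (Fin N) ℂ)), IsRealMatrix ζ → ζ ≠ 0 → 0 < (β ζ ζ).re

/-- The invertible matrix representing the image of `g ∈ G` in `PGL₂(ℂ) = G / Z(G)`,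
the group of automorphisms of `ℙ¹ = G / B`, is `M` (up to a scalar). -/
def ProjectsTo (g : GL (Fin N) ℂ) (M : Matrix (Fin 2) (Fin 2) ℂ) : Prop :=
  ∃ A : SL(2, ℂ), ∃ c ∈ 𝒢.C, ∃ l : ℂ, l ≠ 0 ∧ g = 𝒢.φ A * c ∧
    M = l • (A : Matrix (Fin 2) (Fin 2) ℂ)

end SplitRankOneGroup

/-- The preimage in `GL₂(F)` of the subgroup `PSO_{1,1}(F)` of `PGL₂(F)`. -/
def preimagePSO11 (F : Type) [Field F] : Set (GL (Fin 2) F) :=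
  {M | ∃ l p q : F, l ≠ 0 ∧ p ^ 2 - q ^ 2 = 1 ∧
    (M : Matrix (Fin 2) (Fin 2) F) = l • !![p, q; q, p]}

namespace SplitRankOneGroup

variable {N : ℕ} (𝒢 : SplitRankOneGroup N) (H : Subgroup 𝒢.G)

/-- The stabilizer in `G` of a point of `X = G / H`, as a subgroup of `GL_N(ℂ)`. -/
def stab (x : 𝒢.G ⧸ H) : Subgroup (GL (Fin N) ℂ) :=
  (MulAction.stabilizer 𝒢.G x).map 𝒢.G.subtype

/-- The preimage in `GL₂(ℂ)` of the image `Q_x` of the stabilizer of `x` in `PGL₂(ℂ)`. -/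
def Q (x : 𝒢.G ⧸ H) : Set (GL (Fin 2) ℂ) :=
  {M | ∃ h ∈ 𝒢.stab H x, 𝒢.ProjectsTo h (M : Matrix (Fin 2) (Fin 2) ℂ)}

/-- The preimage in `GL₂(ℝ)` of the image `R_x` in `PGL₂(ℝ)` of the group of real points of the
stabilizer of `x`. -/
def R (x : 𝒢.G ⧸ H) : Set (GL (Fin 2) ℝ) :=
  {M | ∃ h ∈ 𝒢.stab H x ⊓ realGL N,
    𝒢.ProjectsTo h ((M : Matrix (Fin 2) (Fin 2) ℝ).map Complex.ofReal)}

/-- Type (U) at `x`: up to conjugation, `Q_x` lies between the upper unitriangular and the upper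
triangular subgroup of `PGL₂(ℂ)`. -/
def IsTypeU (x : 𝒢.G ⧸ H) : Prop :=
  ∃ δ : GL (Fin 2) ℂ,
    (∀ M : GL (Fin 2) ℂ, M 1 0 = 0 → M 0 0 = 1 → M 1 1 = 1 → δ⁻¹ * M * δ ∈ 𝒢.Q H x) ∧
    (∀ M ∈ 𝒢.Q H x, (δ * M * δ⁻¹) 1 0 = 0)

/-- Type (T) at `x`: up to conjugation, `Q_x = PSO_{1,1}(ℂ)`. -/
def IsTypeT (x : 𝒢.G ⧸ H) : Prop :=
  ∃ δ : GL (Fin 2) ℂ, ∀ M : GL (Fin 2) ℂ, M ∈ 𝒢.Q H x ↔ δ * M * δ⁻¹ ∈ preimagePSO11 ℂ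

/-- Type (T2) at `x`: type (T) and, up to conjugation in `PGL₂(ℝ)`, `R_x = PSO_{1,1}(ℝ)`. -/
def IsTypeT2 (x : 𝒢.G ⧸ H) : Prop :=
  𝒢.IsTypeT H x ∧
    ∃ γ : GL (Fin 2) ℝ, ∀ M : GL (Fin 2) ℝ, M ∈ 𝒢.R H x ↔ γ * M * γ⁻¹ ∈ preimagePSO11 ℝ

/-- The real locus of `X = G / H` for the real structure `gH ↦ σ(g)H`. -/
def realLocus : Set (𝒢.G ⧸ H) :=
  {x | ∃ g g' : 𝒢.G, (g' : GL (Fin N) ℂ) = conjGL N g ∧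
    (QuotientGroup.mk g : 𝒢.G ⧸ H) = x ∧ (QuotientGroup.mk g' : 𝒢.G ⧸ H) = x}

/-- The `B(ℝ)`-orbit of a point. -/
def realBorelOrbit (x : 𝒢.G ⧸ H) : Set (𝒢.G ⧸ H) := MulAction.orbit (𝒢.realPts 𝒢.B) x

/-- The set of all `B(ℝ)`-orbits on the real locus of `X`. -/
def IsRealBorelOrbit (O : Set (𝒢.G ⧸ H)) : Prop :=
  ∃ x ∈ 𝒢.realLocus H, O = 𝒢.realBorelOrbit H x

/-- The `G(ℝ)`-span of a subset.  (For `G` of semisimple rank one, `P_α = G`.) -/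
def realSpan (O : Set (𝒢.G ⧸ H)) : Set (𝒢.G ⧸ H) :=
  {y | ∃ g ∈ 𝒢.realPts 𝒢.G, ∃ x ∈ O, y = g • x}

/-- `O` is open (in the classical topology) in its `G(ℝ)`-span. -/
def IsOpenInSpan (O : Set (𝒢.G ⧸ H)) : Prop :=
  ∃ V : Set (𝒢.G ⧸ H), IsOpen V ∧ O = V ∩ 𝒢.realSpan H O

/-- `O₂` is another `B(ℝ)`-orbit in the span of `O`; outside type (U) it is moreover required that
`O` and `O₂` be both open or both non-open in the span. -/
def IsReflectionPartner (O O₂ : Set (𝒢.G ⧸ H)) : Prop :=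
  𝒢.IsRealBorelOrbit H O₂ ∧ O₂ ⊆ 𝒢.realSpan H O ∧ O₂ ≠ O ∧
    ((∃ x ∈ O, 𝒢.IsTypeU H x) ∨ (𝒢.IsOpenInSpan H O₂ ↔ 𝒢.IsOpenInSpan H O))

open Classical in
/-- The reflection operator of `α` on the set of `B(ℝ)`-orbits.  In type (U) it interchanges the
two orbits of the span; in the types (P), (T0), (N0) the span is a single orbit, which is fixed;
in type (T1) it fixes the open orbit and interchanges the two orbits of codimension one; in
type (T2) it interchanges the two open orbits and the two orbits of codimension one; in
type (N1) it fixes both orbits; and in type (N2) it interchanges the two open orbits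
and fixes the orbit of codimension one. -/
def reflectionOperator (O : Set (𝒢.G ⧸ H)) : Set (𝒢.G ⧸ H) :=
  if h : ∃! O₂, 𝒢.IsReflectionPartner H O O₂ then h.choose else O

/-- The open `B`-orbit of the complex variety `X`. -/
def Omax : Set (𝒢.G ⧸ H) :=
  {x | IsOpen (MulAction.orbit (𝒢.B.subgroupOf 𝒢.G) x)}

/-- The subgroup `T_0` of elements of `T` that act trivially on the slice, which
is the quotient of the open `B`-orbit by `U`. -/
def T0 : Set (GL (Fin N) ℂ) :=
  {t | t ∈ 𝒢.T ∧ ∃ ht : t ∈ 𝒢.G, ∀ x ∈ 𝒢.Omax H,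
    (⟨t, ht⟩ : 𝒢.G) • x ∈ MulAction.orbit (𝒢.U.subgroupOf 𝒢.G) x}

variable (β : LinearMap.BilinForm ℂ (Matrix (Fin N) (Fin N) ℂ))

/-- `ξ` belongs to the image under the moment map of the cotangent space of `X` at `x`: the
annihilator of the Lie algebra of the stabilizer of `x`, inside the Lie algebra of `G`
(identified with its dual by `β`). -/
def IsCovectorAt (x : 𝒢.G ⧸ H) (ξ : Matrix (Fin N) (Fin N) ℂ) : Prop :=
  ξ ∈ lieAlg (𝒢.G : Set (GL (Fin N) ℂ)) ∧
    ∀ η ∈ lieAlg (𝒢.stab H x : Set (GL (Fin N) ℂ)), β ξ η = 0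

/-- The space `𝔞* ⊆ 𝔱* ≃ 𝔱`, the annihilator of the Lie algebra of `T_0`. -/
def aStar : Set (Matrix (Fin N) (Fin N) ℂ) :=
  {ζ | ζ ∈ lieAlg (𝒢.T : Set (GL (Fin N) ℂ)) ∧ ∀ τ ∈ lieAlg (𝒢.T0 H), β ζ τ = 0}

/-- The flat `Z(ζ)`: the points of the open `B`-orbit over which the moment map takes the
value `ζ`. -/
def flat (ζ : Matrix (Fin N) (Fin N) ℂ) : Set (𝒢.G ⧸ H) :=
  {x | x ∈ 𝒢.Omax H ∧ 𝒢.IsCovectorAt H β x ζ}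

/-- The principal stratum of `𝔞*` (when the stabilizer of the open `B`-orbit is `B`, with
Levi subgroup `T`): the `ζ` which lie in no proper intersection of `𝔞*` with the kernel of the
coroot (the fixed space of `s_α`) or with `s_α(𝔞*)`, and whose flat is a closed `T`-orbit. -/
def aPr : Set (Matrix (Fin N) (Fin N) ℂ) :=
  {ζ | ζ ∈ 𝒢.aStar H β ∧
    ((∃ ζ₁ ∈ 𝒢.aStar H β, 𝒢.sα ζ₁ ≠ ζ₁) → 𝒢.sα ζ ≠ ζ) ∧
    (𝒢.sα '' 𝒢.aStar H β ≠ 𝒢.aStar H β → ζ ∉ 𝒢.sα '' 𝒢.aStar H β) ∧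
    (∃ x, 𝒢.flat H β ζ = MulAction.orbit (𝒢.T.subgroupOf 𝒢.G) x) ∧
    IsClosed (𝒢.flat H β ζ)}

/-- Two elements of the Lie algebra of `G` have the same image in the quotient
`𝔤* // G ≃ 𝔱* / W`: they are not separated by invariant polynomials. -/
def SameInvariants (ξ ζ : Matrix (Fin N) (Fin N) ℂ) : Prop :=
  ∀ f : MvPolynomial (Fin N × Fin N) ℂ,
    (∀ g ∈ 𝒢.G, ∀ η ∈ lieAlg (𝒢.G : Set (GL (Fin N) ℂ)),
      MvPolynomial.eval (fun ij => Ad g η ij.1 ij.2) f =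
        MvPolynomial.eval (fun ij => η ij.1 ij.2) f) →
    MvPolynomial.eval (fun ij => ξ ij.1 ij.2) f = MvPolynomial.eval (fun ij => ζ ij.1 ij.2) f

/-- The principal stratum of the real locus of the fibre product of `T*X` and `𝔱*` over `𝔱* / W`,
consisting of triples `(x, ξ, ζ)`, with `(x, ξ)` a real point of `T*X ⊆ X × 𝔤*` and `ζ ∈ 𝔱*`
real. -/
def tildeTPr : Set ((𝒢.G ⧸ H) × Matrix (Fin N) (Fin N) ℂ × Matrix (Fin N) (Fin N) ℂ) :=
  {p | p.1 ∈ 𝒢.realLocus H ∧ 𝒢.IsCovectorAt H β p.1 p.2.1 ∧ IsRealMatrix p.2.1 ∧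
    p.2.2 ∈ lieAlg (𝒢.T : Set (GL (Fin N) ℂ)) ∧ IsRealMatrix p.2.2 ∧
    𝒢.SameInvariants p.2.1 p.2.2 ∧
    (p.2.2 ∈ 𝒢.aPr H β ∨ p.2.2 ∈ 𝒢.sα '' 𝒢.aPr H β)}

/-- The principal stratum of the lift to the fibre product of the conormal bundle of the
foliation of `O` by `U(ℝ)`-orbits: `ξ ∈ 𝔲^⊥ = 𝔲 ⊕ 𝔱` has `𝔱`-component `ζ`. -/
def tildeUPr (O : Set (𝒢.G ⧸ H)) :
    Set ((𝒢.G ⧸ H) × Matrix (Fin N) (Fin N) ℂ × Matrix (Fin N) (Fin N) ℂ) :=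
  {p | p ∈ 𝒢.tildeTPr H β ∧ p.1 ∈ O ∧ p.2.1 - p.2.2 ∈ lieAlg (𝒢.U : Set (GL (Fin N) ℂ))}

/-- The cell attached to `O` in the partition of the principal stratum: the `G(ℝ)`-span
of `tildeUPr O`. -/
def cell (O : Set (𝒢.G ⧸ H)) :
    Set ((𝒢.G ⧸ H) × Matrix (Fin N) (Fin N) ℂ × Matrix (Fin N) (Fin N) ℂ) :=
  {p | ∃ g ∈ 𝒢.realPts 𝒢.G, ∃ q ∈ 𝒢.tildeUPr H β O,
    p = (g • q.1, Ad (g : GL (Fin N) ℂ) q.2.1, q.2.2)}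

/-- The action of `s_α` on the fibre product. -/
def sαTilde (p : (𝒢.G ⧸ H) × Matrix (Fin N) (Fin N) ℂ × Matrix (Fin N) (Fin N) ℂ) :
    (𝒢.G ⧸ H) × Matrix (Fin N) (Fin N) ℂ × Matrix (Fin N) (Fin N) ℂ :=
  (p.1, p.2.1, 𝒢.sα p.2.2)

/-- The orthocomplement `𝔱_⊥`, in the Lie algebra of `Z(G)°`, of its intersection with the Lie
algebra of `H`. -/
def tPerp : Set (Matrix (Fin N) (Fin N) ℂ) :=
  {z | z ∈ lieAlg (𝒢.C : Set (GL (Fin N) ℂ)) ∧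
    ∀ z₀ ∈ lieAlg (H.map 𝒢.G.subtype : Set (GL (Fin N) ℂ)) ∩ lieAlg (𝒢.C : Set (GL (Fin N) ℂ)),
      β z z₀ = 0}

/-- The annihilator `𝔥^⊥` of the Lie algebra of `H` in the Lie algebra of `G`. -/
def hPerp : Set (Matrix (Fin N) (Fin N) ℂ) :=
  {ξ | ξ ∈ lieAlg (𝒢.G : Set (GL (Fin N) ℂ)) ∧
    ∀ η ∈ lieAlg (H.map 𝒢.G.subtype : Set (GL (Fin N) ℂ)), β ξ η = 0}

/-- The intersection `𝔰` of `𝔥^⊥` with the Lie algebra of `[G, G]`. -/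
def sSpace : Set (Matrix (Fin N) (Fin N) ℂ) :=
  𝒢.hPerp H β ∩ lieAlg (𝒢.φ.range : Set (GL (Fin N) ℂ))

/-- The orthocomplement `𝔰^⊥` of `𝔰` in `𝔥^⊥`. -/
def sPerp : Set (Matrix (Fin N) (Fin N) ℂ) :=
  {ξ | ξ ∈ 𝒢.hPerp H β ∧ ∀ η ∈ 𝒢.sSpace H β, β ξ η = 0}

end SplitRankOneGroup

end

/-! Everything is read off from a frame. By type (T2) there is a real `P` in `SL₂` such that `H`
maps onto the torus `P · diag · P⁻¹` of `PGL₂(ℂ)` and `H(ℝ)` onto the identity component of its real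
points (`exists_torusFrame`). For `g = φ(A) c` put `M = A P`. This is defined up to sign. On `G/H`
it matters only up to diagonal matrices on the right, and `B` acts through upper triangular matrices
on the left. So the second row of `M`, up to these rescalings, classifies the `B`-orbits, the open
one being `M₁₀ M₁₁ ≠ 0`. At a real point `M` is `1` or `i` times a real matrix, and over `ℝ` the
torus contributes only positive squares. Hence the sign of `sg = Re (M₁₀ · conj M₁₁)` separates the
open `B(ℝ)`-orbits (`mk_mem_realBorelOrbit`). Both signs occur, which gives `O` and `O'`. Type (U)
is impossible, so each is the only reflection partner of the other.

For the cells let `Y = M · slH · M⁻¹` and `y = Y₀₀`. A principal `ζ = a · slH + z`, with `z`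
central, has `a ≠ 0`. A real unipotent element therefore moves `(x, ξ, ζ)` with `ξ ∈ ζ + 𝔲` to a
point `(kH, ζ, ζ)` over the same `B(ℝ)`-orbit (`exists_unipotent`). Then `s_α` produces `(kH, ζ, s_α
ζ)`, which is the `n_α⁻¹`-translate of `(n_α kH, s_α ζ, s_α ζ)`. The question is thus whether `n_α`
changes the sign at `k`, and `sg_weyl` answers it: `4 · sg(k) · sg(n_α k) = y² - 1`.

The condition on `𝔰^⊥` controls `y`. By `isCovectorAt_cartan`, `ζ` is a covector at `kH` exactly
when `a y · P slH P⁻¹ + z` lies in `𝔥^⊥`, and then it lies in `𝔰^⊥`. If `𝔰^⊥ ⊆ 𝔱_⊥`, this vector is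
central, so `y = 0` and the sign always changes. If not, there is a real central `w` with `P slH P⁻¹
+ w ∈ 𝔥^⊥`. Then `ζ = ½ slH + w` is principal with flat `{y = 2}` (`half_mem_aPr`), and there `y² -
1 = 3 > 0`, so the reflected point does not reach the cell of `O'`.

Two preparations carry this. Lie algebras are given by one-parameter subgroups only, so `𝔤 = dφ(𝔰𝔩₂)
⊕ 𝔷` has to be proved (`exists_of_mem_lieG`). And `𝔥` must contain an element lying over `P slH P⁻¹`
(`IsTorusFrame.exists_mem_lieAlg`); this is where the algebraicity of `H` enters through its
equations. -/

open scoped MatrixGroups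

noncomputable section

/-! ### One-parameter subgroups of matrices -/

section MatrixExp

variable {n : ℕ}

section
open scoped Matrix.Norms.Operator

lemma hasDerivAt_matrix {f : ℂ → Matrix (Fin n) (Fin n) ℂ} {f' : Matrix (Fin n) (Fin n) ℂ} {s : ℂ} :
    HasDerivAt f f' s ↔ ∀ i j, HasDerivAt (fun t => f t i j) (f' i j) s := by
  constructor
  · intro h i j
    exact (((Matrix.entryLinearMap ℂ ℂ i j : Matrix (Fin n) (Fin n) ℂ →ₗ[ℂ] ℂ).toContinuousLinearMap.hasFDerivAt).comp_hasDerivAt s h)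
  · intro h
    have e0 (M : Matrix (Fin n) (Fin n) ℂ) : M = ∑ i, ∑ j, M i j • Matrix.single i j (1 : ℂ) := by
      conv_lhs => rw [Matrix.matrix_eq_sum_single M]
      simp [Matrix.smul_single]
    have e : f = fun t => ∑ i, ∑ j, f t i j • Matrix.single i j (1 : ℂ) := funext fun t => e0 _
    have e' := e0 f'
    rw [e, e']
    exact HasDerivAt.fun_sum fun i _ => HasDerivAt.fun_sum fun j _ => (h i j).smul_const _

lemma hasDerivAt_exp_smul_entry (ξ : Matrix (Fin n) (Fin n) ℂ) (s : ℂ) (i j : Fin n) :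
    HasDerivAt (fun t : ℂ => NormedSpace.exp (t • ξ) i j)
      ((ξ * NormedSpace.exp (s • ξ)) i j) s :=
  hasDerivAt_matrix.1 (hasDerivAt_exp_smul_const' ξ s) i j

/-- Additivity propagates the derivative at `0` to the equation `Φ' = ξ Φ`, and then `exp (-s ξ)
Φ(s)` has zero derivative. -/
lemma eq_exp_smul_of_add_mul {Φ : ℂ → Matrix (Fin n) (Fin n) ℂ} {ξ : Matrix (Fin n) (Fin n) ℂ}
    (h0 : Φ 0 = 1) (hadd : ∀ s t, Φ (s + t) = Φ s * Φ t)
    (hd : ∀ i j, HasDerivAt (fun t => Φ t i j) (ξ i j) 0) (s : ℂ) :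
    Φ s = NormedSpace.exp (s • ξ) := by
  have hd0 : HasDerivAt Φ ξ 0 := hasDerivAt_matrix.2 hd
  have hΦ : ∀ t, HasDerivAt Φ (ξ * Φ t) t := by
    intro t
    have h1 : HasDerivAt (fun u => Φ (u - t) * Φ t) (ξ * Φ t) t := by
      have := HasDerivAt.comp_sub_const t t (f := Φ) (f' := ξ) (by rw [sub_self]; exact hd0)
      exact this.mul_const (Φ t)
    convert h1 using 1
    funext u
    rw [← hadd]; simp
  have hc : ∀ t, HasDerivAt (fun u => NormedSpace.exp (-u • ξ) * Φ u) 0 t := by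
    intro t
    have h1 := (hasDerivAt_exp_smul_const ξ (-t)).scomp t (hasDerivAt_neg t)
    have h2 := h1.mul (hΦ t)
    refine h2.congr_deriv ?_
    rw [neg_one_smul]
    change -(NormedSpace.exp (-t • ξ) * ξ) * Φ t + NormedSpace.exp (-t • ξ) * (ξ * Φ t) = 0
    rw [neg_mul, mul_assoc, neg_add_cancel]
  have hconst := is_const_of_deriv_eq_zero (f := fun u => NormedSpace.exp (-u • ξ) * Φ u)
    (fun t => (hc t).differentiableAt) (fun t => (hc t).deriv) s 0
  simp only [neg_zero, zero_smul, NormedSpace.exp_zero, h0, mul_one] at hconst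
  have h3 : NormedSpace.exp (s • ξ) * NormedSpace.exp (-s • ξ) = 1 := by
    rw [← Matrix.exp_add_of_commute _ _ (by rw [neg_smul]; exact (Commute.refl _).neg_right)]
    simp
  calc Φ s = (NormedSpace.exp (s • ξ) * NormedSpace.exp (-s • ξ)) * Φ s := by rw [h3, one_mul]
    _ = _ := by rw [mul_assoc, hconst, mul_one]

end

lemma matrix_exp_zero : NormedSpace.exp (0 : Matrix (Fin n) (Fin n) ℂ) = 1 := by
  simp

lemma exp_add_smul (ξ : Matrix (Fin n) (Fin n) ℂ) (s t : ℂ) :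
    NormedSpace.exp ((s + t) • ξ) = NormedSpace.exp (s • ξ) * NormedSpace.exp (t • ξ) := by
  rw [add_smul, Matrix.exp_add_of_commute]
  exact ((Commute.refl ξ).smul_left s).smul_right t

lemma commute_of_commute_exp {ξ M : Matrix (Fin n) (Fin n) ℂ}
    (h : ∀ s : ℂ, Commute (NormedSpace.exp (s • ξ)) M) : Commute ξ M := by
  have key : ∀ i j, (ξ * M) i j = (M * ξ) i j := by
    intro i j
    have h1 : HasDerivAt (fun s : ℂ => (NormedSpace.exp (s • ξ) * M) i j) ((ξ * M) i j) 0 := by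
      simp only [Matrix.mul_apply]
      refine HasDerivAt.fun_sum fun k _ => ?_
      have := hasDerivAt_exp_smul_entry ξ 0 i k
      simp only [zero_smul, matrix_exp_zero, mul_one] at this
      exact this.mul_const _
    have h2 : HasDerivAt (fun s : ℂ => (M * NormedSpace.exp (s • ξ)) i j) ((M * ξ) i j) 0 := by
      simp only [Matrix.mul_apply]
      refine HasDerivAt.fun_sum fun k _ => ?_
      have := hasDerivAt_exp_smul_entry ξ 0 k j
      simp only [zero_smul, matrix_exp_zero, mul_one] at this
      exact this.const_mul _
    have : (fun s : ℂ => (NormedSpace.exp (s • ξ) * M) i j) =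
        fun s : ℂ => (M * NormedSpace.exp (s • ξ)) i j := by
      funext s; rw [(h s).eq]
    rw [this] at h1
    exact h1.unique h2
  ext i j; exact key i j

/-- `exp` of a traceless `2 × 2` matrix has determinant one. -/
lemma det_exp_smul_of_trace_eq_zero {ξ : Matrix (Fin 2) (Fin 2) ℂ} (h : ξ.trace = 0) (s : ℂ) :
    (NormedSpace.exp (s • ξ)).det = 1 := by
  have hd : ∀ t, HasDerivAt (fun t : ℂ => (NormedSpace.exp (t • ξ)).det) 0 t := by
    intro t
    simp only [Matrix.det_fin_two]
    have h4 := ((hasDerivAt_exp_smul_entry ξ t 0 0).mul (hasDerivAt_exp_smul_entry ξ t 1 1)).sub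
      ((hasDerivAt_exp_smul_entry ξ t 0 1).mul (hasDerivAt_exp_smul_entry ξ t 1 0))
    refine h4.congr_deriv ?_
    rw [Matrix.mul_apply, Matrix.mul_apply, Matrix.mul_apply, Matrix.mul_apply]
    rw [Matrix.trace_fin_two] at h
    have : ξ 1 1 = - ξ 0 0 := by linear_combination h
    simp only [Fin.sum_univ_two, this]; ring
  have := is_const_of_deriv_eq_zero (f := fun t : ℂ => (NormedSpace.exp (t • ξ)).det)
    (fun t => (hd t).differentiableAt) (fun t => (hd t).deriv) s 0
  simpa [matrix_exp_zero] using this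

/-- The one-parameter subgroup of `SL₂` with traceless generator `ξ`. -/
def expSL (ξ : Matrix (Fin 2) (Fin 2) ℂ) (h : ξ.trace = 0) (s : ℂ) : SL(2, ℂ) :=
  ⟨NormedSpace.exp (s • ξ), det_exp_smul_of_trace_eq_zero h s⟩

lemma expSL_add {ξ : Matrix (Fin 2) (Fin 2) ℂ} (h : ξ.trace = 0) (s t : ℂ) :
    expSL ξ h (s + t) = expSL ξ h s * expSL ξ h t :=
  Subtype.ext (exp_add_smul ξ s t)

lemma expSL_zero {ξ : Matrix (Fin 2) (Fin 2) ℂ} (h : ξ.trace = 0) : expSL ξ h 0 = 1 :=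
  Subtype.ext (by simp [expSL])

lemma expSL_conj {ξ : Matrix (Fin 2) (Fin 2) ℂ} (h : ξ.trace = 0) (A : SL(2, ℂ))
    (h' : ((A : Matrix (Fin 2) (Fin 2) ℂ) * ξ * (A⁻¹ : SL(2, ℂ))).trace = 0) (s : ℂ) :
    expSL (A * ξ * (A⁻¹ : SL(2, ℂ))) h' s = A * expSL ξ h s * A⁻¹ := by
  apply Subtype.ext
  have hA : (A : Matrix (Fin 2) (Fin 2) ℂ) * ((A⁻¹ : SL(2, ℂ)) : Matrix (Fin 2) (Fin 2) ℂ) = 1 := by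
    rw [← Matrix.SpecialLinearGroup.coe_mul]; simp
  have hinv : ((A⁻¹ : SL(2, ℂ)) : Matrix (Fin 2) (Fin 2) ℂ) = (A : Matrix (Fin 2) (Fin 2) ℂ)⁻¹ :=
    (Matrix.inv_eq_right_inv hA).symm
  have hu : IsUnit (A : Matrix (Fin 2) (Fin 2) ℂ) := by
    rw [Matrix.isUnit_iff_isUnit_det]; simp
  change NormedSpace.exp (s • ((A : Matrix (Fin 2) (Fin 2) ℂ) * ξ * ((A⁻¹ : SL(2, ℂ)) : Matrix (Fin 2) (Fin 2) ℂ))) =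
    (A : Matrix (Fin 2) (Fin 2) ℂ) * NormedSpace.exp (s • ξ) * ((A⁻¹ : SL(2, ℂ)) : Matrix (Fin 2) (Fin 2) ℂ)
  rw [hinv]
  rw [← Matrix.exp_conj _ _ hu]
  simp

/-- The chain rule for polynomials, by induction on the polynomial. It makes the differential of `φ`
explicit, since `φ` is given only by real polynomials. -/
lemma hasDerivAt_aeval {σ : Type*} [Fintype σ] [DecidableEq σ] (p : MvPolynomial σ ℝ) {c : ℂ → σ → ℂ} {c' : σ → ℂ}
    {s : ℂ} (hc : ∀ a, HasDerivAt (fun t => c t a) (c' a) s) :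
    HasDerivAt (fun t => MvPolynomial.aeval (c t) p)
      (∑ a, MvPolynomial.aeval (c s) (MvPolynomial.pderiv a p) * c' a) s := by
  induction p using MvPolynomial.induction_on with
  | C r => simpa using hasDerivAt_const s (r : ℂ)
  | add p q hp hq =>
    simp only [map_add, add_mul, Finset.sum_add_distrib]
    exact hp.add hq
  | mul_X p a hp =>
    have := hp.mul (hc a)
    simp only [map_mul, MvPolynomial.aeval_X, Derivation.leibniz, MvPolynomial.pderiv_X, map_add, smul_eq_mul]
    refine this.congr_deriv ?_
    simp only [add_mul, Finset.sum_add_distrib, Finset.sum_mul]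
    rw [add_comm]
    congr 1
    · rw [Finset.sum_eq_single a]
      · simp
      · intro b _ hb; simp [Pi.single_eq_of_ne' hb]
      · simp
    · exact Finset.sum_congr rfl fun b _ => by ring

end MatrixExp

lemma eq_of_exp_smul_eq {n : ℕ} {ξ η : Matrix (Fin n) (Fin n) ℂ}
    (h : ∀ s : ℂ, NormedSpace.exp (s • ξ) = NormedSpace.exp (s • η)) : ξ = η := by
  ext i j
  have h1 := hasDerivAt_exp_smul_entry ξ 0 i j
  have h2 := hasDerivAt_exp_smul_entry η 0 i j
  simp only [h, zero_smul, matrix_exp_zero, mul_one] at h1 h2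
  exact h1.unique h2

lemma exp_smul_GL_conj {n : ℕ} (g : GL (Fin n) ℂ) (ξ : Matrix (Fin n) (Fin n) ℂ) (s : ℂ) :
    NormedSpace.exp (s • Ad g ξ) = Ad g (NormedSpace.exp (s • ξ)) := by
  have := Matrix.exp_units_conj g (s • ξ)
  simp only [Ad]
  rw [← this]; simp

/-! ### The adjoint action and Lie algebras of matrix groups -/

section AdLemmas
variable {n : ℕ}

lemma Ad_mul (g g' : GL (Fin n) ℂ) (ξ : Matrix (Fin n) (Fin n) ℂ) :
    Ad (g * g') ξ = Ad g (Ad g' ξ) := by simp [Ad, mul_assoc]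
@[simp] lemma Ad_one (ξ : Matrix (Fin n) (Fin n) ℂ) : Ad 1 ξ = ξ := by simp [Ad]
lemma Ad_add (g : GL (Fin n) ℂ) (ξ η : Matrix (Fin n) (Fin n) ℂ) : Ad g (ξ + η) = Ad g ξ + Ad g η := by
  simp [Ad, mul_add, add_mul]
lemma Ad_inv_Ad (g : GL (Fin n) ℂ) (ξ : Matrix (Fin n) (Fin n) ℂ) : Ad g⁻¹ (Ad g ξ) = ξ := by
  rw [← Ad_mul]; simp
lemma Ad_Ad_inv (g : GL (Fin n) ℂ) (ξ : Matrix (Fin n) (Fin n) ℂ) : Ad g (Ad g⁻¹ ξ) = ξ := by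
  rw [← Ad_mul]; simp

lemma Ad_eq_self_iff {g : GL (Fin n) ℂ} {ξ : Matrix (Fin n) (Fin n) ℂ} :
    Ad g ξ = ξ ↔ Commute (g : Matrix (Fin n) (Fin n) ℂ) ξ := by
  constructor
  · intro h
    have : (Ad g ξ) * (g : Matrix (Fin n) (Fin n) ℂ) = ξ * g := by rw [h]
    rw [Ad, mul_assoc, ← Units.val_mul, inv_mul_cancel, Units.val_one, mul_one] at this
    exact this
  · intro h
    rw [Ad, h.eq, mul_assoc, ← Units.val_mul, mul_inv_cancel, Units.val_one, mul_one]

lemma Ad_mem_lieAlg {K K' : Set (GL (Fin n) ℂ)} {g : GL (Fin n) ℂ}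
    (h : ∀ k ∈ K, g * k * g⁻¹ ∈ K') {ξ : Matrix (Fin n) (Fin n) ℂ} (hξ : ξ ∈ lieAlg K) :
    Ad g ξ ∈ lieAlg K' := by
  intro s
  obtain ⟨k, hk, e⟩ := hξ s
  exact ⟨_, h k hk, by rw [exp_smul_GL_conj, ← e]; simp [Ad]⟩

lemma lieAlg_mono {K K' : Set (GL (Fin n) ℂ)} (h : K ⊆ K') : lieAlg K ⊆ lieAlg K' := by
  intro ξ hξ s
  obtain ⟨k, hk, e⟩ := hξ s
  exact ⟨k, h hk, e⟩

lemma smul_mem_lieAlg {K : Set (GL (Fin n) ℂ)} {ξ : Matrix (Fin n) (Fin n) ℂ} (hξ : ξ ∈ lieAlg K)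
    (t : ℂ) : t • ξ ∈ lieAlg K := by
  intro s
  obtain ⟨k, hk, e⟩ := hξ (s * t)
  exact ⟨k, hk, by rw [e, smul_smul]⟩

lemma commute_of_mem_lieAlg {K : Set (GL (Fin n) ℂ)} {ξ M : Matrix (Fin n) (Fin n) ℂ}
    (h : ∀ k ∈ K, Commute (k : Matrix (Fin n) (Fin n) ℂ) M) (hξ : ξ ∈ lieAlg K) : Commute ξ M := by
  refine commute_of_commute_exp fun s => ?_
  obtain ⟨k, hk, e⟩ := hξ s
  rw [← e]; exact h k hk

/-- Commuting elements of the Lie algebra of a group may be added. -/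
lemma add_mem_lieAlg {K : Subgroup (GL (Fin n) ℂ)} {ξ η : Matrix (Fin n) (Fin n) ℂ}
    (hc : Commute ξ η) (hξ : ξ ∈ lieAlg (K : Set (GL (Fin n) ℂ)))
    (hη : η ∈ lieAlg (K : Set (GL (Fin n) ℂ))) : ξ + η ∈ lieAlg (K : Set (GL (Fin n) ℂ)) := by
  intro s
  obtain ⟨k, hk, e⟩ := hξ s
  obtain ⟨k', hk', e'⟩ := hη s
  refine ⟨k * k', K.mul_mem hk hk', ?_⟩
  rw [smul_add, Matrix.exp_add_of_commute _ _ ((hc.smul_left s).smul_right s)]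
  simp [e, e']

lemma commute_of_mem_lieAlg₂ {K K' : Set (GL (Fin n) ℂ)} {ξ η : Matrix (Fin n) (Fin n) ℂ}
    (h : ∀ k ∈ K, ∀ k' ∈ K', k * k' = k' * k) (hξ : ξ ∈ lieAlg K) (hη : η ∈ lieAlg K') :
    Commute ξ η := by
  refine commute_of_mem_lieAlg (fun k hk => ?_) hξ
  refine (commute_of_mem_lieAlg (fun k' hk' => ?_) hη).symm
  have := congrArg (fun u : GL (Fin n) ℂ => (u : Matrix (Fin n) (Fin n) ℂ)) (h k hk k' hk')
  simp only [Units.val_mul] at this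
  exact this.symm

lemma Ad_mul_Ad (g : GL (Fin n) ℂ) (ξ η : Matrix (Fin n) (Fin n) ℂ) : Ad g ξ * Ad g η = Ad g (ξ * η) := by
  have : ((g⁻¹ : GL (Fin n) ℂ) : Matrix (Fin n) (Fin n) ℂ) * (g : Matrix (Fin n) (Fin n) ℂ) = 1 := by
    rw [← Units.val_mul]; simp
  calc Ad g ξ * Ad g η = (g : Matrix (Fin n) (Fin n) ℂ) * ξ * (((g⁻¹ : GL (Fin n) ℂ) : Matrix (Fin n) (Fin n) ℂ) * g)
      * η * ((g⁻¹ : GL (Fin n) ℂ) : Matrix (Fin n) (Fin n) ℂ) := by simp only [Ad, mul_assoc]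
    _ = _ := by rw [this]; simp [Ad, mul_assoc]

end AdLemmas

lemma SL2_scalar_of_commute {A : Matrix (Fin 2) (Fin 2) ℂ}
    (h : ∀ ξ : Matrix (Fin 2) (Fin 2) ℂ, ξ.trace = 0 → A * ξ = ξ * A) :
    A 0 1 = 0 ∧ A 1 0 = 0 ∧ A 0 0 = A 1 1 := by
  have h1 := h !![0, 1; 0, 0] (by simp [Matrix.trace_fin_two])
  have h2 := h !![1, 0; 0, -1] (by simp [Matrix.trace_fin_two])
  have a := congrFun (congrFun h1 0) 1
  have b := congrFun (congrFun h2 0) 1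
  have c := congrFun (congrFun h2 1) 0
  simp [Matrix.mul_apply, Fin.sum_univ_two] at a b c
  refine ⟨?_, ?_, a⟩
  · linear_combination (-1/2) * b
  · linear_combination (1/2) * c

lemma SL2_eq_one_or_neg_one {A : SL(2, ℂ)} (h01 : A 0 1 = 0) (h10 : A 1 0 = 0) (h : A 0 0 = A 1 1) :
    A = 1 ∨ A = -1 := by
  have hd := A.2
  rw [Matrix.det_fin_two] at hd
  have hd' : A 0 0 * A 1 1 - A 0 1 * A 1 0 = 1 := hd
  have : A 1 1 * A 1 1 = 1 := by rw [h01, h] at hd'; linear_combination hd'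
  rcases mul_self_eq_one_iff.1 this with h' | h'
  · left; ext i j; fin_cases i <;> fin_cases j <;> simp [h01, h10, h, h']
  · right; ext i j; fin_cases i <;> fin_cases j <;> simp [h01, h10, h, h']

/-! ### The homomorphism `φ`, its differential, and the elements of `G`, `U`, `T`, `B` -/

namespace SplitRankOneGroup

variable {N : ℕ} (𝒢 : SplitRankOneGroup N)

/-- Polynomials defining `φ`. -/
def polyφ : Fin N → Fin N → MvPolynomial (Fin 2 × Fin 2) ℝ := 𝒢.φ_algebraic.choose

lemma φ_apply (A : SL(2, ℂ)) (i j : Fin N) : (𝒢.φ A : Matrix (Fin N) (Fin N) ℂ) i j =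
    MvPolynomial.aeval (fun ab : Fin 2 × Fin 2 => (A : Matrix (Fin 2) (Fin 2) ℂ) ab.1 ab.2)
      (𝒢.polyφ i j) := 𝒢.φ_algebraic.choose_spec A i j

/-- The differential of `φ` at the identity. -/
def dφ : Matrix (Fin 2) (Fin 2) ℂ →ₗ[ℂ] Matrix (Fin N) (Fin N) ℂ where
  toFun ξ := Matrix.of fun i j => ∑ a, MvPolynomial.aeval
    (fun ab : Fin 2 × Fin 2 => (1 : Matrix (Fin 2) (Fin 2) ℂ) ab.1 ab.2)
    (MvPolynomial.pderiv a (𝒢.polyφ i j)) * ξ a.1 a.2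
  map_add' ξ η := by
    ext i j; simp [mul_add, Finset.sum_add_distrib]
  map_smul' t ξ := by
    ext i j; simp only [Matrix.of_apply, Matrix.smul_apply, smul_eq_mul, RingHom.id_apply,
      Finset.mul_sum]
    exact Finset.sum_congr rfl fun b _ => by ring

/-- Both sides are one-parameter groups, so it suffices to compare derivatives at `0`. Vanishing
trace is what keeps the exponential inside `SL₂`. -/
lemma φ_expSL {ξ : Matrix (Fin 2) (Fin 2) ℂ} (h : ξ.trace = 0) (s : ℂ) :
    (𝒢.φ (expSL ξ h s) : Matrix (Fin N) (Fin N) ℂ) = NormedSpace.exp (s • 𝒢.dφ ξ) := by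
  refine eq_exp_smul_of_add_mul (Φ := fun s => (𝒢.φ (expSL ξ h s) : Matrix (Fin N) (Fin N) ℂ))
    ?_ ?_ ?_ s
  · simp [expSL_zero]
  · intro s t; simp [expSL_add]
  · intro i j
    simp only [φ_apply]
    have := hasDerivAt_aeval (𝒢.polyφ i j)
      (c := fun t ab => (expSL ξ h t : Matrix (Fin 2) (Fin 2) ℂ) ab.1 ab.2)
      (c' := fun ab => ξ ab.1 ab.2) (s := 0) (fun a => by
        have := hasDerivAt_exp_smul_entry ξ 0 a.1 a.2
        simp only [zero_smul, matrix_exp_zero, mul_one] at this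
        exact this)
    refine this.congr_deriv ?_
    simp [dφ, expSL_zero]

lemma trace_conj (A : SL(2, ℂ)) (ξ : Matrix (Fin 2) (Fin 2) ℂ) :
    ((A : Matrix (Fin 2) (Fin 2) ℂ) * ξ * (A⁻¹ : SL(2, ℂ))).trace = ξ.trace := by
  rw [Matrix.trace_mul_comm, ← mul_assoc, ← Matrix.SpecialLinearGroup.coe_mul]; simp

lemma Ad_φ_dφ (A : SL(2, ℂ)) {ξ : Matrix (Fin 2) (Fin 2) ℂ} (h : ξ.trace = 0) :
    Ad (𝒢.φ A) (𝒢.dφ ξ) = 𝒢.dφ (A * ξ * (A⁻¹ : SL(2, ℂ))) := by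
  apply eq_of_exp_smul_eq
  intro s
  have h' := (trace_conj A ξ).trans h
  rw [exp_smul_GL_conj, ← φ_expSL _ h, ← φ_expSL _ h', expSL_conj h]
  simp [Ad]

/-- The kernel of `φ` is central, so `exp (s ξ)` is central for all `s`. Then `ξ` commutes with two
opposite unipotents and is scalar, and trace zero finishes. -/
lemma dφ_eq_zero {ξ : Matrix (Fin 2) (Fin 2) ℂ} (h : ξ.trace = 0) (h0 : 𝒢.dφ ξ = 0) : ξ = 0 := by
  have key : ∀ M : SL(2, ℂ), Commute ξ (M : Matrix (Fin 2) (Fin 2) ℂ) := by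
    intro M
    refine commute_of_commute_exp fun s => ?_
    have h1 : expSL ξ h s ∈ Subgroup.center SL(2, ℂ) := by
      apply 𝒢.φ_ker
      rw [MonoidHom.mem_ker]
      apply Units.ext
      rw [φ_expSL, h0]; simp
    have h2 := Subgroup.mem_center_iff.1 h1 M
    exact (congrArg (fun u : SL(2, ℂ) => (u : Matrix (Fin 2) (Fin 2) ℂ)) h2).symm
  have k1 := (key ⟨!![1, 1; 0, 1], by simp [Matrix.det_fin_two]⟩).eq
  have k2 := (key ⟨!![1, 0; 1, 1], by simp [Matrix.det_fin_two]⟩).eq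
  have a := congrFun (congrFun k1 0) 1
  have b := congrFun (congrFun k1 0) 0
  have c := congrFun (congrFun k2 0) 0
  rw [Matrix.trace_fin_two] at h
  simp [Matrix.mul_apply, Fin.sum_univ_two] at a b c
  have d0 : ξ 0 0 = 0 := by linear_combination (1/2) * h + (1/2) * a
  have d1 : ξ 1 1 = 0 := by linear_combination (1/2) * h - (1/2) * a
  ext i j; fin_cases i <;> fin_cases j <;> simp [b, c, d0, d1]

lemma dφ_inj {ξ η : Matrix (Fin 2) (Fin 2) ℂ} (h : ξ.trace = 0) (h' : η.trace = 0)
    (e : 𝒢.dφ ξ = 𝒢.dφ η) : ξ = η := by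
  rw [← sub_eq_zero]
  exact 𝒢.dφ_eq_zero (by simp [h, h']) (by simp [e])

lemma exists_C_form : ∃ (k : ℕ) (P : GL (Fin N) ℂ) (m : Fin N → Fin k → ℤ), P ∈ realGL N ∧
    ∀ g : GL (Fin N) ℂ, g ∈ 𝒢.C ↔ ∃ t : Fin k → ℂˣ, (g : Matrix (Fin N) (Fin N) ℂ) =
      Ad P (Matrix.diagonal (fun i => ∏ j, ((t j ^ m i j : ℂˣ) : ℂ))) := by
  obtain ⟨k, P, m, hC⟩ := 𝒢.C_split
  refine ⟨k, Matrix.GeneralLinearGroup.map Complex.ofRealHom P, m, ?_, fun g => ?_⟩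
  · change conjGL N _ = _
    ext i j
    simp [conjGL]
  · rw [hC]
    simp only [Ad, ← map_inv]
    rfl

lemma C_comm {c c' : GL (Fin N) ℂ} (hc : c ∈ 𝒢.C) (hc' : c' ∈ 𝒢.C) : c * c' = c' * c := by
  obtain ⟨k, P, m, -, hC⟩ := 𝒢.exists_C_form
  obtain ⟨t, ht⟩ := (hC c).1 hc
  obtain ⟨t', ht'⟩ := (hC c').1 hc'
  apply Units.ext
  rw [Units.val_mul, Units.val_mul, ht, ht', Ad_mul_Ad, Ad_mul_Ad]
  simp [mul_comm]

lemma conj_mem_C {c : GL (Fin N) ℂ} (hc : c ∈ 𝒢.C) : conjGL N c ∈ 𝒢.C := by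
  obtain ⟨k, P, m, hP, hC⟩ := 𝒢.exists_C_form
  obtain ⟨t, ht⟩ := (hC c).1 hc
  have hP : conjGL N P = P := hP
  refine (hC _).2 ⟨fun j => Units.map (starRingEnd ℂ : ℂ →* ℂ) (t j), ?_⟩
  have h1 : ((conjGL N c : GL (Fin N) ℂ) : Matrix (Fin N) (Fin N) ℂ) =
    (starRingEnd ℂ).mapMatrix (c : Matrix (Fin N) (Fin N) ℂ) := rfl
  have h2 : (starRingEnd ℂ).mapMatrix (P : Matrix (Fin N) (Fin N) ℂ) = P :=
    congrArg (fun u : GL (Fin N) ℂ => (u : Matrix (Fin N) (Fin N) ℂ)) hP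
  have h3 : (starRingEnd ℂ).mapMatrix ((P⁻¹ : GL (Fin N) ℂ) : Matrix (Fin N) (Fin N) ℂ) = (P⁻¹ : GL (Fin N) ℂ) :=
    congrArg (fun u : GL (Fin N) ℂ => (u : Matrix (Fin N) (Fin N) ℂ))
      (show conjGL N P⁻¹ = P⁻¹ by rw [map_inv, hP])
  rw [h1, ht, Ad, map_mul, map_mul, h2, h3, Ad]
  congr 2
  ext i j
  by_cases hij : i = j
  · subst hij; simp
  · simp [hij]

/-- Elements of `S ⊔ C`, for `S` contained in the derived group. -/
lemma mem_sup_C {S : Subgroup (GL (Fin N) ℂ)} (hS : S ≤ 𝒢.φ.range) {g : GL (Fin N) ℂ} :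
    g ∈ S ⊔ 𝒢.C ↔ ∃ s ∈ S, ∃ c ∈ 𝒢.C, g = s * c := by
  constructor
  · intro h
    rw [Subgroup.sup_eq_closure] at h
    induction h using Subgroup.closure_induction with
    | mem x hx =>
      rcases hx with hx | hx
      · exact ⟨x, hx, 1, 𝒢.C.one_mem, by simp⟩
      · exact ⟨1, S.one_mem, x, hx, by simp⟩
    | inv x _ hx =>
      obtain ⟨s, hs, c, hc, rfl⟩ := hx
      obtain ⟨A, rfl⟩ := hS hs
      exact ⟨_, S.inv_mem hs, _, 𝒢.C.inv_mem hc, by rw [mul_inv_rev, ← mul_inv_rev, ← 𝒢.C_central c hc]; simp⟩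
    | one => exact ⟨1, S.one_mem, 1, 𝒢.C.one_mem, by simp⟩
    | mul x y _ _ hx hy =>
      obtain ⟨s, hs, c, hc, rfl⟩ := hx
      obtain ⟨s', hs', c', hc', rfl⟩ := hy
      obtain ⟨A, rfl⟩ := hS hs'
      refine ⟨s * 𝒢.φ A, S.mul_mem hs hs', c * c', 𝒢.C.mul_mem hc hc', ?_⟩
      rw [mul_assoc, ← mul_assoc c, 𝒢.C_central c hc A]; group
  · rintro ⟨s, hs, c, hc, rfl⟩
    exact Subgroup.mul_mem_sup hs hc

lemma mem_G {g : GL (Fin N) ℂ} : g ∈ 𝒢.G ↔ ∃ A, ∃ c ∈ 𝒢.C, g = 𝒢.φ A * c := by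
  rw [𝒢.G_eq, 𝒢.mem_sup_C le_rfl]
  constructor
  · rintro ⟨_, ⟨A, rfl⟩, c, hc, rfl⟩; exact ⟨A, c, hc, rfl⟩
  · rintro ⟨A, c, hc, rfl⟩; exact ⟨_, ⟨A, rfl⟩, c, hc, rfl⟩

/-- Shows that the closures in the definitions of `U`, `T` and `B` add nothing to their generating
sets. -/
lemma mem_closure_φ {S : SL(2, ℂ) → Prop} (h1 : S 1) (hmul : ∀ A B, S A → S B → S (A * B))
    (hinv : ∀ A, S A → S A⁻¹) {g : GL (Fin N) ℂ} :
    g ∈ Subgroup.closure {g | ∃ A : SL(2, ℂ), S A ∧ g = 𝒢.φ A} ↔ ∃ A, S A ∧ g = 𝒢.φ A := by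
  constructor
  · intro h
    induction h using Subgroup.closure_induction with
    | mem x hx => exact hx
    | one => exact ⟨1, h1, by simp⟩
    | mul x y _ _ hx hy =>
      obtain ⟨A, hA, rfl⟩ := hx
      obtain ⟨B, hB, rfl⟩ := hy
      exact ⟨A * B, hmul A B hA hB, by simp⟩
    | inv x _ hx =>
      obtain ⟨A, hA, rfl⟩ := hx
      exact ⟨A⁻¹, hinv A hA, by simp⟩
  · exact fun h => Subgroup.subset_closure h

lemma closure_φ_le (S : SL(2, ℂ) → Prop) :
    Subgroup.closure {g | ∃ A : SL(2, ℂ), S A ∧ g = 𝒢.φ A} ≤ 𝒢.φ.range := by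
  rw [Subgroup.closure_le]
  rintro _ ⟨A, -, rfl⟩; exact ⟨A, rfl⟩

lemma SL2_mul_apply (A B : SL(2, ℂ)) (i j : Fin 2) : (A * B) i j = A i 0 * B 0 j + A i 1 * B 1 j := by
  simp [Matrix.mul_apply, Fin.sum_univ_two]

lemma SL2_inv_00 (A : SL(2, ℂ)) : A⁻¹ 0 0 = A 1 1 := by
  simp [Matrix.SpecialLinearGroup.SL2_inv_expl]
lemma SL2_inv_01 (A : SL(2, ℂ)) : A⁻¹ 0 1 = - A 0 1 := by
  simp [Matrix.SpecialLinearGroup.SL2_inv_expl]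
lemma SL2_inv_10 (A : SL(2, ℂ)) : A⁻¹ 1 0 = - A 1 0 := by
  simp [Matrix.SpecialLinearGroup.SL2_inv_expl]
lemma SL2_inv_11 (A : SL(2, ℂ)) : A⁻¹ 1 1 = A 0 0 := by
  simp [Matrix.SpecialLinearGroup.SL2_inv_expl]
lemma SL2_det (A : SL(2, ℂ)) : A 0 0 * A 1 1 - A 0 1 * A 1 0 = 1 := by
  have := A.2
  rw [Matrix.det_fin_two] at this
  exact this

lemma mem_U {g : GL (Fin N) ℂ} :
    g ∈ 𝒢.U ↔ ∃ A : SL(2, ℂ), A 1 0 = 0 ∧ A 0 0 = 1 ∧ A 1 1 = 1 ∧ g = 𝒢.φ A := by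
  have := 𝒢.mem_closure_φ (S := fun A => A 1 0 = 0 ∧ A 0 0 = 1 ∧ A 1 1 = 1) (g := g)
    (by simp) (by rintro A B ⟨h1, h2, h3⟩ ⟨h4, h5, h6⟩; simp [SL2_mul_apply, *])
    (by rintro A ⟨h1, h2, h3⟩; simp only [SL2_inv_00, SL2_inv_10, SL2_inv_11, *]; simp)
  simp only [and_assoc] at this
  exact this

lemma mem_T {g : GL (Fin N) ℂ} :
    g ∈ 𝒢.T ↔ ∃ A : SL(2, ℂ), A 1 0 = 0 ∧ A 0 1 = 0 ∧ ∃ c ∈ 𝒢.C, g = 𝒢.φ A * c := by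
  have h := fun g => 𝒢.mem_closure_φ (S := fun A => A 1 0 = 0 ∧ A 0 1 = 0) (g := g)
    (by simp) (by rintro A B ⟨h1, h2⟩ ⟨h4, h5⟩; simp [SL2_mul_apply, *])
    (by rintro A ⟨h1, h2⟩; simp only [SL2_inv_01, SL2_inv_10, *]; simp)
  have h' := 𝒢.closure_φ_le (fun A => A 1 0 = 0 ∧ A 0 1 = 0)
  simp only [and_assoc] at h h'
  rw [T, 𝒢.mem_sup_C h']
  simp only [h]
  constructor
  · rintro ⟨_, ⟨A, h1, h2, rfl⟩, c, hc, rfl⟩; exact ⟨A, h1, h2, c, hc, rfl⟩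
  · rintro ⟨A, h1, h2, c, hc, rfl⟩; exact ⟨_, ⟨A, h1, h2, rfl⟩, c, hc, rfl⟩

lemma mem_B {g : GL (Fin N) ℂ} :
    g ∈ 𝒢.B ↔ ∃ A : SL(2, ℂ), A 1 0 = 0 ∧ ∃ c ∈ 𝒢.C, g = 𝒢.φ A * c := by
  have h := fun g => 𝒢.mem_closure_φ (S := fun A => A 1 0 = 0) (g := g)
    (by simp) (by rintro A B h1 h4; simp [SL2_mul_apply, *])
    (by rintro A h1; simp only [SL2_inv_10, *]; simp)
  have h' := 𝒢.closure_φ_le (fun A => A 1 0 = 0)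
  rw [B, 𝒢.mem_sup_C h']
  simp only [h]
  constructor
  · rintro ⟨_, ⟨A, h1, rfl⟩, c, hc, rfl⟩; exact ⟨A, h1, c, hc, rfl⟩
  · rintro ⟨A, h1, c, hc, rfl⟩; exact ⟨_, ⟨A, h1, rfl⟩, c, hc, rfl⟩

lemma commute_C_dφ {c : GL (Fin N) ℂ} (hc : c ∈ 𝒢.C) {ξ : Matrix (Fin 2) (Fin 2) ℂ} (h : ξ.trace = 0) :
    Commute (c : Matrix (Fin N) (Fin N) ℂ) (𝒢.dφ ξ) := by
  refine (commute_of_commute_exp fun s => ?_).symm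
  rw [← 𝒢.φ_expSL h]
  have := congrArg (fun u : GL (Fin N) ℂ => (u : Matrix (Fin N) (Fin N) ℂ))
    (𝒢.C_central c hc (expSL ξ h s))
  simp only [Units.val_mul] at this
  exact this.symm

lemma Ad_C_dφ {c : GL (Fin N) ℂ} (hc : c ∈ 𝒢.C) {ξ : Matrix (Fin 2) (Fin 2) ℂ} (h : ξ.trace = 0) :
    Ad c (𝒢.dφ ξ) = 𝒢.dφ ξ := Ad_eq_self_iff.2 (𝒢.commute_C_dφ hc h)

/-- The elements of the derived group that act on its Lie algebra as scalars are central. -/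
lemma eq_one_or_neg_one_of_Ad {A : SL(2, ℂ)}
    (h : ∀ ξ : Matrix (Fin 2) (Fin 2) ℂ, ξ.trace = 0 → Ad (𝒢.φ A) (𝒢.dφ ξ) = 𝒢.dφ ξ) :
    A = 1 ∨ A = -1 := by
  obtain ⟨h1, h2, h3⟩ := SL2_scalar_of_commute (A := A) (fun ξ hξ => by
    have := h ξ hξ
    rw [𝒢.Ad_φ_dφ A hξ] at this
    have := 𝒢.dφ_inj ((trace_conj A ξ).trans hξ) hξ this
    conv_rhs => rw [← this]
    rw [mul_assoc, mul_assoc, ← Matrix.SpecialLinearGroup.coe_mul]; simp)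
  exact SL2_eq_one_or_neg_one h1 h2 h3

/-- `φ(A'⁻¹ A)` lies in `C`, so it acts trivially on `dφ(𝔰𝔩₂)` and `A'⁻¹ A = ±1`. This sign is the
only ambiguity in the `SL₂`-component of an element of `G`. -/
lemma eq_or_eq_neg {A A' : SL(2, ℂ)} {c c' : GL (Fin N) ℂ} (hc : c ∈ 𝒢.C) (hc' : c' ∈ 𝒢.C)
    (h : 𝒢.φ A * c = 𝒢.φ A' * c') : A = A' ∨ A = -A' := by
  have h1 : 𝒢.φ (A'⁻¹ * A) = c' * c⁻¹ := by
    rw [map_mul, map_inv, eq_mul_inv_iff_mul_eq, mul_assoc, h]; group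
  have h2 := 𝒢.eq_one_or_neg_one_of_Ad (A := A'⁻¹ * A) (fun ξ hξ => by
    rw [h1]; exact 𝒢.Ad_C_dφ (𝒢.C.mul_mem hc' (𝒢.C.inv_mem hc)) hξ)
  rcases h2 with h2 | h2
  · left; exact (inv_mul_eq_one.1 h2).symm
  · right; rw [inv_mul_eq_iff_eq_mul] at h2; rw [h2]; simp

end SplitRankOneGroup

/-! ### Commutators as derivatives of conjugation; basis of `𝔰𝔩₂`; conjugation -/

section
open scoped Matrix.Norms.Operator

lemma hasDerivAt_exp_conj {n : ℕ} (ξ M : Matrix (Fin n) (Fin n) ℂ) :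
    HasDerivAt (fun s : ℂ => NormedSpace.exp (s • ξ) * M * NormedSpace.exp (-s • ξ))
      (ξ * M - M * ξ) 0 := by
  have a := (hasDerivAt_exp_smul_const ξ (0 : ℂ)).mul_const M
  have b := HasDerivAt.scomp (0 : ℂ) (hasDerivAt_exp_smul_const ξ (-0 : ℂ)) (hasDerivAt_neg 0)
  refine (a.mul b).congr_deriv ?_
  rw [neg_one_smul]
  change _ * M * NormedSpace.exp (-(0:ℂ) • ξ) + _ * M * _ = _
  simp [sub_eq_add_neg]

/-- The differential of a linear map intertwining two one-parameter groups of conjugations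
intertwines the commutators. -/
lemma linearMap_commutator {n m : ℕ} {ξ M : Matrix (Fin n) (Fin n) ℂ} {η M' : Matrix (Fin m) (Fin m) ℂ}
    {Λ : Matrix (Fin n) (Fin n) ℂ →ₗ[ℂ] Matrix (Fin m) (Fin m) ℂ}
    (h : ∀ s : ℂ, Λ (NormedSpace.exp (s • ξ) * M * NormedSpace.exp (-s • ξ)) =
      NormedSpace.exp (s • η) * M' * NormedSpace.exp (-s • η)) :
    Λ (ξ * M - M * ξ) = η * M' - M' * η := by
  have h2 := (Λ.toContinuousLinearMap.hasFDerivAt).comp_hasDerivAt 0 (hasDerivAt_exp_conj ξ M)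
  have h3 : (Λ.toContinuousLinearMap ∘ fun s : ℂ => NormedSpace.exp (s • ξ) * M * NormedSpace.exp (-s • ξ)) =
    fun s => NormedSpace.exp (s • η) * M' * NormedSpace.exp (-s • η) := funext h
  rw [h3] at h2
  exact h2.unique (hasDerivAt_exp_conj η M')

lemma linearMap_commutator_eq_zero {n : ℕ} {ξ M : Matrix (Fin n) (Fin n) ℂ}
    {Λ : Matrix (Fin n) (Fin n) ℂ →ₗ[ℂ] Matrix (Fin n) (Fin n) ℂ}
    (h : ∀ s : ℂ, Λ (NormedSpace.exp (s • ξ) * M * NormedSpace.exp (-s • ξ)) = 0) :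
    Λ (ξ * M - M * ξ) = 0 := by
  have h2 := (Λ.toContinuousLinearMap.hasFDerivAt).comp_hasDerivAt 0 (hasDerivAt_exp_conj ξ M)
  have h3 : (Λ.toContinuousLinearMap ∘ fun s : ℂ => NormedSpace.exp (s • ξ) * M * NormedSpace.exp (-s • ξ)) =
    fun _ => 0 := funext h
  rw [h3] at h2
  exact h2.unique (hasDerivAt_const 0 0)

end

/-- The strictly upper triangular basis vector of `𝔰𝔩₂`. -/
def slE : Matrix (Fin 2) (Fin 2) ℂ := !![0, 1; 0, 0]
/-- The diagonal basis vector of `𝔰𝔩₂`. -/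
def slH : Matrix (Fin 2) (Fin 2) ℂ := !![1, 0; 0, -1]
/-- The strictly lower triangular basis vector of `𝔰𝔩₂`. -/
def slF : Matrix (Fin 2) (Fin 2) ℂ := !![0, 0; 1, 0]

@[simp] lemma trace_slE : slE.trace = 0 := by simp [slE, Matrix.trace_fin_two]
@[simp] lemma trace_slH : slH.trace = 0 := by simp [slH, Matrix.trace_fin_two]
@[simp] lemma trace_slF : slF.trace = 0 := by simp [slF, Matrix.trace_fin_two]

lemma eq_slE_slH_slF {a : Matrix (Fin 2) (Fin 2) ℂ} (h : a.trace = 0) :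
    a = a 0 1 • slE + a 0 0 • slH + a 1 0 • slF := by
  rw [Matrix.trace_fin_two] at h
  ext i j; fin_cases i <;> fin_cases j <;> simp [slE, slH, slF]
  linear_combination h

/-- Entrywise complex conjugation of matrices. -/
def conjM {n : ℕ} : Matrix (Fin n) (Fin n) ℂ →+* Matrix (Fin n) (Fin n) ℂ := (starRingEnd ℂ).mapMatrix

@[simp] lemma conjM_apply {n : ℕ} (ξ : Matrix (Fin n) (Fin n) ℂ) (i j : Fin n) :
    conjM ξ i j = starRingEnd ℂ (ξ i j) := rfl

lemma isRealMatrix_iff {n : ℕ} {ξ : Matrix (Fin n) (Fin n) ℂ} : IsRealMatrix ξ ↔ conjM ξ = ξ := by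
  constructor
  · intro h; ext i j; exact h i j
  · intro h i j; exact congrFun (congrFun h i) j

lemma conjM_smul {n : ℕ} (t : ℂ) (ξ : Matrix (Fin n) (Fin n) ℂ) :
    conjM (t • ξ) = starRingEnd ℂ t • conjM ξ := by ext i j; simp

@[simp] lemma conjM_conjM {n : ℕ} (ξ : Matrix (Fin n) (Fin n) ℂ) : conjM (conjM ξ) = ξ := by ext i j; simp

lemma coe_conjGL {n : ℕ} (g : GL (Fin n) ℂ) :
    (conjGL n g : Matrix (Fin n) (Fin n) ℂ) = conjM (g : Matrix (Fin n) (Fin n) ℂ) := rfl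

lemma conjM_exp {n : ℕ} (ξ : Matrix (Fin n) (Fin n) ℂ) :
    conjM (NormedSpace.exp ξ) = NormedSpace.exp (conjM ξ) := by
  have h (M : Matrix (Fin n) (Fin n) ℂ) : conjM M = M.conjTranspose.transpose := by ext i j; simp
  rw [h, h, Matrix.exp_transpose, Matrix.exp_conjTranspose]

lemma conjM_Ad {n : ℕ} (g : GL (Fin n) ℂ) (ξ : Matrix (Fin n) (Fin n) ℂ) :
    conjM (Ad g ξ) = Ad (conjGL n g) (conjM ξ) := by
  simp only [Ad, map_mul, ← map_inv]; rfl

lemma conjM_mem_lieAlg {n : ℕ} {K : Subgroup (GL (Fin n) ℂ)} (hK : ∀ k ∈ K, conjGL n k ∈ K)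
    {ξ : Matrix (Fin n) (Fin n) ℂ} (hξ : ξ ∈ lieAlg (K : Set (GL (Fin n) ℂ))) :
    conjM ξ ∈ lieAlg (K : Set (GL (Fin n) ℂ)) := by
  intro s
  obtain ⟨k, hk, e⟩ := hξ (starRingEnd ℂ s)
  exact ⟨_, hK k hk, by rw [coe_conjGL, e, conjM_exp, conjM_smul]; simp⟩

lemma conj_aeval {σ : Type*} (p : MvPolynomial σ ℝ) (f : σ → ℂ) :
    starRingEnd ℂ (MvPolynomial.aeval f p) = MvPolynomial.aeval (fun a => starRingEnd ℂ (f a)) p := by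
  induction p using MvPolynomial.induction_on with
  | C r => simp
  | add p q hp hq => simp [hp, hq]
  | mul_X p a hp => simp [hp]

/-- Complex conjugation on `SL₂`. -/
def conjSL : SL(2, ℂ) →* SL(2, ℂ) := Matrix.SpecialLinearGroup.map (starRingEnd ℂ)

@[simp] lemma conjSL_apply (A : SL(2, ℂ)) (i j : Fin 2) : conjSL A i j = starRingEnd ℂ (A i j) := rfl

lemma eq_zero_of_commute_SL2 {ξ : Matrix (Fin 2) (Fin 2) ℂ} (h : ξ.trace = 0)
    (key : ∀ M : SL(2, ℂ), Commute ξ (M : Matrix (Fin 2) (Fin 2) ℂ)) : ξ = 0 := by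
  have k1 := (key ⟨!![1, 1; 0, 1], by simp [Matrix.det_fin_two]⟩).eq
  have k2 := (key ⟨!![1, 0; 1, 1], by simp [Matrix.det_fin_two]⟩).eq
  have a := congrFun (congrFun k1 0) 1
  have b := congrFun (congrFun k1 0) 0
  have c := congrFun (congrFun k2 0) 0
  rw [Matrix.trace_fin_two] at h
  simp [Matrix.mul_apply, Fin.sum_univ_two] at a b c
  have d0 : ξ 0 0 = 0 := by linear_combination (1/2) * h + (1/2) * a
  have d1 : ξ 1 1 = 0 := by linear_combination (1/2) * h - (1/2) * a
  ext i j; fin_cases i <;> fin_cases j <;> simp [b, c, d0, d1]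

/-! ### Compatibility with complex conjugation, and the Lie algebra of the centre -/

namespace SplitRankOneGroup

variable {N : ℕ} (𝒢 : SplitRankOneGroup N)

lemma conj_φ (A : SL(2, ℂ)) : conjGL N (𝒢.φ A) = 𝒢.φ (conjSL A) := by
  ext i j
  rw [coe_conjGL, conjM_apply, φ_apply, φ_apply, conj_aeval]
  rfl

lemma conjM_dφ (ξ : Matrix (Fin 2) (Fin 2) ℂ) : conjM (𝒢.dφ ξ) = 𝒢.dφ (conjM ξ) := by
  ext i j
  simp only [dφ, conjM_apply, LinearMap.coe_mk, AddHom.coe_mk, Matrix.of_apply, map_sum, map_mul,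
    conj_aeval]
  refine Finset.sum_congr rfl fun a _ => ?_
  congr 3
  funext b
  rw [Matrix.one_apply]; split_ifs <;> simp

/-- A linear left inverse of `dφ` on traceless matrices, with traceless values. -/
lemma exists_ψ : ∃ ψ : Matrix (Fin N) (Fin N) ℂ →ₗ[ℂ] Matrix (Fin 2) (Fin 2) ℂ,
    (∀ ξ, (ψ ξ).trace = 0) ∧ ∀ a, a.trace = 0 → ψ (𝒢.dφ a) = a := by
  let L := LinearMap.ker (Matrix.traceLinearMap (Fin 2) ℂ ℂ)
  obtain ⟨ψ, hψ⟩ := LinearMap.exists_leftInverse_of_injective (𝒢.dφ.comp L.subtype) (by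
    rw [LinearMap.ker_eq_bot']
    intro m hm
    apply Subtype.ext
    exact 𝒢.dφ_eq_zero (LinearMap.mem_ker.1 m.2) (by simpa using hm))
  refine ⟨L.subtype.comp ψ, fun ξ => ?_, fun a ha => ?_⟩
  · exact LinearMap.mem_ker.1 (ψ ξ).2
  · have := LinearMap.congr_fun hψ ⟨a, by simpa [L] using ha⟩
    simpa using congrArg Subtype.val this

/-- The chosen linear left inverse of `dφ`. -/
def ψ : Matrix (Fin N) (Fin N) ℂ →ₗ[ℂ] Matrix (Fin 2) (Fin 2) ℂ := 𝒢.exists_ψ.choose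
lemma trace_ψ (ξ : Matrix (Fin N) (Fin N) ℂ) : (𝒢.ψ ξ).trace = 0 := 𝒢.exists_ψ.choose_spec.1 ξ
lemma ψ_dφ {a : Matrix (Fin 2) (Fin 2) ℂ} (ha : a.trace = 0) : 𝒢.ψ (𝒢.dφ a) = a :=
  𝒢.exists_ψ.choose_spec.2 a ha

lemma φ_neg_one_sq (A : SL(2, ℂ)) (h : A = 1 ∨ A = -1) : 𝒢.φ A * 𝒢.φ A = 1 := by
  rw [← map_mul]; rcases h with rfl | rfl <;> simp

lemma commute_dφ {a b : Matrix (Fin 2) (Fin 2) ℂ} (ha : a.trace = 0) (hb : b.trace = 0)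
    (h : Commute (𝒢.dφ a) (𝒢.dφ b)) : Commute a b := by
  refine commute_of_commute_exp fun s => ?_
  have h1 : Ad (𝒢.φ (expSL a ha s)) (𝒢.dφ b) = 𝒢.dφ b := by
    rw [Ad_eq_self_iff, φ_expSL]
    have := (h.smul_left s).symm
    exact this.symm.exp_left
  rw [𝒢.Ad_φ_dφ _ hb] at h1
  have h2 := 𝒢.dφ_inj ((trace_conj _ b).trans hb) hb h1
  change (expSL a ha s : Matrix (Fin 2) (Fin 2) ℂ) * b = b * (expSL a ha s : Matrix (Fin 2) (Fin 2) ℂ)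
  conv_rhs => rw [← h2]
  rw [mul_assoc, mul_assoc, ← Matrix.SpecialLinearGroup.coe_mul]; simp

lemma zero_mem_lieAlg (K : Subgroup (GL (Fin N) ℂ)) : (0 : Matrix (Fin N) (Fin N) ℂ) ∈ lieAlg (K : Set (GL (Fin N) ℂ)) :=
  fun s => ⟨1, K.one_mem, by simp⟩

/-- The Lie algebra of a commutative subgroup. -/
def lieComm (K : Subgroup (GL (Fin N) ℂ)) (hK : ∀ k ∈ K, ∀ k' ∈ K, k * k' = k' * k) :
    Submodule ℂ (Matrix (Fin N) (Fin N) ℂ) where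
  carrier := lieAlg (K : Set (GL (Fin N) ℂ))
  zero_mem' := zero_mem_lieAlg K
  add_mem' h h' := add_mem_lieAlg (commute_of_mem_lieAlg₂ hK h h') h h'
  smul_mem' t _ h := smul_mem_lieAlg h t

/-- The Lie algebra of the connected centre. -/
def lieC : Submodule ℂ (Matrix (Fin N) (Fin N) ℂ) := lieComm 𝒢.C fun _ h _ h' => 𝒢.C_comm h h'

lemma mem_lieC {ξ : Matrix (Fin N) (Fin N) ℂ} : ξ ∈ 𝒢.lieC ↔ ξ ∈ lieAlg (𝒢.C : Set (GL (Fin N) ℂ)) := Iff.rfl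

lemma C_le_G : 𝒢.C ≤ 𝒢.G := by rw [𝒢.G_eq]; exact le_sup_right
lemma range_le_G : 𝒢.φ.range ≤ 𝒢.G := by rw [𝒢.G_eq]; exact le_sup_left
lemma φ_mem_G (A : SL(2, ℂ)) : 𝒢.φ A ∈ 𝒢.G := 𝒢.range_le_G ⟨A, rfl⟩
lemma T_le_G : 𝒢.T ≤ 𝒢.G := by
  intro g hg
  obtain ⟨A, -, -, c, hc, rfl⟩ := 𝒢.mem_T.1 hg
  exact 𝒢.mem_G.2 ⟨A, c, hc, rfl⟩
lemma U_le_range : 𝒢.U ≤ 𝒢.φ.range := by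
  intro g hg
  obtain ⟨A, -, -, -, rfl⟩ := 𝒢.mem_U.1 hg
  exact ⟨A, rfl⟩

lemma dφ_mem_lieAlg_range {a : Matrix (Fin 2) (Fin 2) ℂ} (ha : a.trace = 0) :
    𝒢.dφ a ∈ lieAlg (𝒢.φ.range : Set (GL (Fin N) ℂ)) :=
  fun s => ⟨_, ⟨expSL a ha s, rfl⟩, 𝒢.φ_expSL ha s⟩

/-- Passing to `s / 2` and squaring removes the sign ambiguity of the `SL₂`-component. -/
lemma exp_half_sq {n : ℕ} (ξ : Matrix (Fin n) (Fin n) ℂ) (s : ℂ) :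
    NormedSpace.exp (s • ξ) = NormedSpace.exp ((s/2) • ξ) * NormedSpace.exp ((s/2) • ξ) := by
  rw [← exp_add_smul]; congr 2; ring

lemma commute_lieC_dφ {z : Matrix (Fin N) (Fin N) ℂ} (hz : z ∈ 𝒢.lieC) {a : Matrix (Fin 2) (Fin 2) ℂ}
    (ha : a.trace = 0) : Commute z (𝒢.dφ a) :=
  commute_of_mem_lieAlg (fun _ hk => 𝒢.commute_C_dφ hk ha) hz

lemma Ad_lieC {g : GL (Fin N) ℂ} (hg : g ∈ 𝒢.G) {z : Matrix (Fin N) (Fin N) ℂ} (hz : z ∈ 𝒢.lieC) : Ad g z = z := by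
  rw [Ad_eq_self_iff]
  refine (commute_of_mem_lieAlg (fun c hc => ?_) hz).symm
  obtain ⟨A, c', hc', rfl⟩ := 𝒢.mem_G.1 hg
  have : c * (𝒢.φ A * c') = 𝒢.φ A * c' * c := by
    rw [← mul_assoc, 𝒢.C_central c hc, mul_assoc, 𝒢.C_comm hc hc', mul_assoc]
  have := congrArg (fun u : GL (Fin N) ℂ => (u : Matrix (Fin N) (Fin N) ℂ)) this
  simp only [Units.val_mul] at this
  simp only [Units.val_mul]
  exact this

/-- An element of the Lie algebra of `G` commuting with that of the derived group generates a
one-parameter subgroup of the connected centre. -/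
lemma exp_eq_of_commute {ξ : Matrix (Fin N) (Fin N) ℂ}
    (hc : ∀ a : Matrix (Fin 2) (Fin 2) ℂ, a.trace = 0 → Commute ξ (𝒢.dφ a)) {s : ℂ} {A : SL(2, ℂ)}
    {c : GL (Fin N) ℂ} (hcC : c ∈ 𝒢.C)
    (he : ((𝒢.φ A * c : GL (Fin N) ℂ) : Matrix (Fin N) (Fin N) ℂ) = NormedSpace.exp ((s / 2) • ξ)) :
    ((c * c : GL (Fin N) ℂ) : Matrix (Fin N) (Fin N) ℂ) = NormedSpace.exp (s • ξ) := by
  have hA := 𝒢.eq_one_or_neg_one_of_Ad (A := A) (fun a ha => by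
    have h1 : Ad (𝒢.φ A * c) (𝒢.dφ a) = 𝒢.dφ a := by
      rw [Ad_eq_self_iff, he]
      exact ((hc a ha).smul_left _).exp_left
    rwa [Ad_mul, 𝒢.Ad_C_dφ hcC ha] at h1)
  have h2 := 𝒢.φ_neg_one_sq A hA
  rw [exp_half_sq, ← he, ← Units.val_mul]
  congr 1
  calc c * c = (𝒢.φ A * 𝒢.φ A) * (c * c) := by rw [h2, one_mul]
    _ = _ := Commute.mul_mul_mul_comm (𝒢.C_central c hcC A).symm _ _

lemma mem_lieC_of_commute {ξ : Matrix (Fin N) (Fin N) ℂ} (hξ : ξ ∈ lieAlg (𝒢.G : Set (GL (Fin N) ℂ)))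
    (hc : ∀ a : Matrix (Fin 2) (Fin 2) ℂ, a.trace = 0 → Commute ξ (𝒢.dφ a)) : ξ ∈ 𝒢.lieC := by
  intro s
  obtain ⟨g, hg, e⟩ := hξ (s / 2)
  obtain ⟨A, c, hcC, rfl⟩ := 𝒢.mem_G.1 hg
  exact ⟨c * c, 𝒢.C.mul_mem hcC hcC, 𝒢.exp_eq_of_commute hc hcC e⟩

end SplitRankOneGroup

/-- Derivations of `𝔰𝔩₂` are inner. -/
lemma exists_inner_of_derivation {DE DH DF : Matrix (Fin 2) (Fin 2) ℂ} (tE : DE.trace = 0)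
    (tH : DH.trace = 0) (tF : DF.trace = 0)
    (r1 : (2 : ℂ) • DE = DH * slE - slE * DH + (slH * DE - DE * slH))
    (r2 : -((2 : ℂ) • DF) = DH * slF - slF * DH + (slH * DF - DF * slH))
    (r3 : DH = DE * slF - slF * DE + (slE * DF - DF * slE)) :
    ∃ a : Matrix (Fin 2) (Fin 2) ℂ, a.trace = 0 ∧ DE = a * slE - slE * a ∧ DH = a * slH - slH * a ∧
      DF = a * slF - slF * a := by
  rw [Matrix.trace_fin_two] at tE tH tF
  have f1 := fun i j => congrFun (congrFun r1 i) j
  have f2 := fun i j => congrFun (congrFun r2 i) j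
  have f3 := fun i j => congrFun (congrFun r3 i) j
  simp only [Fin.forall_fin_two, slE, slF, slH, Matrix.mul_apply, Fin.sum_univ_two, Matrix.smul_apply,
    Matrix.sub_apply, Matrix.add_apply, Matrix.neg_apply, Matrix.of_apply, Matrix.cons_val_zero,
    Matrix.cons_val_one, smul_eq_mul, Matrix.cons_val'] at f1 f2 f3
  obtain ⟨⟨f1a, f1b⟩, f1c, f1d⟩ := f1
  obtain ⟨⟨f2a, f2b⟩, f2c, f2d⟩ := f2
  obtain ⟨⟨f3a, f3b⟩, f3c, f3d⟩ := f3
  refine ⟨!![DE 0 1 / 2, - DH 0 1 / 2; DH 1 0 / 2, - DE 0 1 / 2], by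
    simp [Matrix.trace_fin_two]; ring, ?_, ?_, ?_⟩
  all_goals
    ext i j; fin_cases i <;> fin_cases j <;>
    simp only [Fin.zero_eta, Fin.mk_one, slE, slF, slH, Matrix.mul_apply, Fin.sum_univ_two, 
      Matrix.sub_apply, Matrix.of_apply, Matrix.cons_val_zero, Matrix.cons_val_one, Matrix.cons_val'] <;> grind

/-! ### The Lie algebra of `G` as derived algebra plus centre -/

namespace SplitRankOneGroup

variable {N : ℕ} (𝒢 : SplitRankOneGroup N)

lemma dφ_commutator {a b : Matrix (Fin 2) (Fin 2) ℂ} (ha : a.trace = 0) (hb : b.trace = 0) :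
    𝒢.dφ a * 𝒢.dφ b - 𝒢.dφ b * 𝒢.dφ a = 𝒢.dφ (a * b - b * a) := by
  symm
  apply linearMap_commutator
  intro s
  have h1 : NormedSpace.exp (-s • a) = ((expSL a ha s)⁻¹ : SL(2, ℂ)) := by
    have : expSL a ha (-s) = (expSL a ha s)⁻¹ := by
      rw [eq_inv_iff_mul_eq_one, ← expSL_add, neg_add_cancel, expSL_zero]
    rw [← this]; rfl
  have h2 : NormedSpace.exp (-s • 𝒢.dφ a) = ((𝒢.φ (expSL a ha s))⁻¹ : GL (Fin N) ℂ) := by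
    rw [neg_smul, Matrix.exp_neg, ← 𝒢.φ_expSL ha, Matrix.coe_units_inv]
  have h3 := 𝒢.Ad_φ_dφ (expSL a ha s) hb
  rw [h1, h2, ← 𝒢.φ_expSL ha]
  exact h3.symm

/-- The curve `Ad (exp (s ξ)) (dφ a)` stays in the image of `𝔰𝔩₂`, where the linear map `dφ ∘ ψ -
id` vanishes. So this map also kills the derivative of the curve at `0`. -/
lemma exists_commutator {ξ : Matrix (Fin N) (Fin N) ℂ} (hξ : ξ ∈ lieAlg (𝒢.G : Set (GL (Fin N) ℂ)))
    {a : Matrix (Fin 2) (Fin 2) ℂ} (ha : a.trace = 0) :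
    ∃ b : Matrix (Fin 2) (Fin 2) ℂ, b.trace = 0 ∧ ξ * 𝒢.dφ a - 𝒢.dφ a * ξ = 𝒢.dφ b := by
  have h : (𝒢.dφ ∘ₗ 𝒢.ψ - LinearMap.id : Matrix (Fin N) (Fin N) ℂ →ₗ[ℂ] Matrix (Fin N) (Fin N) ℂ) (ξ * 𝒢.dφ a - 𝒢.dφ a * ξ) = 0 := by
    apply linearMap_commutator_eq_zero
    intro s
    obtain ⟨g, hg, e⟩ := hξ s
    obtain ⟨A, c, hc, rfl⟩ := 𝒢.mem_G.1 hg
    have e' : NormedSpace.exp (-s • ξ) = (((𝒢.φ A * c)⁻¹ : GL (Fin N) ℂ) : Matrix (Fin N) (Fin N) ℂ) := by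
      rw [neg_smul, Matrix.exp_neg, ← e, Matrix.coe_units_inv]
    have h1 : NormedSpace.exp (s • ξ) * 𝒢.dφ a * NormedSpace.exp (-s • ξ) = Ad (𝒢.φ A * c) (𝒢.dφ a) := by
      rw [e', ← e]; rfl
    rw [h1, Ad_mul, 𝒢.Ad_C_dφ hc ha, 𝒢.Ad_φ_dφ A ha]
    rw [LinearMap.sub_apply, LinearMap.comp_apply, 𝒢.ψ_dφ ((trace_conj A a).trans ha)]
    simp
  refine ⟨𝒢.ψ (ξ * 𝒢.dφ a - 𝒢.dφ a * ξ), 𝒢.trace_ψ _, ?_⟩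
  exact (sub_eq_zero.1 h).symm

lemma dφ_mem_lieG {a : Matrix (Fin 2) (Fin 2) ℂ} (ha : a.trace = 0) :
    𝒢.dφ a ∈ lieAlg (𝒢.G : Set (GL (Fin N) ℂ)) :=
  lieAlg_mono 𝒢.range_le_G (𝒢.dφ_mem_lieAlg_range ha)

lemma lieC_le_lieG {z : Matrix (Fin N) (Fin N) ℂ} (hz : z ∈ 𝒢.lieC) :
    z ∈ lieAlg (𝒢.G : Set (GL (Fin N) ℂ)) := lieAlg_mono 𝒢.C_le_G hz

lemma dφ_add_mem_lieG {a : Matrix (Fin 2) (Fin 2) ℂ} (ha : a.trace = 0) {z : Matrix (Fin N) (Fin N) ℂ}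
    (hz : z ∈ 𝒢.lieC) : 𝒢.dφ a + z ∈ lieAlg (𝒢.G : Set (GL (Fin N) ℂ)) :=
  add_mem_lieAlg (𝒢.commute_lieC_dφ hz ha).symm (𝒢.dφ_mem_lieG ha) (𝒢.lieC_le_lieG hz)

/-- The Lie algebra of `G` is the sum of those of the derived group and of the connected centre. -/
lemma exists_of_mem_lieG {ξ : Matrix (Fin N) (Fin N) ℂ} (hξ : ξ ∈ lieAlg (𝒢.G : Set (GL (Fin N) ℂ))) :
    ∃ a : Matrix (Fin 2) (Fin 2) ℂ, a.trace = 0 ∧ ∃ z ∈ 𝒢.lieC, ξ = 𝒢.dφ a + z := by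
  obtain ⟨DE, tE, hE⟩ := 𝒢.exists_commutator hξ trace_slE
  obtain ⟨DH, tH, hH⟩ := 𝒢.exists_commutator hξ trace_slH
  obtain ⟨DF, tF, hF⟩ := 𝒢.exists_commutator hξ trace_slF
  have cHE : 𝒢.dφ slH * 𝒢.dφ slE - 𝒢.dφ slE * 𝒢.dφ slH = (2 : ℂ) • 𝒢.dφ slE := by
    rw [𝒢.dφ_commutator trace_slH trace_slE, ← map_smul]
    congr 1
    ext i j; fin_cases i <;> fin_cases j <;> simp [slE, slH]; norm_num
  have cHF : 𝒢.dφ slH * 𝒢.dφ slF - 𝒢.dφ slF * 𝒢.dφ slH = - ((2 : ℂ) • 𝒢.dφ slF) := by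
    rw [𝒢.dφ_commutator trace_slH trace_slF, ← map_smul, ← map_neg]
    congr 1
    ext i j; fin_cases i <;> fin_cases j <;> simp [slF, slH]; norm_num
  have cEF : 𝒢.dφ slE * 𝒢.dφ slF - 𝒢.dφ slF * 𝒢.dφ slE = 𝒢.dφ slH := by
    rw [𝒢.dφ_commutator trace_slE trace_slF]
    congr 1
    ext i j; fin_cases i <;> fin_cases j <;> simp [slE, slF, slH]
  -- Bracketing with `W` is a derivation. Applied to the three relations of `𝔰𝔩₂` it gives the
  -- hypotheses of `exists_inner_of_derivation`.
  have lb : ∀ X Y Z W : Matrix (Fin N) (Fin N) ℂ, X * Y - Y * X = Z →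
      W * Z - Z * W = (W * X - X * W) * Y - Y * (W * X - X * W) + (X * (W * Y - Y * W) - (W * Y - Y * W) * X) := by
    rintro X Y _ W rfl; noncomm_ring
  have tr : ∀ a b : Matrix (Fin 2) (Fin 2) ℂ, (a * b - b * a).trace = 0 := fun a b => by
    rw [Matrix.trace_sub, Matrix.trace_mul_comm, sub_self]
  have r1 := lb _ _ _ ξ cHE
  have r2 := lb _ _ _ ξ cHF
  have r3 := lb _ _ _ ξ cEF
  have e1 : ξ * ((2 : ℂ) • 𝒢.dφ slE) - (2 : ℂ) • 𝒢.dφ slE * ξ = 𝒢.dφ ((2 : ℂ) • DE) := by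
    rw [map_smul, ← hE, mul_smul_comm, smul_mul_assoc, smul_sub]
  have e2 : ξ * -((2 : ℂ) • 𝒢.dφ slF) - -((2 : ℂ) • 𝒢.dφ slF) * ξ = 𝒢.dφ (-((2 : ℂ) • DF)) := by
    rw [map_neg, map_smul, ← hF, mul_neg, neg_mul, mul_smul_comm, smul_mul_assoc, smul_sub]; abel
  rw [e1, hH, hE, 𝒢.dφ_commutator tH trace_slE, 𝒢.dφ_commutator trace_slH tE, ← map_add] at r1
  rw [e2, hH, hF, 𝒢.dφ_commutator tH trace_slF, 𝒢.dφ_commutator trace_slH tF, ← map_add] at r2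
  rw [hH, hE, hF, 𝒢.dφ_commutator tE trace_slF, 𝒢.dφ_commutator trace_slE tF, ← map_add] at r3
  replace r1 := 𝒢.dφ_inj (by simp [tE]) (by simp only [Matrix.trace_add, tr, add_zero]) r1
  replace r2 := 𝒢.dφ_inj (by simp [tF]) (by simp only [Matrix.trace_add, tr, add_zero]) r2
  replace r3 := 𝒢.dφ_inj tH (by simp only [Matrix.trace_add, tr, add_zero]) r3
  obtain ⟨a, ha, kE, kH, kF⟩ := exists_inner_of_derivation tE tH tF r1 r2 r3
  have hc : ∀ b : Matrix (Fin 2) (Fin 2) ℂ, b.trace = 0 → Commute (ξ - 𝒢.dφ a) (𝒢.dφ b) := by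
    have key : ∀ b D : Matrix (Fin 2) (Fin 2) ℂ, b.trace = 0 → ξ * 𝒢.dφ b - 𝒢.dφ b * ξ = 𝒢.dφ D →
        D = a * b - b * a → Commute (ξ - 𝒢.dφ a) (𝒢.dφ b) := by
      rintro b _ hb h rfl
      rw [← 𝒢.dφ_commutator ha hb] at h
      rw [commute_iff_eq, ← sub_eq_zero]
      calc _ = (ξ * 𝒢.dφ b - 𝒢.dφ b * ξ) - (𝒢.dφ a * 𝒢.dφ b - 𝒢.dφ b * 𝒢.dφ a) := by noncomm_ring
        _ = 0 := by rw [h, sub_self]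
    intro b hb
    rw [eq_slE_slH_slF hb, map_add, map_add, map_smul, map_smul, map_smul]
    exact (((key _ _ trace_slE hE kE).smul_right _).add_right ((key _ _ trace_slH hH kH).smul_right _)).add_right
      ((key _ _ trace_slF hF kF).smul_right _)
  refine ⟨a, ha, ξ - 𝒢.dφ a, 𝒢.mem_lieC_of_commute ?_ hc, by abel⟩
  rw [sub_eq_add_neg]
  -- At this point only commuting elements may be added; `ξ` commutes with `dφ a` because `ξ - dφ a`
  -- does.
  refine add_mem_lieAlg ?_ hξ ?_
  · have := (hc a ha).add_left (Commute.refl (𝒢.dφ a))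
    rw [sub_add_cancel] at this
    exact this.neg_right
  · simpa using smul_mem_lieAlg (𝒢.dφ_mem_lieG ha) (-1)

end SplitRankOneGroup

/-- The diagonal matrix `diag(λ, λ⁻¹)` in `SL₂`. -/
def diagSL (l : ℂ) (hl : l ≠ 0) : SL(2, ℂ) := ⟨!![l, 0; 0, l⁻¹], by simp [Matrix.det_fin_two, hl]⟩
/-- The upper unitriangular matrices in `SL₂`. -/
def upperSL (s : ℂ) : SL(2, ℂ) := ⟨!![1, s; 0, 1], by simp [Matrix.det_fin_two]⟩
/-- The lower unitriangular matrices in `SL₂`. -/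
def lowerSL (s : ℂ) : SL(2, ℂ) := ⟨!![1, 0; s, 1], by simp [Matrix.det_fin_two]⟩
/-- The representative of the simple reflection in `SL₂`. -/
def weylSL : SL(2, ℂ) := ⟨!![0, -1; 1, 0], by simp [Matrix.det_fin_two]⟩

@[simp] lemma diagSL_00 (l : ℂ) (hl : l ≠ 0) : diagSL l hl 0 0 = l := rfl
@[simp] lemma diagSL_01 (l : ℂ) (hl : l ≠ 0) : diagSL l hl 0 1 = 0 := rfl
@[simp] lemma diagSL_10 (l : ℂ) (hl : l ≠ 0) : diagSL l hl 1 0 = 0 := rfl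
@[simp] lemma diagSL_11 (l : ℂ) (hl : l ≠ 0) : diagSL l hl 1 1 = l⁻¹ := rfl
@[simp] lemma upperSL_00 (s : ℂ) : upperSL s 0 0 = 1 := rfl
@[simp] lemma upperSL_01 (s : ℂ) : upperSL s 0 1 = s := rfl
@[simp] lemma upperSL_10 (s : ℂ) : upperSL s 1 0 = 0 := rfl
@[simp] lemma upperSL_11 (s : ℂ) : upperSL s 1 1 = 1 := rfl
@[simp] lemma lowerSL_00 (s : ℂ) : lowerSL s 0 0 = 1 := rfl
@[simp] lemma lowerSL_01 (s : ℂ) : lowerSL s 0 1 = 0 := rfl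
@[simp] lemma lowerSL_10 (s : ℂ) : lowerSL s 1 0 = s := rfl
@[simp] lemma lowerSL_11 (s : ℂ) : lowerSL s 1 1 = 1 := rfl
@[simp] lemma weylSL_00 : weylSL 0 0 = 0 := rfl
@[simp] lemma weylSL_01 : weylSL 0 1 = -1 := rfl
@[simp] lemma weylSL_10 : weylSL 1 0 = 1 := rfl
@[simp] lemma weylSL_11 : weylSL 1 1 = 0 := rfl

/-- Conjugation of a `2 × 2` matrix by an element of `SL₂`. -/
def conjBy (A : SL(2, ℂ)) (ξ : Matrix (Fin 2) (Fin 2) ℂ) : Matrix (Fin 2) (Fin 2) ℂ :=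
  (A : Matrix (Fin 2) (Fin 2) ℂ) * ξ * ((A⁻¹ : SL(2, ℂ)) : Matrix (Fin 2) (Fin 2) ℂ)

@[simp] lemma trace_conjBy (A : SL(2, ℂ)) (ξ : Matrix (Fin 2) (Fin 2) ℂ) : (conjBy A ξ).trace = ξ.trace :=
  SplitRankOneGroup.trace_conj A ξ

lemma conjBy_apply (A : SL(2, ℂ)) (ξ : Matrix (Fin 2) (Fin 2) ℂ) (i j : Fin 2) :
    conjBy A ξ i j = (A i 0 * ξ 0 0 + A i 1 * ξ 1 0) * A⁻¹ 0 j + (A i 0 * ξ 0 1 + A i 1 * ξ 1 1) * A⁻¹ 1 j := by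
  simp only [conjBy, Matrix.mul_apply, Fin.sum_univ_two]

lemma conjBy_mul (A B : SL(2, ℂ)) (ξ : Matrix (Fin 2) (Fin 2) ℂ) : conjBy (A * B) ξ = conjBy A (conjBy B ξ) := by
  simp only [conjBy, mul_inv_rev, Matrix.SpecialLinearGroup.coe_mul, mul_assoc]

lemma SL2_ext {A B : SL(2, ℂ)} (h00 : A 0 0 = B 0 0) (h01 : A 0 1 = B 0 1) (h10 : A 1 0 = B 1 0)
    (h11 : A 1 1 = B 1 1) : A = B := by
  ext i j; fin_cases i <;> fin_cases j <;> assumption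

/-! ### The Lie algebras of `[G, G]`, `T` and `U` -/

namespace SplitRankOneGroup

variable {N : ℕ} (𝒢 : SplitRankOneGroup N)

lemma Ad_φ_dφ' (A : SL(2, ℂ)) {ξ : Matrix (Fin 2) (Fin 2) ℂ} (h : ξ.trace = 0) :
    Ad (𝒢.φ A) (𝒢.dφ ξ) = 𝒢.dφ (conjBy A ξ) := 𝒢.Ad_φ_dφ A h

lemma Ad_dφ_add {A : SL(2, ℂ)} {c : GL (Fin N) ℂ} (hc : c ∈ 𝒢.C) {a : Matrix (Fin 2) (Fin 2) ℂ}
    (ha : a.trace = 0) {z : Matrix (Fin N) (Fin N) ℂ} (hz : z ∈ 𝒢.lieC) :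
    Ad (𝒢.φ A * c) (𝒢.dφ a + z) = 𝒢.dφ (conjBy A a) + z := by
  rw [Ad_add, Ad_mul, 𝒢.Ad_C_dφ hc ha, 𝒢.Ad_φ_dφ' A ha, 𝒢.Ad_lieC (𝒢.mem_G.2 ⟨A, c, hc, rfl⟩) hz]

lemma dφ_mem_lieC {a : Matrix (Fin 2) (Fin 2) ℂ} (ha : a.trace = 0) (h : 𝒢.dφ a ∈ 𝒢.lieC) : a = 0 := by
  refine eq_zero_of_commute_SL2 ha fun M => ?_
  have h1 := 𝒢.Ad_lieC (𝒢.φ_mem_G M) h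
  rw [𝒢.Ad_φ_dφ _ ha] at h1
  have h2 := 𝒢.dφ_inj ((trace_conj _ a).trans ha) ha h1
  rw [commute_iff_eq]
  conv_lhs => rw [← h2]
  rw [mul_assoc, mul_assoc, ← Matrix.SpecialLinearGroup.coe_mul]; simp

lemma dφ_add_inj {a b : Matrix (Fin 2) (Fin 2) ℂ} (ha : a.trace = 0) (hb : b.trace = 0)
    {z w : Matrix (Fin N) (Fin N) ℂ} (hz : z ∈ 𝒢.lieC) (hw : w ∈ 𝒢.lieC)
    (h : 𝒢.dφ a + z = 𝒢.dφ b + w) : a = b ∧ z = w := by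
  have h1 : 𝒢.dφ (a - b) ∈ 𝒢.lieC := by
    have : 𝒢.dφ (a - b) = w - z := by
      rw [map_sub, sub_eq_sub_iff_add_eq_add, h]; abel
    rw [this]; exact 𝒢.lieC.sub_mem hw hz
  have h2 := sub_eq_zero.1 (𝒢.dφ_mem_lieC (by simp [ha, hb]) h1)
  subst h2
  exact ⟨rfl, add_left_cancel h⟩

/-- The central part `z` also lies in the Lie algebra of the image of `φ`. As `z` is central, `exp
((s / 2) z)` equals some `φ(±1)`, whose square is `1`; hence `exp (s z) = 1` for all `s` and `z =
0`. -/
lemma exists_of_mem_lieRange {ξ : Matrix (Fin N) (Fin N) ℂ}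
    (hξ : ξ ∈ lieAlg (𝒢.φ.range : Set (GL (Fin N) ℂ))) :
    ∃ a : Matrix (Fin 2) (Fin 2) ℂ, a.trace = 0 ∧ ξ = 𝒢.dφ a := by
  obtain ⟨a, ha, z, hz, rfl⟩ := 𝒢.exists_of_mem_lieG (lieAlg_mono 𝒢.range_le_G hξ)
  have hc := 𝒢.commute_lieC_dφ hz ha
  have hz' : z ∈ lieAlg (𝒢.φ.range : Set (GL (Fin N) ℂ)) := by
    have := add_mem_lieAlg (K := 𝒢.φ.range) (ξ := 𝒢.dφ a + z) (η := -𝒢.dφ a) (by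
      exact ((Commute.refl _).add_left hc).neg_right) hξ
      (by simpa using smul_mem_lieAlg (𝒢.dφ_mem_lieAlg_range ha) (-1))
    simpa using this
  refine ⟨a, ha, ?_⟩
  suffices z = 0 by simp [this]
  apply eq_of_exp_smul_eq
  intro s
  obtain ⟨g, ⟨A, rfl⟩, e⟩ := hz' (s / 2)
  have := 𝒢.exp_eq_of_commute (fun b hb => 𝒢.commute_lieC_dφ hz hb) (s := s) (A := A) 𝒢.C.one_mem
    (by simpa using e)
  rw [← this]; simp

lemma commute_slH {a : Matrix (Fin 2) (Fin 2) ℂ} (ha : a.trace = 0) (h : Commute a slH) :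
    a = a 0 0 • slH := by
  have a1 := congrFun (congrFun h.eq 0) 1
  have a2 := congrFun (congrFun h.eq 1) 0
  simp only [slH, Matrix.mul_apply, Fin.sum_univ_two, Matrix.of_apply, Matrix.cons_val_zero,
    Matrix.cons_val_one, Matrix.cons_val'] at a1 a2
  have h1 : a 0 1 = 0 := by linear_combination (-1/2) * a1
  have h2 : a 1 0 = 0 := by linear_combination (1/2) * a2
  conv_lhs => rw [eq_slE_slH_slF ha]
  simp [h1, h2]

lemma commute_slE {a : Matrix (Fin 2) (Fin 2) ℂ} (ha : a.trace = 0) (h : Commute a slE) :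
    a = a 0 1 • slE := by
  have a1 := congrFun (congrFun h.eq 0) 0
  have a2 := congrFun (congrFun h.eq 0) 1
  simp only [slE, Matrix.mul_apply, Fin.sum_univ_two, Matrix.of_apply, Matrix.cons_val_zero,
    Matrix.cons_val_one, Matrix.cons_val'] at a1 a2
  rw [Matrix.trace_fin_two] at ha
  have h1 : a 0 0 = 0 := by linear_combination (1/2) * a2 + (1/2) * ha
  have h2 : a 1 0 = 0 := by linear_combination - a1
  have ha' : a.trace = 0 := by rw [Matrix.trace_fin_two]; exact ha
  conv_lhs => rw [eq_slE_slH_slF ha']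
  simp [h1, h2]

lemma conjBy_diag_slH {A : SL(2, ℂ)} (h1 : A 1 0 = 0) (h2 : A 0 1 = 0) : conjBy A slH = slH := by
  have hd := SL2_det A
  ext i j
  fin_cases i <;> fin_cases j <;>
    simp only [Fin.zero_eta, Fin.mk_one, conjBy_apply, SL2_inv_00, SL2_inv_01, SL2_inv_10, SL2_inv_11, h1, h2] <;> simp [slH] <;>
    rw [h1, h2] at hd <;> linear_combination hd

lemma conjBy_unip_slE {A : SL(2, ℂ)} (h1 : A 1 0 = 0) (h2 : A 0 0 = 1) (h3 : A 1 1 = 1) : conjBy A slE = slE := by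
  ext i j
  fin_cases i <;> fin_cases j <;>
    simp only [Fin.zero_eta, Fin.mk_one, conjBy_apply, SL2_inv_00, SL2_inv_01, SL2_inv_10, SL2_inv_11, h1, h2, h3] <;> simp [slE]

/-- `T` fixes `dφ slH`, so its Lie algebra commutes with it, and the centraliser of `slH` in `𝔰𝔩₂`
is the line it spans. -/
lemma exists_of_mem_lieT {ξ : Matrix (Fin N) (Fin N) ℂ} (hξ : ξ ∈ lieAlg (𝒢.T : Set (GL (Fin N) ℂ))) :
    ∃ a : ℂ, ∃ z ∈ 𝒢.lieC, ξ = 𝒢.dφ (a • slH) + z := by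
  obtain ⟨a, ha, z, hz, rfl⟩ := 𝒢.exists_of_mem_lieG (lieAlg_mono 𝒢.T_le_G hξ)
  have h1 : Commute (𝒢.dφ a + z) (𝒢.dφ slH) := by
    refine commute_of_mem_lieAlg (fun t ht => ?_) hξ
    obtain ⟨A, h1, h2, c, hc, rfl⟩ := 𝒢.mem_T.1 ht
    rw [← Ad_eq_self_iff, Ad_mul, 𝒢.Ad_C_dφ hc trace_slH, 𝒢.Ad_φ_dφ' A trace_slH, conjBy_diag_slH h1 h2]
  have h2 : Commute (𝒢.dφ a) (𝒢.dφ slH) := by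
    have := h1.sub_left (𝒢.commute_lieC_dφ hz trace_slH)
    simpa using this
  exact ⟨a 0 0, z, hz, by rw [← commute_slH ha (𝒢.commute_dφ ha trace_slH h2)]⟩

lemma diagSL_eq_exp (s : ℂ) : expSL slH trace_slH s = diagSL (Complex.exp s) (Complex.exp_ne_zero s) := by
  have h1 : s • slH = Matrix.diagonal ![s, -s] := by
    ext i j; fin_cases i <;> fin_cases j <;> simp [slH]
  apply Subtype.ext
  change NormedSpace.exp (s • slH) = !![Complex.exp s, 0; 0, (Complex.exp s)⁻¹]
  rw [h1, Matrix.exp_diagonal, ← Complex.exp_neg]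
  ext i j; fin_cases i <;> fin_cases j <;> simp [Complex.exp_eq_exp_ℂ]

lemma mem_lieT {a : ℂ} {z : Matrix (Fin N) (Fin N) ℂ} (hz : z ∈ 𝒢.lieC) :
    𝒢.dφ (a • slH) + z ∈ lieAlg (𝒢.T : Set (GL (Fin N) ℂ)) := by
  refine add_mem_lieAlg (𝒢.commute_lieC_dφ hz (by simp)).symm ?_ (lieAlg_mono (SetLike.coe_subset_coe.2 le_sup_right) hz)
  rw [map_smul]
  refine smul_mem_lieAlg (fun s => ?_) a
  refine ⟨_, 𝒢.mem_T.2 ⟨expSL slH trace_slH s, ?_, ?_, 1, 𝒢.C.one_mem, rfl⟩, ?_⟩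
  · simp [diagSL_eq_exp]
  · simp [diagSL_eq_exp]
  · rw [mul_one, φ_expSL]

lemma exists_of_mem_lieU {ξ : Matrix (Fin N) (Fin N) ℂ} (hξ : ξ ∈ lieAlg (𝒢.U : Set (GL (Fin N) ℂ))) :
    ∃ a : ℂ, ξ = 𝒢.dφ (a • slE) := by
  obtain ⟨a, ha, rfl⟩ := 𝒢.exists_of_mem_lieRange (lieAlg_mono 𝒢.U_le_range hξ)
  have h1 : Commute (𝒢.dφ a) (𝒢.dφ slE) := by
    refine commute_of_mem_lieAlg (fun t ht => ?_) hξ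
    obtain ⟨A, h1, h2, h3, rfl⟩ := 𝒢.mem_U.1 ht
    rw [← Ad_eq_self_iff, 𝒢.Ad_φ_dφ' A trace_slE, conjBy_unip_slE h1 h2 h3]
  exact ⟨a 0 1, by rw [← commute_slE ha (𝒢.commute_dφ ha trace_slE h1)]⟩

lemma conj_mem_G {g : GL (Fin N) ℂ} (hg : g ∈ 𝒢.G) : conjGL N g ∈ 𝒢.G := by
  obtain ⟨A, c, hc, rfl⟩ := 𝒢.mem_G.1 hg
  exact 𝒢.mem_G.2 ⟨conjSL A, conjGL N c, 𝒢.conj_mem_C hc, by rw [map_mul, conj_φ]⟩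

lemma conjM_mem_lieC {z : Matrix (Fin N) (Fin N) ℂ} (hz : z ∈ 𝒢.lieC) : conjM z ∈ 𝒢.lieC :=
  conjM_mem_lieAlg (fun _ h => 𝒢.conj_mem_C h) hz

lemma conjM_slH : conjM slH = slH := by
  ext i j; fin_cases i <;> fin_cases j <;> simp [slH]

lemma lieG_add {ξ η : Matrix (Fin N) (Fin N) ℂ} (hξ : ξ ∈ lieAlg (𝒢.G : Set (GL (Fin N) ℂ)))
    (hη : η ∈ lieAlg (𝒢.G : Set (GL (Fin N) ℂ))) : ξ + η ∈ lieAlg (𝒢.G : Set (GL (Fin N) ℂ)) := by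
  obtain ⟨a, ha, z, hz, rfl⟩ := 𝒢.exists_of_mem_lieG hξ
  obtain ⟨b, hb, w, hw, rfl⟩ := 𝒢.exists_of_mem_lieG hη
  have := 𝒢.dφ_add_mem_lieG (a := a + b) (by simp [ha, hb]) (𝒢.lieC.add_mem hz hw)
  rw [map_add] at this
  convert this using 1
  abel

/-- Invariant inner products commute with complex conjugation. -/
lemma IsInvariantInnerProduct.conj {𝒢 : SplitRankOneGroup N}
    {β : LinearMap.BilinForm ℂ (Matrix (Fin N) (Fin N) ℂ)} (hβ : 𝒢.IsInvariantInnerProduct β)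
    {ξ η : Matrix (Fin N) (Fin N) ℂ} (hξ : ξ ∈ lieAlg (𝒢.G : Set (GL (Fin N) ℂ)))
    (hη : η ∈ lieAlg (𝒢.G : Set (GL (Fin N) ℂ))) :
    β (conjM ξ) (conjM η) = starRingEnd ℂ (β ξ η) := by
  have key : ∀ ξ ∈ lieAlg (𝒢.G : Set (GL (Fin N) ℂ)), ∃ x ∈ lieAlg (𝒢.G : Set (GL (Fin N) ℂ)),
      ∃ y ∈ lieAlg (𝒢.G : Set (GL (Fin N) ℂ)), conjM x = x ∧ conjM y = y ∧ ξ = x + Complex.I • y := by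
    intro ξ hξ
    have hc := conjM_mem_lieAlg (fun _ h => 𝒢.conj_mem_G h) hξ
    have c2 : starRingEnd ℂ (2 : ℂ) = 2 := map_ofNat _ 2
    refine ⟨(1/2 : ℂ) • (ξ + conjM ξ), smul_mem_lieAlg (𝒢.lieG_add hξ hc) _,
      (-Complex.I/2 : ℂ) • (ξ + (-1 : ℂ) • conjM ξ), smul_mem_lieAlg (𝒢.lieG_add hξ (smul_mem_lieAlg hc _)) _, ?_, ?_, ?_⟩
    · ext i j; simp [c2]; ring
    · ext i j; simp [c2]; ring
    · ext i j; simp; ring_nf; simp; ring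
  obtain ⟨x, hx, y, hy, cx, cy, rfl⟩ := key ξ hξ
  obtain ⟨u, hu, v, hv, cu, cv, rfl⟩ := key η hη
  have re : ∀ x ∈ lieAlg (𝒢.G : Set (GL (Fin N) ℂ)), ∀ u ∈ lieAlg (𝒢.G : Set (GL (Fin N) ℂ)),
      conjM x = x → conjM u = u → starRingEnd ℂ (β x u) = β x u := fun x hx u hu cx cu =>
    Complex.conj_eq_iff_im.2 (hβ.real x hx u hu (isRealMatrix_iff.2 cx) (isRealMatrix_iff.2 cu))
  simp only [map_add, conjM_smul, cx, cy, cu, cv, map_smul, LinearMap.add_apply, LinearMap.smul_apply,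
    smul_eq_mul, map_mul, re x hx u hu cx cu, re x hx v hv cx cv, re y hy u hu cy cu, re y hy v hv cy cv]

end SplitRankOneGroup

lemma conjBy_diag_slE (l : ℂ) (hl : l ≠ 0) : conjBy (diagSL l hl) slE = (l ^ 2) • slE := by
  ext i j
  fin_cases i <;> fin_cases j <;>
    simp only [Fin.zero_eta, Fin.mk_one, conjBy_apply, SplitRankOneGroup.SL2_inv_00, SplitRankOneGroup.SL2_inv_01, SplitRankOneGroup.SL2_inv_10, SplitRankOneGroup.SL2_inv_11] <;> simp [slE, sq]

lemma conjBy_diag_slF (l : ℂ) (hl : l ≠ 0) : conjBy (diagSL l hl) slF = (l⁻¹ ^ 2) • slF := by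
  ext i j
  fin_cases i <;> fin_cases j <;>
    simp only [Fin.zero_eta, Fin.mk_one, conjBy_apply, SplitRankOneGroup.SL2_inv_00, SplitRankOneGroup.SL2_inv_01, SplitRankOneGroup.SL2_inv_10, SplitRankOneGroup.SL2_inv_11] <;> simp [slF, sq]

lemma conjBy_weyl_slH : conjBy weylSL slH = - slH := by
  ext i j
  fin_cases i <;> fin_cases j <;>
    simp only [Fin.zero_eta, Fin.mk_one, conjBy_apply, SplitRankOneGroup.SL2_inv_00, SplitRankOneGroup.SL2_inv_01, SplitRankOneGroup.SL2_inv_10, SplitRankOneGroup.SL2_inv_11] <;> simp [slH]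

lemma conjBy_upper_slH (s : ℂ) : conjBy (upperSL s) slH = slH - (2 * s) • slE := by
  ext i j
  fin_cases i <;> fin_cases j <;>
    simp only [Fin.zero_eta, Fin.mk_one, conjBy_apply, SplitRankOneGroup.SL2_inv_00, SplitRankOneGroup.SL2_inv_01, SplitRankOneGroup.SL2_inv_10, SplitRankOneGroup.SL2_inv_11] <;> simp [slH, slE]; ring

lemma conjBy_upper_slF (s : ℂ) : conjBy (upperSL s) slF = slF + s • slH - (s ^ 2) • slE := by
  ext i j
  fin_cases i <;> fin_cases j <;>
    simp only [Fin.zero_eta, Fin.mk_one, conjBy_apply, SplitRankOneGroup.SL2_inv_00, SplitRankOneGroup.SL2_inv_01, SplitRankOneGroup.SL2_inv_10, SplitRankOneGroup.SL2_inv_11] <;> simp [slH, slE, slF]; ring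

/-! ### Invariant inner products on `dφ(𝔰𝔩₂) ⊕ 𝔷` -/

namespace SplitRankOneGroup
namespace IsInvariantInnerProduct

variable {N : ℕ} {𝒢 : SplitRankOneGroup N} {β : LinearMap.BilinForm ℂ (Matrix (Fin N) (Fin N) ℂ)}
  (hβ : 𝒢.IsInvariantInnerProduct β)
include hβ

lemma inv_dφ (A : SL(2, ℂ)) {a b : Matrix (Fin 2) (Fin 2) ℂ} (ha : a.trace = 0) (hb : b.trace = 0) :
    β (𝒢.dφ (conjBy A a)) (𝒢.dφ (conjBy A b)) = β (𝒢.dφ a) (𝒢.dφ b) := by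
  rw [← 𝒢.Ad_φ_dφ' A ha, ← 𝒢.Ad_φ_dφ' A hb]
  exact hβ.invariant _ (𝒢.φ_mem_G A) _ (𝒢.dφ_mem_lieG ha) _ (𝒢.dφ_mem_lieG hb)

lemma inv_dφ_lieC (A : SL(2, ℂ)) {a : Matrix (Fin 2) (Fin 2) ℂ} (ha : a.trace = 0)
    {z : Matrix (Fin N) (Fin N) ℂ} (hz : z ∈ 𝒢.lieC) :
    β (𝒢.dφ (conjBy A a)) z = β (𝒢.dφ a) z := by
  rw [← 𝒢.Ad_φ_dφ' A ha]
  conv_lhs => rw [← 𝒢.Ad_lieC (𝒢.φ_mem_G A) hz]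
  exact hβ.invariant _ (𝒢.φ_mem_G A) _ (𝒢.dφ_mem_lieG ha) _ (𝒢.lieC_le_lieG hz)

/-- `G` fixes the centre, while suitable group elements scale `slE`, `slF`, `slH` by `4`, `1/4`,
`-1`. None of these factors is `1`, so invariance forces each pairing to vanish. -/
lemma dφ_lieC {a : Matrix (Fin 2) (Fin 2) ℂ} (ha : a.trace = 0)
    {z : Matrix (Fin N) (Fin N) ℂ} (hz : z ∈ 𝒢.lieC) : β (𝒢.dφ a) z = 0 := by
  have h1 := hβ.inv_dφ_lieC (diagSL 2 two_ne_zero) trace_slE hz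
  have h2 := hβ.inv_dφ_lieC (diagSL 2 two_ne_zero) trace_slF hz
  have h3 := hβ.inv_dφ_lieC weylSL trace_slH hz
  rw [conjBy_diag_slE, map_smul, map_smul, LinearMap.smul_apply, smul_eq_mul] at h1
  rw [conjBy_diag_slF, map_smul, map_smul, LinearMap.smul_apply, smul_eq_mul] at h2
  rw [conjBy_weyl_slH, map_neg, map_neg, LinearMap.neg_apply] at h3
  rw [eq_slE_slH_slF ha]
  simp only [map_add, map_smul, LinearMap.add_apply, LinearMap.smul_apply, smul_eq_mul]
  have k1 : β (𝒢.dφ slE) z = 0 := by linear_combination (1/3) * h1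
  have k2 : β (𝒢.dφ slF) z = 0 := by linear_combination (-4/3) * h2
  have k3 : β (𝒢.dφ slH) z = 0 := by linear_combination (-1/2) * h3
  rw [k1, k2, k3]; ring

lemma lieC_dφ {a : Matrix (Fin 2) (Fin 2) ℂ} (ha : a.trace = 0)
    {z : Matrix (Fin N) (Fin N) ℂ} (hz : z ∈ 𝒢.lieC) : β z (𝒢.dφ a) = 0 := by
  rw [hβ.symm _ (𝒢.lieC_le_lieG hz) _ (𝒢.dφ_mem_lieG ha), hβ.dφ_lieC ha hz]

/-- The restriction of an invariant inner product to `𝔰𝔩₂` is a multiple of the trace form. -/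
lemma dφ_dφ {a b : Matrix (Fin 2) (Fin 2) ℂ} (ha : a.trace = 0) (hb : b.trace = 0) :
    β (𝒢.dφ a) (𝒢.dφ b) =
      β (𝒢.dφ slH) (𝒢.dφ slH) * (a 0 0 * b 0 0 + (a 0 1 * b 1 0 + a 1 0 * b 0 1) / 2) := by
  have hEE := hβ.inv_dφ (diagSL 2 two_ne_zero) trace_slE trace_slE
  have hFF := hβ.inv_dφ (diagSL 2 two_ne_zero) trace_slF trace_slF
  have hEH := hβ.inv_dφ (diagSL 2 two_ne_zero) trace_slE trace_slH
  have hFH := hβ.inv_dφ (diagSL 2 two_ne_zero) trace_slF trace_slH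
  -- The torus kills the pairings of weight different from zero; invariance under a unipotent
  -- element ties the pairing of `slE` with `slF` to that of `slH` with itself.
  have hHF := hβ.inv_dφ (upperSL 1) trace_slH trace_slF
  have sHE := hβ.symm _ (𝒢.dφ_mem_lieG trace_slH) _ (𝒢.dφ_mem_lieG trace_slE)
  have sHF := hβ.symm _ (𝒢.dφ_mem_lieG trace_slH) _ (𝒢.dφ_mem_lieG trace_slF)
  have sEF := hβ.symm _ (𝒢.dφ_mem_lieG trace_slE) _ (𝒢.dφ_mem_lieG trace_slF)
  rw [conjBy_upper_slH, conjBy_upper_slF] at hHF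
  rw [conjBy_diag_slE] at hEE hEH
  rw [conjBy_diag_slF] at hFF hFH
  rw [conjBy_diag_slH (by simp) (by simp)] at hEH hFH
  simp only [map_add, map_sub, map_smul, LinearMap.sub_apply, LinearMap.smul_apply,
    smul_eq_mul] at hEE hFF hEH hFH hHF
  have kEE : β (𝒢.dφ slE) (𝒢.dφ slE) = 0 := by linear_combination (1/15) * hEE
  have kFF : β (𝒢.dφ slF) (𝒢.dφ slF) = 0 := by linear_combination (-16/15) * hFF
  have kEH : β (𝒢.dφ slE) (𝒢.dφ slH) = 0 := by linear_combination (1/3) * hEH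
  have kFH : β (𝒢.dφ slF) (𝒢.dφ slH) = 0 := by linear_combination (-4/3) * hFH
  rw [kEH] at sHE
  rw [kFH] at sHF
  rw [sHE, sHF, kEH, kEE] at hHF
  have kEF : β (𝒢.dφ slE) (𝒢.dφ slF) = β (𝒢.dφ slH) (𝒢.dφ slH) / 2 := by linear_combination (-1/2) * hHF
  rw [kEF] at sEF
  conv_lhs => rw [eq_slE_slH_slF ha, eq_slE_slH_slF hb]
  simp only [map_add, map_smul, LinearMap.add_apply, LinearMap.smul_apply,
    smul_eq_mul, kEE, kFF, kEH, kFH, sHE, sHF, kEF, ← sEF]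
  ring

/-- `dφ slH` is a nonzero real vector of the Lie algebra of `T`, where the form is positive
definite. -/
lemma slH_slH_ne_zero : β (𝒢.dφ slH) (𝒢.dφ slH) ≠ 0 := by
  have h := hβ.pos (𝒢.dφ slH) (by simpa using 𝒢.mem_lieT (a := 1) 𝒢.lieC.zero_mem)
    (isRealMatrix_iff.2 (by rw [conjM_dφ, conjM_slH])) (fun h0 => by
      have := congrFun (congrFun (𝒢.dφ_eq_zero trace_slH h0) 0) 0
      simp [slH] at this)
  intro h0
  rw [h0] at h
  simp at h

end IsInvariantInnerProduct
end SplitRankOneGroup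

/-! ### Exponential polynomials, and diagonalisation in `SL₂` -/

/-- The algebra of exponential polynomials with real frequencies. -/
def expPoly : Subalgebra ℂ (ℂ → ℂ) :=
  Algebra.adjoin ℂ (Set.range fun (μ : ℝ) (s : ℂ) => Complex.exp (μ * s))

lemma exp_mem_expPoly (μ : ℝ) : (fun s : ℂ => Complex.exp (μ * s)) ∈ expPoly :=
  Algebra.subset_adjoin ⟨μ, rfl⟩

/-- An exponential polynomial with real frequencies that vanishes at the natural numbers vanishes. -/
lemma expPoly_eq_zero {f : ℂ → ℂ} (hf : f ∈ expPoly) (h : ∀ n : ℕ, f n = 0) : f = 0 := by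
  have h1 : f ∈ Submodule.span ℂ (Set.range fun (μ : ℝ) (s : ℂ) => Complex.exp (μ * s)) := by
    let M : Submonoid (ℂ → ℂ) :=
      { carrier := Set.range fun (μ : ℝ) (s : ℂ) => Complex.exp (μ * s)
        one_mem' := ⟨0, by funext s; simp⟩
        mul_mem' := by
          rintro _ _ ⟨μ, rfl⟩ ⟨ν, rfl⟩
          exact ⟨μ + ν, by funext s; simp [add_mul, Complex.exp_add]⟩ }
    have h2 : f ∈ Subalgebra.toSubmodule expPoly := hf
    rw [expPoly, Algebra.adjoin_eq_span] at h2
    have h3 : Submonoid.closure (Set.range fun (μ : ℝ) (s : ℂ) => Complex.exp (μ * s)) = M :=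
      Submonoid.closure_eq M
    rw [h3] at h2
    exact h2
  obtain ⟨c, rfl⟩ := (Finsupp.mem_span_range_iff_exists_finsupp).1 h1
  -- On natural numbers each exponential is a character of the monoid `ℕ`. Real frequencies give
  -- distinct characters, which are linearly independent by Dedekind.
  let χ : ℝ → (Multiplicative ℕ →* ℂ) := fun μ => (powersHom ℂ) (Complex.exp μ)
  have hχ : Function.Injective χ := by
    intro μ ν h
    have h2 := DFunLike.congr_fun h (Multiplicative.ofAdd 1)
    simp only [χ, powersHom_apply, toAdd_ofAdd, pow_one] at h2
    rw [← Complex.ofReal_exp, ← Complex.ofReal_exp] at h2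
    exact Real.exp_injective (Complex.ofReal_injective h2)
  have hli := (linearIndependent_monoidHom (Multiplicative ℕ) ℂ).comp χ hχ
  have hc : c = 0 := by
    rw [linearIndependent_iff] at hli
    apply hli
    funext n
    have := h (Multiplicative.toAdd n)
    rw [Finsupp.linearCombination_apply]
    simp only [Finsupp.sum, Finset.sum_apply, Pi.smul_apply, smul_eq_mul, Pi.zero_apply] at this ⊢
    rw [← this]
    refine Finset.sum_congr rfl fun μ _ => ?_
    simp only [Function.comp, χ, powersHom_apply, ← Complex.exp_nat_mul]
    rw [mul_comm ((μ : ℝ) : ℂ)]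
  simp [hc]

lemma SL2_conj_diag (P : SL(2, ℂ)) (l m : ℂ) (hl : l ≠ 0) (hm : m ≠ 0) :
    (P * diagSL l hl * P⁻¹) * (P * diagSL m hm * P⁻¹) = P * diagSL (l * m) (mul_ne_zero hl hm) * P⁻¹ := by
  have : diagSL l hl * diagSL m hm = diagSL (l * m) (mul_ne_zero hl hm) := by
    apply SL2_ext <;> simp only [SplitRankOneGroup.SL2_mul_apply] <;> simp [mul_comm]
  rw [← this]; group

/-- An element of `SL₂` for which the columns of `P` are eigenvectors. -/
lemma SL2_eq_conj_diag {P A : SL(2, ℂ)} {x y : ℂ}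
    (h : (A : Matrix (Fin 2) (Fin 2) ℂ) * P = P * !![x, 0; 0, y]) :
    ∃ hx : x ≠ 0, A = P * diagSL x hx * P⁻¹ := by
  have hd : x * y = 1 := by
    have := congrArg Matrix.det h
    simpa [Matrix.det_fin_two] using this.symm
  have hx : x ≠ 0 := left_ne_zero_of_mul_eq_one hd
  refine ⟨hx, ?_⟩
  rw [eq_mul_inv_iff_mul_eq]
  apply Subtype.ext
  have hy : y = x⁻¹ := eq_inv_of_mul_eq_one_right hd
  rw [hy] at h
  exact h

/-- The condition `l² ≠ 1` makes the two eigenvalues distinct, so the centraliser is the torus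
itself. -/
lemma SL2_eq_conj_diag_of_commute {P A : SL(2, ℂ)} {l : ℂ} {hl : l ≠ 0} (hl2 : l ^ 2 ≠ 1)
    (h : A * (P * diagSL l hl * P⁻¹) = (P * diagSL l hl * P⁻¹) * A) :
    ∃ x, ∃ hx : x ≠ 0, A = P * diagSL x hx * P⁻¹ := by
  have h1 : (P⁻¹ * A * P) * diagSL l hl = diagSL l hl * (P⁻¹ * A * P) := by
    have := congrArg (fun u => P⁻¹ * u * P) h
    simp only [mul_assoc, inv_mul_cancel, mul_one, inv_mul_cancel_left] at this ⊢
    exact this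
  set D := P⁻¹ * A * P with hD
  have hll : l - l⁻¹ ≠ 0 := by
    intro h0
    apply hl2
    field_simp at h0
    linear_combination h0
  have e1 := congrArg (fun u : SL(2, ℂ) => u 0 1) h1
  have e2 := congrArg (fun u : SL(2, ℂ) => u 1 0) h1
  simp only [SplitRankOneGroup.SL2_mul_apply, diagSL_00, diagSL_01, diagSL_10, diagSL_11] at e1 e2
  have d1 : D 0 1 = 0 := by
    have : D 0 1 * (l - l⁻¹) = 0 := by linear_combination -e1
    exact (mul_eq_zero.1 this).resolve_right hll
  have d2 : D 1 0 = 0 := by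
    have : D 1 0 * (l - l⁻¹) = 0 := by linear_combination e2
    exact (mul_eq_zero.1 this).resolve_right hll
  have hdet := SplitRankOneGroup.SL2_det D
  rw [d1] at hdet
  have hx : D 0 0 ≠ 0 := fun h0 => by rw [h0] at hdet; simp at hdet
  refine ⟨D 0 0, hx, ?_⟩
  have : D = diagSL (D 0 0) hx := by
    apply SL2_ext
    · simp
    · simpa using d1
    · simpa using d2
    · rw [diagSL_11]; field_simp; linear_combination hdet
  rw [← this, hD]; group

/-! ### The torus frame of a stabilizer of type (T2) -/

namespace SplitRankOneGroup

variable {N : ℕ} (𝒢 : SplitRankOneGroup N)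

lemma φ_mul_mul {A B : SL(2, ℂ)} {c c' : GL (Fin N) ℂ} (hc : c ∈ 𝒢.C) :
    𝒢.φ A * c * (𝒢.φ B * c') = 𝒢.φ (A * B) * (c * c') := by
  rw [map_mul]; exact Commute.mul_mul_mul_comm (𝒢.C_central c hc B) _ _

/-- In the second alternative `A` is `i` times a real matrix of determinant `-1`, that is, the class
of `A` in `PGL₂(ℝ)` has negative determinant. -/
lemma conjSL_eq_or_of_real {A : SL(2, ℂ)} {c : GL (Fin N) ℂ} (hc : c ∈ 𝒢.C)
    (h : 𝒢.φ A * c ∈ realGL N) : conjSL A = A ∨ conjSL A = -A := by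
  have h' : conjGL N (𝒢.φ A * c) = 𝒢.φ A * c := h
  rw [map_mul, conj_φ] at h'
  exact 𝒢.eq_or_eq_neg (𝒢.conj_mem_C hc) hc h'

/-- The image of `H` in `PGL₂(ℂ)` is the maximal torus fixing the columns of the real matrix `P`,
and the image of `H(ℝ)` is the identity component of its group of real points. -/
structure IsTorusFrame (H : Subgroup (GL (Fin N) ℂ)) (P : SL(2, ℂ)) : Prop where
  real : conjSL P = P
  mem : ∀ A, ∀ c ∈ 𝒢.C, 𝒢.φ A * c ∈ H → ∃ l, ∃ hl : l ≠ 0, A = P * diagSL l hl * P⁻¹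
  exists_mem : ∀ l, ∀ hl : l ≠ 0, ∃ c ∈ 𝒢.C, 𝒢.φ (P * diagSL l hl * P⁻¹) * c ∈ H
  mem_real : ∀ A, ∀ c ∈ 𝒢.C, 𝒢.φ A * c ∈ H → 𝒢.φ A * c ∈ realGL N →
    ∃ l : ℝ, ∃ hl : (l : ℂ) ≠ 0, A = P * diagSL l hl * P⁻¹
  exists_real : ∀ l : ℝ, 0 < l → ∀ hl : (l : ℂ) ≠ 0, ∃ c ∈ 𝒢.C,
    𝒢.φ (P * diagSL l hl * P⁻¹) * c ∈ H ∧ 𝒢.φ (P * diagSL l hl * P⁻¹) * c ∈ realGL N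

lemma stab_mk_one (H : Subgroup 𝒢.G) : 𝒢.stab H (QuotientGroup.mk 1) = H.map 𝒢.G.subtype := by
  rw [stab]; congr 1; exact MulAction.stabilizer_quotient H

lemma eq_or_neg_of_smul {M A : SL(2, ℂ)} {l : ℂ}
    (h : (M : Matrix (Fin 2) (Fin 2) ℂ) = l • (A : Matrix (Fin 2) (Fin 2) ℂ)) : A = M ∨ A = -M := by
  have hd := congrArg Matrix.det h
  rw [Matrix.det_smul, M.2, A.2] at hd
  simp only [Fintype.card_fin, mul_one] at hd
  have : l * l = 1 := by rw [← sq]; exact hd.symm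
  rcases mul_self_eq_one_iff.1 this with rfl | rfl
  · left; apply Subtype.ext; simpa using h.symm
  · right; apply Subtype.ext
    rw [Matrix.SpecialLinearGroup.coe_neg, h]; simp

lemma exists_torusFrame (H : Subgroup 𝒢.G) (h : 𝒢.IsTypeT2 H (QuotientGroup.mk 1)) :
    ∃ P, 𝒢.IsTorusFrame (H.map 𝒢.G.subtype) P := by
  obtain ⟨⟨δ, hδ⟩, γ, hγ⟩ := h
  simp only [Q, R, stab_mk_one] at hδ hγ
  set K := H.map 𝒢.G.subtype
  -- the frame
  set d : ℝ := (γ : Matrix (Fin 2) (Fin 2) ℝ).det with hd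
  have hd0 : d ≠ 0 := (Matrix.isUnits_det_units γ).ne_zero
  -- The columns of `!![1, e; 1, -e]` are common eigenvectors of all matrices `!![p, q; q, p]`, and
  -- this `e` gives `P0` determinant one.
  set e : ℝ := -d / 2 with he
  have he0 : e ≠ 0 := by rw [he]; simpa using hd0
  let P0 : Matrix (Fin 2) (Fin 2) ℝ := ((γ⁻¹ : GL (Fin 2) ℝ) : Matrix (Fin 2) (Fin 2) ℝ) * !![1, e; 1, -e]
  have hγP0 : (γ : Matrix (Fin 2) (Fin 2) ℝ) * P0 = !![1, e; 1, -e] := by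
    simp only [P0]
    rw [← mul_assoc, ← Units.val_mul]; simp
  have hP0 : P0.det = 1 := by
    have := congrArg Matrix.det hγP0
    rw [Matrix.det_mul, ← hd, Matrix.det_fin_two_of] at this
    apply mul_left_cancel₀ hd0
    rw [this, he]; ring
  let P : SL(2, ℂ) := Matrix.SpecialLinearGroup.map Complex.ofRealHom ⟨P0, hP0⟩
  have hP : conjSL P = P := by
    apply SL2_ext <;> exact Complex.conj_ofReal _
  have hPm : (P : Matrix (Fin 2) (Fin 2) ℂ) = P0.map Complex.ofReal := rfl
  let γc : Matrix (Fin 2) (Fin 2) ℂ := (γ : Matrix (Fin 2) (Fin 2) ℝ).map Complex.ofReal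
  have hγdet : IsUnit γc.det := by
    have : γc.det = Complex.ofRealHom d := (RingHom.map_det Complex.ofRealHom _).symm
    rw [this]; simpa using hd0
  have hγu : IsUnit γc := (Matrix.isUnit_iff_isUnit_det _).2 hγdet
  have hPu : IsUnit (P : Matrix (Fin 2) (Fin 2) ℂ) := by
    rw [Matrix.isUnit_iff_isUnit_det, P.2]; exact isUnit_one
  have hmapmul : ∀ X Y : Matrix (Fin 2) (Fin 2) ℝ, (X * Y).map Complex.ofReal =
      X.map Complex.ofReal * Y.map Complex.ofReal := fun X Y => Matrix.map_mul (f := Complex.ofRealHom)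
  have hγP : γc * (P : Matrix (Fin 2) (Fin 2) ℂ) = !![1, (e : ℂ); 1, -(e : ℂ)] := by
    rw [hPm, ← hmapmul, hγP0]
    ext i j; fin_cases i <;> fin_cases j <;> simp
  -- The eigenvalues of `!![p, q; q, p]` are `p + q` and `p - q`; here they are set equal to `l` and
  -- `l⁻¹`. `F2` goes the opposite way.
  have F1 : ∀ l (hl : l ≠ 0), γc * ((P * diagSL l hl * P⁻¹ : SL(2, ℂ)) : Matrix (Fin 2) (Fin 2) ℂ) =
      !![(l + l⁻¹) / 2, (l - l⁻¹) / 2; (l - l⁻¹) / 2, (l + l⁻¹) / 2] * γc := by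
    intro l hl
    have h1 : ((P * diagSL l hl * P⁻¹ : SL(2, ℂ)) : Matrix (Fin 2) (Fin 2) ℂ) * (P : Matrix (Fin 2) (Fin 2) ℂ) =
        (P : Matrix (Fin 2) (Fin 2) ℂ) * !![l, 0; 0, l⁻¹] := by
      rw [← Matrix.SpecialLinearGroup.coe_mul, inv_mul_cancel_right, Matrix.SpecialLinearGroup.coe_mul]; rfl
    rw [← hPu.mul_left_inj, mul_assoc γc, h1, ← mul_assoc, hγP, mul_assoc, hγP]
    ext i j; fin_cases i <;> fin_cases j <;> simp [Matrix.mul_apply, Fin.sum_univ_two] <;> ring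
  have F2 : ∀ (A : SL(2, ℂ)) (m p q : ℂ), γc * (A : Matrix (Fin 2) (Fin 2) ℂ) = m • !![p, q; q, p] * γc →
      (A : Matrix (Fin 2) (Fin 2) ℂ) * P = P * !![m * (p + q), 0; 0, m * (p - q)] := by
    intro A m p q h
    rw [← hγu.mul_right_inj, ← mul_assoc, h, mul_assoc, ← mul_assoc γc, hγP]
    ext i j; fin_cases i <;> fin_cases j <;> simp [Matrix.mul_apply, Fin.sum_univ_two] <;> ring
  have hreal : ∀ l : ℝ, 0 < l → ∀ hl : (l : ℂ) ≠ 0, ∃ c ∈ 𝒢.C,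
      𝒢.φ (P * diagSL l hl * P⁻¹) * c ∈ K ∧ 𝒢.φ (P * diagSL l hl * P⁻¹) * c ∈ realGL N := by
    intro l hl0 hl
    -- Equality in `PGL₂` determines the `SL₂`-component only up to sign, so an element over the
    -- square root is found first and then squared.
    obtain ⟨m, hm0, rfl⟩ : ∃ m : ℝ, 0 < m ∧ l = m * m := ⟨√l, Real.sqrt_pos.2 hl0, (Real.mul_self_sqrt hl0.le).symm⟩
    have hm : (m : ℂ) ≠ 0 := by exact_mod_cast hm0.ne'
    have hpq : ((m + m⁻¹) / 2) ^ 2 - ((m - m⁻¹) / 2) ^ 2 = 1 := by field_simp; ring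
    let W : GL (Fin 2) ℝ := Matrix.GeneralLinearGroup.mkOfDetNeZero
      !![(m + m⁻¹) / 2, (m - m⁻¹) / 2; (m - m⁻¹) / 2, (m + m⁻¹) / 2] (by
        rw [Matrix.det_fin_two_of, ← sq, ← sq, hpq]; exact one_ne_zero)
    obtain ⟨h, ⟨hK, hR⟩, A, c, hc, x, hx, rfl, hM⟩ := (hγ (γ⁻¹ * W * γ)).2 ⟨1, _, _, one_ne_zero, hpq, by
      rw [one_smul]
      have : γ * (γ⁻¹ * W * γ) * γ⁻¹ = W := by group
      rw [this]; rfl⟩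
    have hM' : ((γ⁻¹ * W * γ : GL (Fin 2) ℝ) : Matrix (Fin 2) (Fin 2) ℝ).map Complex.ofReal =
        ((P * diagSL m hm * P⁻¹ : SL(2, ℂ)) : Matrix (Fin 2) (Fin 2) ℂ) := by
      rw [← hγu.mul_right_inj, F1]
      change (γ : Matrix (Fin 2) (Fin 2) ℝ).map Complex.ofReal * _ = _ * (γ : Matrix (Fin 2) (Fin 2) ℝ).map Complex.ofReal
      rw [← hmapmul, ← Units.val_mul]
      have : γ * (γ⁻¹ * W * γ) = W * γ := by group
      rw [this, Units.val_mul, hmapmul]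
      congr 1
      ext i j; fin_cases i <;> fin_cases j <;> simp [W, Matrix.GeneralLinearGroup.mkOfDetNeZero]
    rw [hM'] at hM
    have hA : A * A = P * diagSL ((m * m : ℝ) : ℂ) hl * P⁻¹ := by
      have : diagSL ((m * m : ℝ) : ℂ) hl = diagSL (m * m) (mul_ne_zero hm hm) := by
        apply SL2_ext <;> simp
      rw [this, ← SL2_conj_diag P _ _ hm hm]
      rcases eq_or_neg_of_smul hM with rfl | rfl <;> simp
    have key : 𝒢.φ (P * diagSL ((m * m : ℝ) : ℂ) hl * P⁻¹) * (c * c) = 𝒢.φ A * c * (𝒢.φ A * c) := by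
      rw [𝒢.φ_mul_mul hc, hA]
    refine ⟨c * c, 𝒢.C.mul_mem hc hc, ?_, ?_⟩
    · rw [key]; exact K.mul_mem hK hK
    · rw [key]; exact (realGL N).mul_mem hR hR
  -- a hyperbolic element
  have h2 : ((2 : ℝ) : ℂ) ≠ 0 := by norm_num
  obtain ⟨c0, hc0, hK0, -⟩ := hreal 2 two_pos h2
  set A0 := P * diagSL ((2 : ℝ) : ℂ) h2 * P⁻¹ with hA0
  have hQ : ∀ A : SL(2, ℂ), ∀ c ∈ 𝒢.C, 𝒢.φ A * c ∈ K → ∃ m p q : ℂ, m ≠ 0 ∧ p ^ 2 - q ^ 2 = 1 ∧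
      ((δ * (A : GL (Fin 2) ℂ) * δ⁻¹ : GL (Fin 2) ℂ) : Matrix (Fin 2) (Fin 2) ℂ) = m • !![p, q; q, p] := by
    intro A c hc hA
    exact (hδ (A : GL (Fin 2) ℂ)).1 ⟨_, hA, A, c, hc, 1, one_ne_zero, rfl, by simp⟩
  obtain ⟨m0, p0, q0, hm0, hpq0, hδ0⟩ := hQ A0 c0 hc0 hK0
  have hinj : ∀ A B : SL(2, ℂ), (A : GL (Fin 2) ℂ) = B → A = B := fun A B h =>
    Matrix.SpecialLinearGroup.toGL_injective h
  refine ⟨P, hP, ?_, ?_, ?_, hreal⟩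
  · intro A c hc hA
    obtain ⟨m, p, q, hm, hpq, hδA⟩ := hQ A c hc hA
    -- Matrices of the form `!![p, q; q, p]` commute with one another, so `A` centralises the
    -- regular element `A0` and lies in its torus.
    have hcomm : (δ * (A : GL (Fin 2) ℂ) * δ⁻¹) * (δ * (A0 : GL (Fin 2) ℂ) * δ⁻¹) =
        (δ * (A0 : GL (Fin 2) ℂ) * δ⁻¹) * (δ * (A : GL (Fin 2) ℂ) * δ⁻¹) := by
      apply Units.ext
      rw [Units.val_mul _ (δ * (A0 : GL (Fin 2) ℂ) * δ⁻¹), Units.val_mul _ (δ * (A : GL (Fin 2) ℂ) * δ⁻¹), hδA, hδ0]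
      ext i j; fin_cases i <;> fin_cases j <;> simp [Matrix.mul_apply, Fin.sum_univ_two] <;> ring
    refine SL2_eq_conj_diag_of_commute (hl := h2) (by norm_num) (hinj _ _ ?_)
    rw [← hA0]
    have := congrArg (fun u => δ⁻¹ * u * δ) hcomm
    simp only [mul_assoc, inv_mul_cancel, mul_one, inv_mul_cancel_left] at this
    simpa using this
  · intro l hl
    obtain ⟨m, rfl⟩ : ∃ m : ℂ, l = m * m := by
      obtain ⟨m, hm⟩ := IsAlgClosed.exists_pow_nat_eq l two_pos
      exact ⟨m, by rw [← hm, sq]⟩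
    have hm : m ≠ 0 := left_ne_zero_of_mul hl
    set A := P * diagSL m hm * P⁻¹ with hA
    have hAA0 : A * A0 = A0 * A := by
      rw [hA, hA0, SL2_conj_diag, SL2_conj_diag]
      congr 3; ring
    set X := δ * (A : GL (Fin 2) ℂ) * δ⁻¹ with hX
    have hcomm : X * (δ * (A0 : GL (Fin 2) ℂ) * δ⁻¹) = (δ * (A0 : GL (Fin 2) ℂ) * δ⁻¹) * X := by
      have : (A : GL (Fin 2) ℂ) * A0 = A0 * A := by rw [← map_mul, hAA0, map_mul]
      rw [hX]
      simp only [mul_assoc, inv_mul_cancel_left]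
      rw [← mul_assoc (A : GL (Fin 2) ℂ), this]; simp only [mul_assoc]
    -- With `q0 = 0` the element `A0` would be scalar, yet it does not commute with a unipotent.
    have hq0 : q0 ≠ 0 := by
      rintro rfl
      set B := P * upperSL 1 * P⁻¹ with hB
      have h1 : (δ * (A0 : GL (Fin 2) ℂ) * δ⁻¹) * (δ * (B : GL (Fin 2) ℂ) * δ⁻¹) =
          (δ * (B : GL (Fin 2) ℂ) * δ⁻¹) * (δ * (A0 : GL (Fin 2) ℂ) * δ⁻¹) := by
        apply Units.ext
        rw [Units.val_mul, Units.val_mul _ (δ * (A0 : GL (Fin 2) ℂ) * δ⁻¹), hδ0]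
        ext i j; fin_cases i <;> fin_cases j <;> simp [Matrix.mul_apply, Fin.sum_univ_two] <;> ring
      have h3 : A0 * B = B * A0 := by
        apply hinj
        have := congrArg (fun u => δ⁻¹ * u * δ) h1
        simp only [mul_assoc, inv_mul_cancel, mul_one, inv_mul_cancel_left] at this
        simpa using this
      have h4 : diagSL ((2 : ℝ) : ℂ) h2 * upperSL 1 = upperSL 1 * diagSL ((2 : ℝ) : ℂ) h2 := by
        have := congrArg (fun u => P⁻¹ * u * P) h3
        simp only [hA0, hB, mul_assoc, inv_mul_cancel, mul_one, inv_mul_cancel_left] at this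
        exact this
      have h5 := congrArg (fun u : SL(2, ℂ) => u 0 1) h4
      simp only [SL2_mul_apply] at h5
      norm_num at h5
    have hm' := congrArg (fun u : GL (Fin 2) ℂ => (u : Matrix (Fin 2) (Fin 2) ℂ)) hcomm
    simp only [Units.val_mul X, Units.val_mul _ X, hδ0] at hm'
    have e1 := congrFun (congrFun hm' 0) 0
    have e2 := congrFun (congrFun hm' 0) 1
    simp [Matrix.mul_apply, Fin.sum_univ_two] at e1 e2
    -- Since `q0 ≠ 0`, commuting with `!![p0, q0; q0, p0]` forces `X` into the same form, and its
    -- determinant one becomes the equation `p² - q² = 1`.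
    have mq : m0 * q0 ≠ 0 := mul_ne_zero hm0 hq0
    have x1 : X 0 1 = X 1 0 := mul_left_cancel₀ mq (by linear_combination e1)
    have x2 : X 0 0 = X 1 1 := mul_left_cancel₀ mq (by linear_combination e2)
    have hXdet : (X : Matrix (Fin 2) (Fin 2) ℂ).det = 1 := by
      rw [hX, Units.val_mul, Units.val_mul, Matrix.det_units_conj]
      exact A.2
    rw [Matrix.det_fin_two] at hXdet
    obtain ⟨h, hK, A', c, hc, y, hy, rfl, hA'⟩ := (hδ (A : GL (Fin 2) ℂ)).2 ⟨1, X 0 0, X 0 1, one_ne_zero,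
      by rw [← hXdet, ← x1, ← x2]; ring, by
        rw [← hX]; ext i j; fin_cases i <;> fin_cases j <;> simp [x1, x2]⟩
    have hAA : A' * A' = P * diagSL (m * m) hl * P⁻¹ := by
      rw [← SL2_conj_diag P m m hm hm]
      rcases eq_or_neg_of_smul (M := A) hA' with rfl | rfl <;> simp [hA]
    refine ⟨c * c, 𝒢.C.mul_mem hc hc, ?_⟩
    rw [← hAA, ← 𝒢.φ_mul_mul hc]
    exact K.mul_mem hK hK
  · intro A c hc hA hR
    rcases 𝒢.conjSL_eq_or_of_real hc hR with hr | hr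
    · let M0 : Matrix (Fin 2) (Fin 2) ℝ := Matrix.of fun i j => (A i j).re
      have hM0 : M0.map Complex.ofReal = (A : Matrix (Fin 2) (Fin 2) ℂ) := by
        ext i j
        have : starRingEnd ℂ (A i j) = A i j := congrArg (fun u : SL(2, ℂ) => u i j) hr
        simpa [M0] using Complex.conj_eq_iff_re.1 this
      have hdet : M0.det = 1 := by
        have h1 : (M0.map Complex.ofReal).det = Complex.ofRealHom M0.det := (RingHom.map_det Complex.ofRealHom _).symm
        rw [hM0, A.2] at h1
        exact Complex.ofReal_injective (by simpa using h1.symm)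
      let M : GL (Fin 2) ℝ := Matrix.GeneralLinearGroup.mkOfDetNeZero M0 (by rw [hdet]; exact one_ne_zero)
      obtain ⟨m, p, q, hm, hpq, hM⟩ := (hγ M).1 ⟨_, ⟨hA, hR⟩, A, c, hc, 1, one_ne_zero, rfl, by
        rw [one_smul]; exact hM0⟩
      have h3 : (γ : Matrix (Fin 2) (Fin 2) ℝ) * M0 = m • !![p, q; q, p] * (γ : Matrix (Fin 2) (Fin 2) ℝ) := by
        rw [← hM, ← Units.val_mul, inv_mul_cancel_right, Units.val_mul]; rfl
      have h4 := congrArg (fun Z : Matrix (Fin 2) (Fin 2) ℝ => Z.map Complex.ofReal) h3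
      simp only [hmapmul, hM0] at h4
      have h5 := F2 A m p q (by
        rw [show (γc : Matrix (Fin 2) (Fin 2) ℂ) * (A : Matrix (Fin 2) (Fin 2) ℂ) = _ from h4]
        congr 1
        ext i j; fin_cases i <;> fin_cases j <;> simp)
      obtain ⟨hx, hA'⟩ := SL2_eq_conj_diag h5
      have e : ((m * (p + q) : ℝ) : ℂ) = m * (p + q) := by push_cast; rfl
      refine ⟨m * (p + q), by rw [e]; exact hx, ?_⟩
      rw [hA']; congr 3; exact e.symm
    -- Now `-i A` is real of determinant `-1`, whereas the elements of the preimage of `PSO₁,₁(ℝ)`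
    -- have determinant `m² > 0`.
    · exfalso
      let M0 : Matrix (Fin 2) (Fin 2) ℝ := Matrix.of fun i j => (A i j).im
      have hM0 : M0.map Complex.ofReal = (-Complex.I) • (A : Matrix (Fin 2) (Fin 2) ℂ) := by
        ext i j
        have : starRingEnd ℂ (A i j) = - A i j := congrArg (fun u : SL(2, ℂ) => u i j) hr
        have h1 := congrArg Complex.re this
        simp at h1
        apply Complex.ext <;> simp [M0]
        linarith
      have hdet : M0.det = -1 := by
        have h1 : (M0.map Complex.ofReal).det = Complex.ofRealHom M0.det := (RingHom.map_det Complex.ofRealHom _).symm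
        rw [hM0, Matrix.det_smul, A.2] at h1
        apply Complex.ofReal_injective
        simpa using h1.symm
      let M : GL (Fin 2) ℝ := Matrix.GeneralLinearGroup.mkOfDetNeZero M0 (by rw [hdet]; norm_num)
      obtain ⟨m, p, q, hm, hpq, hM⟩ := (hγ M).1 ⟨_, ⟨hA, hR⟩, A, c, hc, -Complex.I, by simp, rfl, hM0⟩
      have h1 := congrArg Matrix.det hM
      rw [Units.val_mul, Units.val_mul, Matrix.det_units_conj, Matrix.det_smul, Matrix.det_fin_two_of] at h1
      have h3 : (M : Matrix (Fin 2) (Fin 2) ℝ).det = -1 := hdet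
      rw [h3, ← sq, ← sq, hpq] at h1
      simp at h1
      nlinarith [sq_nonneg m]

end SplitRankOneGroup

/-! ### From elements of `H` to its Lie algebra -/

lemma aeval_mem_expPoly {σ : Type*} (p : MvPolynomial σ ℝ) {v : ℂ → σ → ℂ}
    (h : ∀ a, (fun s => v s a) ∈ expPoly) : (fun s => MvPolynomial.aeval (v s) p) ∈ expPoly := by
  induction p using MvPolynomial.induction_on with
  | C r =>
    simp only [MvPolynomial.aeval_C]
    exact expPoly.algebraMap_mem (r : ℂ)
  | add p q hp hq => simp only [map_add]; exact expPoly.add_mem hp hq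
  | mul_X p a hp => simp only [map_mul, MvPolynomial.aeval_X]; exact expPoly.mul_mem hp (h a)

lemma const_mem_expPoly (r : ℂ) : (fun _ : ℂ => r) ∈ expPoly := expPoly.algebraMap_mem r

lemma mul_apply_mem_expPoly {n : ℕ} {X Y : ℂ → Matrix (Fin n) (Fin n) ℂ}
    (hX : ∀ i j, (fun s => X s i j) ∈ expPoly) (hY : ∀ i j, (fun s => Y s i j) ∈ expPoly) (i j : Fin n) :
    (fun s => (X s * Y s) i j) ∈ expPoly := by
  simp only [Matrix.mul_apply]
  have : (fun s => ∑ k, X s i k * Y s k j) = ∑ k, (fun s => X s i k) * (fun s => Y s k j) := by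
    funext s; simp [Finset.sum_apply]
  rw [this]
  exact expPoly.sum_mem fun k _ => expPoly.mul_mem (hX i k) (hY k j)

lemma const_mul_mul_const_mem_expPoly {n : ℕ} (X Z : Matrix (Fin n) (Fin n) ℂ)
    {Y : ℂ → Matrix (Fin n) (Fin n) ℂ} (hY : ∀ i j, (fun s => Y s i j) ∈ expPoly) (i j : Fin n) :
    (fun s => (X * Y s * Z) i j) ∈ expPoly :=
  mul_apply_mem_expPoly (X := fun s => X * Y s) (Y := fun _ => Z)
    (mul_apply_mem_expPoly (X := fun _ => X) (Y := Y) (fun i j => const_mem_expPoly (X i j)) hY)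
    (fun i j => const_mem_expPoly (Z i j)) i j

lemma Ad_diagonal_injective {n : ℕ} (Q : GL (Fin n) ℂ) {x y : Fin n → ℂ}
    (h : Ad Q (Matrix.diagonal x) = Ad Q (Matrix.diagonal y)) : x = y := by
  have := congrArg (Ad Q⁻¹) h
  rw [Ad_inv_Ad, Ad_inv_Ad] at this
  exact Matrix.diagonal_injective this

namespace SplitRankOneGroup

variable {N : ℕ} (𝒢 : SplitRankOneGroup N)

/-- The square of a real element of the split torus `C` lies on a real one-parameter subgroup. -/
lemma exists_log_of_real {c : GL (Fin N) ℂ} (hc : c ∈ 𝒢.C) (hr : c ∈ realGL N) :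
    ∃ z ∈ 𝒢.lieC, NormedSpace.exp z = (c * c : GL (Fin N) ℂ) ∧
      ∀ i j, (fun s : ℂ => NormedSpace.exp (s • z) i j) ∈ expPoly := by
  obtain ⟨k, Q, m, hQ, hC⟩ := 𝒢.exists_C_form
  obtain ⟨t, ht⟩ := (hC c).1 hc
  -- The eigenvalues of the real element `c` are real, although the parameters `t j` need not be.
  -- Hence their squares are the squares of their absolute values, and `μ i` is the real logarithm
  -- of such a square.
  let μ : Fin N → ℝ := fun i => ∑ j, m i j * (2 * Real.log ‖(t j : ℂ)‖)
  have hexp : ∀ s : ℂ, NormedSpace.exp (s • Ad Q (Matrix.diagonal (fun i => (μ i : ℂ)))) =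
      Ad Q (Matrix.diagonal (fun i => Complex.exp (μ i * s))) := by
    intro s
    rw [exp_smul_GL_conj, ← Matrix.diagonal_smul, Matrix.exp_diagonal]
    congr 2
    funext i
    simp [Complex.exp_eq_exp_ℂ, mul_comm]
  refine ⟨Ad Q (Matrix.diagonal (fun i => (μ i : ℂ))), ?_, ?_, ?_⟩
  · intro s
    let t' : Fin k → ℂˣ := fun j => Units.mk0 (Complex.exp (s * (2 * Real.log ‖(t j : ℂ)‖ : ℝ))) (Complex.exp_ne_zero _)
    have key : Ad Q (Matrix.diagonal (fun i => ∏ j, ((t' j ^ m i j : ℂˣ) : ℂ))) =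
        Ad Q (Matrix.diagonal (fun i => Complex.exp (μ i * s))) := by
      congr 2
      funext i
      simp only [t', Units.val_zpow_eq_zpow_val, Units.val_mk0, ← Complex.exp_int_mul, ← Complex.exp_sum, μ]
      congr 1
      push_cast
      rw [Finset.sum_mul]
      exact Finset.sum_congr rfl fun j _ => by ring
    have hinv : IsUnit (Ad Q (Matrix.diagonal (fun i => ∏ j, ((t' j ^ m i j : ℂˣ) : ℂ)))) := by
      rw [key, ← hexp]; exact Matrix.isUnit_exp _
    obtain ⟨g, hg⟩ := hinv
    exact ⟨g, (hC g).2 ⟨t', hg⟩, by rw [hexp, hg, key]⟩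
  · have h1 := hexp 1
    rw [one_smul] at h1
    rw [h1, Units.val_mul, ht, Ad_mul_Ad, Matrix.diagonal_mul_diagonal]
    congr 2
    funext i
    set x : ℂ := ∏ j, ((t j ^ m i j : ℂˣ) : ℂ) with hx
    have hxr : starRingEnd ℂ x = x := by
      have h2 : conjM (c : Matrix (Fin N) (Fin N) ℂ) = c :=
        congrArg (fun u : GL (Fin N) ℂ => (u : Matrix (Fin N) (Fin N) ℂ)) (show conjGL N c = c from hr)
      rw [ht, conjM_Ad, show conjGL N Q = Q from hQ] at h2
      have h3 : conjM (Matrix.diagonal fun i => ∏ j, ((t j ^ m i j : ℂˣ) : ℂ)) =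
          Matrix.diagonal (fun i => starRingEnd ℂ (∏ j, ((t j ^ m i j : ℂˣ) : ℂ))) := by
        ext a b
        by_cases hab : a = b
        · subst hab; simp
        · simp [hab]
      rw [h3] at h2
      exact congrFun (Ad_diagonal_injective Q h2) i
    have hxx : x * x = ((‖x‖ * ‖x‖ : ℝ) : ℂ) := by
      conv_lhs => rw [← hxr]
      rw [mul_comm, hxr, ← sq]
      have := Complex.mul_conj x
      rw [hxr] at this
      rw [sq, this, Complex.normSq_eq_norm_sq]; push_cast; ring
    rw [hxx, mul_one, ← Complex.ofReal_exp]
    congr 1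
    have hn : ‖x‖ = Real.exp (∑ j, m i j * Real.log ‖(t j : ℂ)‖) := by
      rw [hx, norm_prod, Real.exp_sum]
      refine Finset.prod_congr rfl fun j _ => ?_
      have hpos : 0 < ‖(t j : ℂ)‖ := norm_pos_iff.2 (t j).ne_zero
      rw [Units.val_zpow_eq_zpow_val, norm_zpow, ← Real.rpow_intCast, Real.rpow_def_of_pos hpos, mul_comm]
    rw [hn, ← Real.exp_add, ← two_mul, Finset.mul_sum]
    congr 1
    exact Finset.sum_congr rfl fun j _ => by ring
  · intro i j
    have : (fun s : ℂ => NormedSpace.exp (s • Ad Q (Matrix.diagonal (fun i => (μ i : ℂ)))) i j) =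
        fun s => ((Q : Matrix (Fin N) (Fin N) ℂ) * Matrix.diagonal (fun i => Complex.exp (μ i * s)) *
          ((Q⁻¹ : GL (Fin N) ℂ) : Matrix (Fin N) (Fin N) ℂ)) i j := by
      funext s; rw [hexp]; rfl
    rw [this]
    refine const_mul_mul_const_mem_expPoly _ _ (Y := fun s => Matrix.diagonal (fun i => Complex.exp (μ i * s)))
      (fun i j => ?_) i j
    by_cases hij : i = j
    · subst hij; simpa using exp_mem_expPoly (μ i)
    · simpa [hij] using const_mem_expPoly 0

variable {𝒢}

/-- The Lie algebra of `H` surjects onto that of its image in `PGL₂`. -/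
lemma IsTorusFrame.exists_mem_lieAlg {K : Subgroup (GL (Fin N) ℂ)} {P : SL(2, ℂ)} (hP : 𝒢.IsTorusFrame K P)
    (hK : IsRealAlgebraic K) :
    ∃ z ∈ 𝒢.lieC, 𝒢.dφ (conjBy P slH) + z ∈ lieAlg (K : Set (GL (Fin N) ℂ)) := by
  have h2 : ((2 : ℝ) : ℂ) ≠ 0 := by norm_num
  obtain ⟨c, hc, hcK, hcR⟩ := hP.exists_real 2 two_pos h2
  have hcr : c ∈ realGL N := by
    have h3 : 𝒢.φ (P * diagSL ((2 : ℝ) : ℂ) h2 * P⁻¹) ∈ realGL N := by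
      change conjGL N _ = _
      have h4 : conjSL (diagSL ((2 : ℝ) : ℂ) h2) = diagSL ((2 : ℝ) : ℂ) h2 := by
        apply SL2_ext <;> simp [map_ofNat (starRingEnd ℂ) 2]
      rw [conj_φ, map_mul conjSL, map_mul conjSL, map_inv conjSL, hP.real, h4]
      rfl
    exact ((realGL N).mul_mem_cancel_left h3).1 hcR
  obtain ⟨z, hz, hze, hzp⟩ := 𝒢.exists_log_of_real hc hcr
  -- `exp L = 4`, as needed for the square of the element of `H` lying over `diag(2, 1/2)`.
  set L : ℝ := Real.log 2 * 2 with hL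
  have hL0 : (L : ℂ) ≠ 0 := by
    have : 0 < Real.log 2 := Real.log_pos one_lt_two
    exact_mod_cast (mul_pos this two_pos).ne'
  have htr : (conjBy P slH).trace = 0 := by simp
  have htr' : ((L : ℂ) • conjBy P slH).trace = 0 := by simp
  have hcomm : Commute (𝒢.dφ ((L : ℂ) • conjBy P slH)) z := (𝒢.commute_lieC_dφ hz htr').symm
  set η := 𝒢.dφ ((L : ℂ) • conjBy P slH) + z with hη
  have hφ : ∀ s : ℂ, NormedSpace.exp (s • 𝒢.dφ ((L : ℂ) • conjBy P slH)) =
      (𝒢.φ (P * diagSL (Complex.exp (L * s)) (Complex.exp_ne_zero _) * P⁻¹) : Matrix (Fin N) (Fin N) ℂ) := by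
    intro s
    rw [map_smul, smul_smul, ← 𝒢.φ_expSL htr]
    congr 2
    rw [← diagSL_eq_exp, ← expSL_conj trace_slH P htr, mul_comm]
    rfl
  have hexp : ∀ s : ℂ, NormedSpace.exp (s • η) =
      (𝒢.φ (P * diagSL (Complex.exp (L * s)) (Complex.exp_ne_zero _) * P⁻¹) : Matrix (Fin N) (Fin N) ℂ) *
        NormedSpace.exp (s • z) := by
    intro s
    rw [hη, smul_add, Matrix.exp_add_of_commute _ _ ((hcomm.smul_left s).smul_right s), hφ]
  have hentry : ∀ i j, (fun s : ℂ => NormedSpace.exp (s • η) i j) ∈ expPoly := by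
    intro i j
    simp only [hexp]
    refine mul_apply_mem_expPoly (X := fun s => (𝒢.φ (P * diagSL (Complex.exp (L * s)) (Complex.exp_ne_zero _) * P⁻¹) :
      Matrix (Fin N) (Fin N) ℂ)) (Y := fun s => NormedSpace.exp (s • z)) (fun i j => ?_) hzp i j
    simp only [φ_apply]
    refine aeval_mem_expPoly (𝒢.polyφ i j) (v := fun s ab => ((P * diagSL (Complex.exp (L * s)) (Complex.exp_ne_zero _) * P⁻¹ :
      SL(2, ℂ)) : Matrix (Fin 2) (Fin 2) ℂ) ab.1 ab.2) fun a => ?_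
    refine const_mul_mul_const_mem_expPoly (P : Matrix (Fin 2) (Fin 2) ℂ) ((P⁻¹ : SL(2, ℂ)) : Matrix (Fin 2) (Fin 2) ℂ)
      (Y := fun s => (diagSL (Complex.exp (L * s)) (Complex.exp_ne_zero _) : Matrix (Fin 2) (Fin 2) ℂ)) (fun i j => ?_) a.1 a.2
    fin_cases i <;> fin_cases j
    · exact exp_mem_expPoly L
    · exact const_mem_expPoly 0
    · exact const_mem_expPoly 0
    · have := exp_mem_expPoly (-L)
      convert this using 1
      funext s
      change (Complex.exp (L * s))⁻¹ = _
      rw [← Complex.exp_neg]; push_cast; rw [neg_mul]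
  have hη1 : NormedSpace.exp η = ((𝒢.φ (P * diagSL ((2 : ℝ) : ℂ) h2 * P⁻¹) * c *
      (𝒢.φ (P * diagSL ((2 : ℝ) : ℂ) h2 * P⁻¹) * c) : GL (Fin N) ℂ) : Matrix (Fin N) (Fin N) ℂ) := by
    have := hexp 1
    rw [one_smul, one_smul, hze] at this
    rw [this, 𝒢.φ_mul_mul hc, SL2_conj_diag, Units.val_mul (𝒢.φ _)]
    congr 5
    apply SL2_ext <;> simp [hL, mul_two, Complex.exp_add, Complex.exp_log]
  obtain ⟨S, hS⟩ := hK
  -- The powers `exp (n η)` lie in `K`. Along `s ↦ exp (s η)` each equation of `K` is an exponential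
  -- polynomial with real frequencies which vanishes at all natural numbers, hence identically.
  have hηK : η ∈ lieAlg (K : Set (GL (Fin N) ℂ)) := by
    intro s
    obtain ⟨g, hg⟩ := Matrix.isUnit_exp (s • η)
    refine ⟨g, (hS g).2 fun f hf => ?_, hg⟩
    rw [hg]
    have := expPoly_eq_zero (aeval_mem_expPoly f (v := fun s ij => NormedSpace.exp (s • η) ij.1 ij.2)
      fun a => hentry a.1 a.2) (fun n => by
        have h3 : NormedSpace.exp ((n : ℂ) • η) = (((𝒢.φ (P * diagSL ((2 : ℝ) : ℂ) h2 * P⁻¹) * c *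
          (𝒢.φ (P * diagSL ((2 : ℝ) : ℂ) h2 * P⁻¹) * c)) ^ n : GL (Fin N) ℂ) : Matrix (Fin N) (Fin N) ℂ) := by
          rw [Nat.cast_smul_eq_nsmul, Matrix.exp_nsmul, hη1, Units.val_pow_eq_pow_val]
        simp only [h3]
        exact (hS _).1 (K.pow_mem (K.mul_mem hcK hcK) n) f hf)
    exact congrFun this s
  refine ⟨(L : ℂ)⁻¹ • z, 𝒢.lieC.smul_mem _ hz, ?_⟩
  have := smul_mem_lieAlg hηK (L : ℂ)⁻¹
  rwa [hη, map_smul, smul_add, smul_smul, inv_mul_cancel₀ hL0, one_smul] at this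

end SplitRankOneGroup

/-! ### Frames, the matrix `Y` and the sign invariant -/

namespace SplitRankOneGroup

variable {N : ℕ} (𝒢 : SplitRankOneGroup N)

/-- A component in the derived group of an element of `G`, well defined up to sign. -/
def slPart (g : 𝒢.G) : SL(2, ℂ) := (𝒢.mem_G.1 g.2).choose

lemma slPart_spec (g : 𝒢.G) : ∃ c ∈ 𝒢.C, (g : GL (Fin N) ℂ) = 𝒢.φ (𝒢.slPart g) * c :=
  (𝒢.mem_G.1 g.2).choose_spec

lemma slPart_eq {g : 𝒢.G} {A : SL(2, ℂ)} {c : GL (Fin N) ℂ} (hc : c ∈ 𝒢.C)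
    (h : (g : GL (Fin N) ℂ) = 𝒢.φ A * c) : 𝒢.slPart g = A ∨ 𝒢.slPart g = -A := by
  obtain ⟨c', hc', e⟩ := 𝒢.slPart_spec g
  exact 𝒢.eq_or_eq_neg hc' hc (e.symm.trans h)

lemma slPart_mul (g g' : 𝒢.G) :
    𝒢.slPart (g * g') = 𝒢.slPart g * 𝒢.slPart g' ∨ 𝒢.slPart (g * g') = -(𝒢.slPart g * 𝒢.slPart g') := by
  obtain ⟨c, hc, e⟩ := 𝒢.slPart_spec g
  obtain ⟨c', hc', e'⟩ := 𝒢.slPart_spec g'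
  exact 𝒢.slPart_eq (𝒢.C.mul_mem hc hc') (by rw [Subgroup.coe_mul, e, e', 𝒢.φ_mul_mul hc])

lemma slPart_one : 𝒢.slPart 1 = 1 ∨ 𝒢.slPart 1 = -1 :=
  𝒢.slPart_eq 𝒢.C.one_mem (by simp)

/-- The element `φ(A)` of `G`. -/
def φG (A : SL(2, ℂ)) : 𝒢.G := ⟨𝒢.φ A, 𝒢.φ_mem_G A⟩

lemma slPart_φG (A : SL(2, ℂ)) : 𝒢.slPart (𝒢.φG A) = A ∨ 𝒢.slPart (𝒢.φG A) = -A :=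
  𝒢.slPart_eq 𝒢.C.one_mem (by simp [φG])

lemma mem_B_iff (b : 𝒢.G) : (b : GL (Fin N) ℂ) ∈ 𝒢.B ↔ 𝒢.slPart b 1 0 = 0 := by
  rw [mem_B]
  constructor
  · rintro ⟨A, hA, c, hc, e⟩
    rcases 𝒢.slPart_eq hc e with h | h <;> simp [h, hA]
  · intro h
    obtain ⟨c, hc, e⟩ := 𝒢.slPart_spec b
    exact ⟨_, h, c, hc, e⟩

lemma mem_T_iff (b : 𝒢.G) : (b : GL (Fin N) ℂ) ∈ 𝒢.T ↔ 𝒢.slPart b 1 0 = 0 ∧ 𝒢.slPart b 0 1 = 0 := by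
  rw [mem_T]
  constructor
  · rintro ⟨A, hA, hA', c, hc, e⟩
    rcases 𝒢.slPart_eq hc e with h | h <;> simp [h, hA, hA']
  · intro h
    obtain ⟨c, hc, e⟩ := 𝒢.slPart_spec b
    exact ⟨_, h.1, h.2, c, hc, e⟩

/-- The group of real points of `G`. -/
def realG : Subgroup 𝒢.G := (realGL N).comap 𝒢.G.subtype

lemma mem_realPts {K : Subgroup (GL (Fin N) ℂ)} {g : 𝒢.G} :
    g ∈ 𝒢.realPts K ↔ (g : GL (Fin N) ℂ) ∈ K ∧ g ∈ 𝒢.realG := Iff.rfl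

lemma φG_mem_realG {A : SL(2, ℂ)} (h : conjSL A = A) : 𝒢.φG A ∈ 𝒢.realG := by
  change conjGL N (𝒢.φ A) = 𝒢.φ A
  rw [conj_φ, h]

lemma conjSL_slPart {g : 𝒢.G} (h : g ∈ 𝒢.realG) :
    conjSL (𝒢.slPart g) = 𝒢.slPart g ∨ conjSL (𝒢.slPart g) = -𝒢.slPart g := by
  obtain ⟨c, hc, e⟩ := 𝒢.slPart_spec g
  have h' : (g : GL (Fin N) ℂ) ∈ realGL N := h
  exact 𝒢.conjSL_eq_or_of_real hc (e ▸ h')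

variable (P : SL(2, ℂ))

/-- The frame `M = A P` at `g = φ(A) c`, up to sign. -/
def frame (g : 𝒢.G) : SL(2, ℂ) := 𝒢.slPart g * P

lemma frame_mul (g g' : 𝒢.G) :
    𝒢.frame P (g * g') = 𝒢.slPart g * 𝒢.frame P g' ∨ 𝒢.frame P (g * g') = -(𝒢.slPart g * 𝒢.frame P g') := by
  rcases 𝒢.slPart_mul g g' with h | h <;> simp [frame, h, mul_assoc]

/-- The sign invariant of real points. -/
def sg (g : 𝒢.G) : ℝ := (𝒢.frame P g 1 0 * starRingEnd ℂ (𝒢.frame P g 1 1)).re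

/-- The point of `𝔰𝔩₂` attached to `g`. -/
def Yg (g : 𝒢.G) : Matrix (Fin 2) (Fin 2) ℂ := conjBy (𝒢.frame P g) slH

lemma conjBy_neg (A : SL(2, ℂ)) (ξ : Matrix (Fin 2) (Fin 2) ℂ) : conjBy (-A) ξ = conjBy A ξ := by
  have : (-A)⁻¹ = -A⁻¹ := by rw [inv_eq_iff_mul_eq_one]; simp
  simp [conjBy, this]

lemma Yg_mul (g g' : 𝒢.G) : 𝒢.Yg P (g * g') = conjBy (𝒢.slPart g) (𝒢.Yg P g') := by
  rcases 𝒢.frame_mul P g g' with h | h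
  · rw [Yg, h, conjBy_mul]; rfl
  · rw [Yg, h, conjBy_neg, conjBy_mul]; rfl

lemma Yg_00 (g : 𝒢.G) : 𝒢.Yg P g 0 0 =
    𝒢.frame P g 0 0 * 𝒢.frame P g 1 1 + 𝒢.frame P g 0 1 * 𝒢.frame P g 1 0 := by
  rw [Yg, conjBy_apply, SL2_inv_00, SL2_inv_10]; simp [slH]
lemma Yg_01 (g : 𝒢.G) : 𝒢.Yg P g 0 1 = -2 * 𝒢.frame P g 0 0 * 𝒢.frame P g 0 1 := by
  rw [Yg, conjBy_apply, SL2_inv_01, SL2_inv_11]; simp [slH]; ring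
lemma Yg_10 (g : 𝒢.G) : 𝒢.Yg P g 1 0 = 2 * 𝒢.frame P g 1 0 * 𝒢.frame P g 1 1 := by
  rw [Yg, conjBy_apply, SL2_inv_00, SL2_inv_10]; simp [slH]; ring
lemma trace_Yg (g : 𝒢.G) : (𝒢.Yg P g).trace = 0 := by simp [Yg]

lemma Yg_det (g : 𝒢.G) : 𝒢.Yg P g 0 0 ^ 2 + 𝒢.Yg P g 0 1 * 𝒢.Yg P g 1 0 = 1 := by
  have h := SL2_det (𝒢.frame P g)
  rw [Yg_00, Yg_01, Yg_10]
  linear_combination (𝒢.frame P g 0 0 * 𝒢.frame P g 1 1 - 𝒢.frame P g 0 1 * 𝒢.frame P g 1 0 + 1) * h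

lemma Ad_dφ_conjBy (g : 𝒢.G) : Ad (g : GL (Fin N) ℂ) (𝒢.dφ (conjBy P slH)) = 𝒢.dφ (𝒢.Yg P g) := by
  obtain ⟨c, hc, e⟩ := 𝒢.slPart_spec g
  rw [e, Ad_mul, 𝒢.Ad_C_dφ hc (by simp), 𝒢.Ad_φ_dφ' _ (by simp), ← conjBy_mul]; rfl

/-- `slPart` is a choice and need not be continuous, but `Y` is a linear image of `Ad g` applied to
a fixed vector. -/
lemma continuous_Yg (i j : Fin 2) : Continuous fun g : 𝒢.G => 𝒢.Yg P g i j := by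
  have h1 : ∀ g : 𝒢.G, 𝒢.Yg P g = 𝒢.ψ (Ad (g : GL (Fin N) ℂ) (𝒢.dφ (conjBy P slH))) := fun g => by
    rw [Ad_dφ_conjBy, 𝒢.ψ_dφ (𝒢.trace_Yg P g)]
  simp only [h1]
  have h2 : Continuous fun g : 𝒢.G => Ad (g : GL (Fin N) ℂ) (𝒢.dφ (conjBy P slH)) := by
    unfold Ad
    have h3 : Continuous fun g : 𝒢.G => ((g : GL (Fin N) ℂ) : Matrix (Fin N) (Fin N) ℂ) :=
      Units.continuous_val.comp continuous_subtype_val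
    have h4 : Continuous fun g : 𝒢.G => (((g : GL (Fin N) ℂ)⁻¹ : GL (Fin N) ℂ) : Matrix (Fin N) (Fin N) ℂ) :=
      Units.continuous_coe_inv.comp continuous_subtype_val
    exact (h3.mul continuous_const).mul h4
  have h5 : Continuous 𝒢.ψ := 𝒢.ψ.continuous_of_finiteDimensional
  exact (continuous_apply_apply i j).comp (h5.comp h2)

lemma continuous_coe_φ (f : ℝ → SL(2, ℂ)) (hf : ∀ i j, Continuous fun s => f s i j) :
    Continuous fun s => (𝒢.φ (f s) : Matrix (Fin N) (Fin N) ℂ) := by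
  refine continuous_matrix fun i j => ?_
  simp only [φ_apply]
  induction 𝒢.polyφ i j using MvPolynomial.induction_on with
  | C a => simpa using continuous_const
  | add p q hp hq => simp only [map_add]; exact hp.add hq
  | mul_X p ij hp => simp only [map_mul, MvPolynomial.aeval_X]; exact hp.mul (hf ij.1 ij.2)

lemma continuous_φG_lower (g : 𝒢.G) : Continuous fun s : ℝ => 𝒢.φG (lowerSL s) * g := by
  refine Continuous.mul ?_ continuous_const
  refine Continuous.subtype_mk ?_ _
  have key : ∀ t : ℝ → ℝ, Continuous t →
      Continuous fun s : ℝ => (𝒢.φ (lowerSL (t s)) : Matrix (Fin N) (Fin N) ℂ) := by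
    intro t ht
    refine 𝒢.continuous_coe_φ (fun s => lowerSL (t s)) fun i j => ?_
    have h := Complex.continuous_ofReal.comp ht
    fin_cases i <;> fin_cases j <;> simp <;> first | exact continuous_const | exact h
  rw [Units.continuous_iff]
  refine ⟨key id continuous_id, ?_⟩
  have : ∀ s : ℝ, (𝒢.φ (lowerSL s))⁻¹ = 𝒢.φ (lowerSL ((-s : ℝ) : ℂ)) := by
    intro s
    rw [← map_inv]
    congr 1
    apply SL2_ext <;> simp only [SL2_inv_00, SL2_inv_01, SL2_inv_10, SL2_inv_11] <;> simp
  simp only [this]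
  exact key (fun s => -s) continuous_neg

end SplitRankOneGroup

lemma neg_diagSL (l : ℂ) (hl : l ≠ 0) : -diagSL l hl = diagSL (-l) (neg_ne_zero.2 hl) := by
  apply SL2_ext <;> simp [inv_neg]

/-! ### Borel orbits in terms of frames -/

namespace SplitRankOneGroup

variable {N : ℕ} (𝒢 : SplitRankOneGroup N) {P : SL(2, ℂ)} {H : Subgroup 𝒢.G}

lemma frame_mul_of_slPart {g h : 𝒢.G} {l : ℂ} {hl : l ≠ 0}
    (e : 𝒢.slPart h = P * diagSL l hl * P⁻¹) :
    𝒢.frame P (g * h) = 𝒢.frame P g * diagSL l hl ∨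
      𝒢.frame P (g * h) = -(𝒢.frame P g * diagSL l hl) := by
  have e' : 𝒢.slPart g * 𝒢.frame P h = 𝒢.frame P g * diagSL l hl := by
    rw [frame, e, frame]; group
  rw [← e']
  exact 𝒢.frame_mul P g h

variable {𝒢} in
-- The sign ambiguity is absorbed into the diagonal factor, by replacing `l` with `-l`.
lemma IsTorusFrame.frame_mul (hP : 𝒢.IsTorusFrame (H.map 𝒢.G.subtype) P) (g : 𝒢.G) {h : 𝒢.G}
    (hh : h ∈ H) : ∃ l, ∃ hl : l ≠ 0, 𝒢.frame P (g * h) = 𝒢.frame P g * diagSL l hl := by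
  obtain ⟨c, hc, e⟩ := 𝒢.slPart_spec h
  obtain ⟨l, hl, e'⟩ := hP.mem _ c hc (by rw [← e]; exact Subgroup.mem_map_of_mem 𝒢.G.subtype hh)
  rcases 𝒢.frame_mul_of_slPart (g := g) e' with h1 | h1
  · exact ⟨l, hl, h1⟩
  · exact ⟨-l, neg_ne_zero.2 hl, by rw [h1, ← neg_diagSL l hl, mul_neg]⟩

variable {𝒢} in
lemma IsTorusFrame.frame_mul_real (hP : 𝒢.IsTorusFrame (H.map 𝒢.G.subtype) P) (g : 𝒢.G) {h : 𝒢.G}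
    (hh : h ∈ H) (hr : h ∈ 𝒢.realG) :
    ∃ l : ℝ, ∃ hl : (l : ℂ) ≠ 0, 𝒢.frame P (g * h) = 𝒢.frame P g * diagSL l hl := by
  obtain ⟨c, hc, e⟩ := 𝒢.slPart_spec h
  obtain ⟨l, hl, e'⟩ := hP.mem_real _ c hc
    (by rw [← e]; exact Subgroup.mem_map_of_mem 𝒢.G.subtype hh) (by rw [← e]; exact hr)
  rcases 𝒢.frame_mul_of_slPart (g := g) e' with h1 | h1
  · exact ⟨l, hl, h1⟩
  · refine ⟨-l, by push_cast; exact neg_ne_zero.2 hl, ?_⟩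
    rw [h1, ← mul_neg, neg_diagSL l hl]; simp

lemma frame_mul_of_eq {h : 𝒢.G} {l : ℂ} {hl : l ≠ 0} {c : GL (Fin N) ℂ} (hc : c ∈ 𝒢.C)
    (e : (h : GL (Fin N) ℂ) = 𝒢.φ (P * diagSL l hl * P⁻¹) * c) (g : 𝒢.G) :
    𝒢.frame P (g * h) = 𝒢.frame P g * diagSL l hl ∨
      𝒢.frame P (g * h) = -(𝒢.frame P g * diagSL l hl) := by
  rcases 𝒢.slPart_eq hc e with h1 | h1
  · exact 𝒢.frame_mul_of_slPart h1
  · have : 𝒢.slPart h = P * diagSL (-l) (neg_ne_zero.2 hl) * P⁻¹ := by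
      rw [h1, ← neg_diagSL l hl]; simp
    rcases 𝒢.frame_mul_of_slPart (g := g) this with h2 | h2
    · right; rw [h2, ← neg_diagSL l hl, mul_neg]
    · left; rw [h2, ← neg_diagSL l hl, mul_neg, neg_neg]

variable {𝒢} in
lemma IsTorusFrame.exists_mem_H (hP : 𝒢.IsTorusFrame (H.map 𝒢.G.subtype) P) (l : ℂ) (hl : l ≠ 0) :
    ∃ h ∈ H, ∀ g, 𝒢.frame P (g * h) = 𝒢.frame P g * diagSL l hl ∨
      𝒢.frame P (g * h) = -(𝒢.frame P g * diagSL l hl) := by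
  obtain ⟨c, hc, hK⟩ := hP.exists_mem l hl
  obtain ⟨h, hh, e⟩ := Subgroup.mem_map.1 hK
  exact ⟨h, hh, 𝒢.frame_mul_of_eq hc e⟩

variable {𝒢} in
lemma IsTorusFrame.exists_mem_H_real (hP : 𝒢.IsTorusFrame (H.map 𝒢.G.subtype) P) (l : ℝ)
    (h0 : 0 < l) (hl : (l : ℂ) ≠ 0) :
    ∃ h ∈ H, h ∈ 𝒢.realG ∧ ∀ g, 𝒢.frame P (g * h) = 𝒢.frame P g * diagSL l hl ∨
      𝒢.frame P (g * h) = -(𝒢.frame P g * diagSL l hl) := by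
  obtain ⟨c, hc, hK, hr⟩ := hP.exists_real l h0 hl
  obtain ⟨h, hh, e⟩ := Subgroup.mem_map.1 hK
  exact ⟨h, hh, by rw [← e] at hr; exact hr, 𝒢.frame_mul_of_eq hc e⟩

lemma Yg_eq_of_frame {g g' : 𝒢.G} {l : ℂ} {hl : l ≠ 0}
    (h : 𝒢.frame P g' = 𝒢.frame P g * diagSL l hl) : 𝒢.Yg P g' = 𝒢.Yg P g := by
  rw [Yg, h, conjBy_mul, conjBy_diag_slH (by simp) (by simp)]; rfl

variable {𝒢} in
lemma IsTorusFrame.Yg_mul_H (hP : 𝒢.IsTorusFrame (H.map 𝒢.G.subtype) P) (g : 𝒢.G) {h : 𝒢.G}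
    (hh : h ∈ H) : 𝒢.Yg P (g * h) = 𝒢.Yg P g := by
  obtain ⟨l, hl, e⟩ := hP.frame_mul g hh
  exact 𝒢.Yg_eq_of_frame e

variable {𝒢} in
-- Diagonal matrices commute with `slH`, so `Y` descends to a function on `G/H`.
lemma IsTorusFrame.Yg_congr (hP : 𝒢.IsTorusFrame (H.map 𝒢.G.subtype) P) {g g' : 𝒢.G}
    (h : (QuotientGroup.mk g : 𝒢.G ⧸ H) = QuotientGroup.mk g') : 𝒢.Yg P g = 𝒢.Yg P g' := by
  have := hP.Yg_mul_H g (QuotientGroup.eq.1 h)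
  rw [mul_inv_cancel_left] at this
  exact this.symm

lemma mk_mem_orbit {S : Subgroup 𝒢.G} {g g' : 𝒢.G} :
    (QuotientGroup.mk g' : 𝒢.G ⧸ H) ∈ MulAction.orbit S (QuotientGroup.mk g : 𝒢.G ⧸ H) ↔
      ∃ h ∈ H, g' * (g * h)⁻¹ ∈ S := by
  constructor
  · rintro ⟨⟨b, hb⟩, e⟩
    refine ⟨(b * g)⁻¹ * g', QuotientGroup.eq.1 e, ?_⟩
    have : g' * (g * ((b * g)⁻¹ * g'))⁻¹ = b := by group
    rwa [this]
  · rintro ⟨h, hh, hb⟩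
    refine ⟨⟨_, hb⟩, QuotientGroup.eq.2 ?_⟩
    have : ((⟨_, hb⟩ : S) • g)⁻¹ * g' = h := by
      change (g' * (g * h)⁻¹ * g)⁻¹ * g' = h
      group
    change ((⟨_, hb⟩ : S) • g)⁻¹ * g' ∈ H
    rwa [this]

lemma slPart_div (g g' : 𝒢.G) : 𝒢.slPart (g' * g⁻¹) = 𝒢.frame P g' * (𝒢.frame P g)⁻¹ ∨
    𝒢.slPart (g' * g⁻¹) = -(𝒢.frame P g' * (𝒢.frame P g)⁻¹) := by
  rcases 𝒢.frame_mul P (g' * g⁻¹) g with h | h <;> rw [inv_mul_cancel_right] at h <;> rw [h]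
  · left; simp
  · right; simp

lemma div_mem_B (P : SL(2, ℂ)) (g g' : 𝒢.G) : g' * g⁻¹ ∈ 𝒢.B.subgroupOf 𝒢.G ↔
    𝒢.frame P g' 1 0 * 𝒢.frame P g 1 1 = 𝒢.frame P g' 1 1 * 𝒢.frame P g 1 0 := by
  rw [Subgroup.mem_subgroupOf, mem_B_iff]
  have h1 : (𝒢.frame P g' * (𝒢.frame P g)⁻¹) 1 0 =
      𝒢.frame P g' 1 0 * 𝒢.frame P g 1 1 - 𝒢.frame P g' 1 1 * 𝒢.frame P g 1 0 := by
    rw [SL2_mul_apply, SL2_inv_00, SL2_inv_10]; ring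
  rcases 𝒢.slPart_div (P := P) g g' with h | h <;> rw [h]
  · rw [h1, sub_eq_zero]
  · rw [Matrix.SpecialLinearGroup.coe_neg, Matrix.neg_apply, h1, neg_eq_zero, sub_eq_zero]

/-- Two points lie in the same orbit of the Borel subgroup exactly when the second rows of their
frames are proportional up to the action of the torus. -/
lemma mk_mem_orbit_B (hP : 𝒢.IsTorusFrame (H.map 𝒢.G.subtype) P) (g g' : 𝒢.G) :
    (QuotientGroup.mk g' : 𝒢.G ⧸ H) ∈
        MulAction.orbit (𝒢.B.subgroupOf 𝒢.G) (QuotientGroup.mk g : 𝒢.G ⧸ H) ↔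
      ∃ l : ℂ, l ≠ 0 ∧ 𝒢.frame P g' 1 0 * 𝒢.frame P g 1 1 =
        l ^ 2 * (𝒢.frame P g' 1 1 * 𝒢.frame P g 1 0) := by
  rw [mk_mem_orbit]
  constructor
  · rintro ⟨h, hh, hb⟩
    obtain ⟨l, hl, e⟩ := hP.frame_mul g hh
    rw [𝒢.div_mem_B P, e] at hb
    simp only [SL2_mul_apply, diagSL_00, diagSL_01, diagSL_10, diagSL_11] at hb
    refine ⟨l, hl, ?_⟩
    field_simp at hb
    linear_combination hb
  · rintro ⟨l, hl, e⟩
    obtain ⟨h, hh, e'⟩ := hP.exists_mem_H l hl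
    refine ⟨h, hh, ?_⟩
    rw [𝒢.div_mem_B P]
    rcases e' g with e' | e' <;> rw [e'] <;>
      simp only [Matrix.SpecialLinearGroup.coe_neg, Matrix.neg_apply, SL2_mul_apply, diagSL_00, diagSL_01, diagSL_10, diagSL_11] <;>
      field_simp <;> first | linear_combination e | linear_combination -e

lemma frame_row_ne_zero (P : SL(2, ℂ)) (g : 𝒢.G) (h0 : 𝒢.frame P g 1 0 = 0) : 𝒢.frame P g 1 1 ≠ 0 := by
  intro h1
  have := SL2_det (𝒢.frame P g)
  rw [h0, h1] at this; simp at this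

lemma frame_row_ne_zero' (P : SL(2, ℂ)) (g : 𝒢.G) (h0 : 𝒢.frame P g 1 1 = 0) : 𝒢.frame P g 1 0 ≠ 0 :=
  fun h1 => 𝒢.frame_row_ne_zero P g h1 h0

lemma Yg_10_ne_zero (P : SL(2, ℂ)) (g : 𝒢.G) :
    𝒢.Yg P g 1 0 ≠ 0 ↔ 𝒢.frame P g 1 0 ≠ 0 ∧ 𝒢.frame P g 1 1 ≠ 0 := by
  rw [Yg_10]; simp

/-- Every nonzero complex number is a square `l²`, so all rows without zero entries form one orbit.
-/
lemma mk_mem_orbit_B_of_ne_zero (hP : 𝒢.IsTorusFrame (H.map 𝒢.G.subtype) P) {g : 𝒢.G}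
    (hg : 𝒢.Yg P g 1 0 ≠ 0) (g' : 𝒢.G) :
    (QuotientGroup.mk g' : 𝒢.G ⧸ H) ∈
        MulAction.orbit (𝒢.B.subgroupOf 𝒢.G) (QuotientGroup.mk g : 𝒢.G ⧸ H) ↔
      𝒢.Yg P g' 1 0 ≠ 0 := by
  rw [𝒢.mk_mem_orbit_B hP]
  rw [Yg_10_ne_zero] at hg ⊢
  obtain ⟨h0, h1⟩ := hg
  constructor
  · rintro ⟨l, hl, e⟩
    refine ⟨fun h => ?_, fun h => ?_⟩
    · have := 𝒢.frame_row_ne_zero P g' h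
      rw [h, zero_mul] at e
      exact mul_ne_zero (pow_ne_zero 2 hl) (mul_ne_zero this h0) e.symm
    · have := 𝒢.frame_row_ne_zero' P g' h
      rw [h, zero_mul, mul_zero] at e
      exact mul_ne_zero this h1 e
  · rintro ⟨h0', h1'⟩
    obtain ⟨l, hl⟩ := IsAlgClosed.exists_pow_nat_eq
      (𝒢.frame P g' 1 0 * 𝒢.frame P g 1 1 / (𝒢.frame P g' 1 1 * 𝒢.frame P g 1 0)) two_pos
    refine ⟨l, ?_, ?_⟩
    · rintro rfl
      rw [zero_pow two_ne_zero, eq_comm, div_eq_zero_iff] at hl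
      simp [h0, h1, h0', h1'] at hl
    · rw [hl]; field_simp

/-- The common factor `ε` records whether the component in `SL₂` is real or imaginary. As `ε` has
absolute value one, it disappears from `sg`. -/
lemma exists_real_frame (hP : conjSL P = P) {g : 𝒢.G} (hg : g ∈ 𝒢.realG) :
    ∃ ε : ℂ, (ε = 1 ∨ ε = Complex.I) ∧ ∃ r : Fin 2 → Fin 2 → ℝ, ∀ i j, 𝒢.frame P g i j = ε * r i j := by
  rcases 𝒢.conjSL_slPart hg with h | h
  · have h1 : conjSL (𝒢.frame P g) = 𝒢.frame P g := by rw [frame, map_mul, h, hP]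
    refine ⟨1, Or.inl rfl, fun i j => (𝒢.frame P g i j).re, fun i j => ?_⟩
    have := congrArg (fun A : SL(2, ℂ) => A i j) h1
    simp only [conjSL_apply] at this
    rw [one_mul, Complex.conj_eq_iff_re.1 this]
  · have h1 : conjSL (𝒢.frame P g) = -𝒢.frame P g := by rw [frame, map_mul, h, hP, neg_mul]
    refine ⟨Complex.I, Or.inr rfl, fun i j => (𝒢.frame P g i j).im, fun i j => ?_⟩
    have := congrArg (fun A : SL(2, ℂ) => A i j) h1
    simp only [conjSL_apply, Matrix.SpecialLinearGroup.coe_neg, Matrix.neg_apply] at this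
    have h2 := congrArg Complex.re this
    simp at h2
    apply Complex.ext <;> simp
    linarith

lemma sg_eq {g : 𝒢.G} {ε : ℂ} (hε : ε = 1 ∨ ε = Complex.I) {r : Fin 2 → Fin 2 → ℝ}
    (h : ∀ i j, 𝒢.frame P g i j = ε * r i j) : 𝒢.sg P g = r 1 0 * r 1 1 := by
  rw [sg, h, h]
  rcases hε with rfl | rfl <;> simp

/-- Real points of `H` have real `l`, so they change the ratio of the row entries by the positive
factor `l²`, and `B` preserves this ratio. Conversely every positive factor is attained, so where
the product of the entries is nonzero its sign is a complete invariant. -/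
lemma mk_mem_realBorelOrbit (hP : 𝒢.IsTorusFrame (H.map 𝒢.G.subtype) P) {g g' : 𝒢.G}
    (hg : g ∈ 𝒢.realG) (hg' : g' ∈ 𝒢.realG) (h0 : 𝒢.sg P g ≠ 0) :
    (QuotientGroup.mk g' : 𝒢.G ⧸ H) ∈ 𝒢.realBorelOrbit H (QuotientGroup.mk g) ↔
      0 < 𝒢.sg P g * 𝒢.sg P g' := by
  obtain ⟨ε, hε, r, hr⟩ := 𝒢.exists_real_frame hP.real hg
  obtain ⟨ε', hε', r', hr'⟩ := 𝒢.exists_real_frame hP.real hg'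
  have hε0 : ε ≠ 0 := by rcases hε with rfl | rfl <;> simp
  have hε0' : ε' ≠ 0 := by rcases hε' with rfl | rfl <;> simp
  rw [𝒢.sg_eq hε hr] at h0 ⊢
  rw [𝒢.sg_eq hε' hr']
  have hr0 : r' 1 0 = 0 → r' 1 1 ≠ 0 := fun h h1 =>
    𝒢.frame_row_ne_zero P g' (by rw [hr', h]; simp) (by rw [hr', h1]; simp)
  have hr1 : r' 1 1 = 0 → r' 1 0 ≠ 0 := fun h h1 => hr0 h1 h
  rw [realBorelOrbit, mk_mem_orbit]
  have key : ∀ (h : 𝒢.G) (l : ℝ) (hl : (l : ℂ) ≠ 0),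
      (𝒢.frame P (g * h) = 𝒢.frame P g * diagSL l hl ∨
        𝒢.frame P (g * h) = -(𝒢.frame P g * diagSL l hl)) →
      (g' * (g * h)⁻¹ ∈ 𝒢.B.subgroupOf 𝒢.G ↔ r' 1 0 * r 1 1 = l ^ 2 * (r' 1 1 * r 1 0)) := by
    intro h l hl e
    have hl' : l ≠ 0 := by exact_mod_cast hl
    rw [𝒢.div_mem_B P]
    have : (𝒢.frame P g' 1 0 * 𝒢.frame P (g * h) 1 1 = 𝒢.frame P g' 1 1 * 𝒢.frame P (g * h) 1 0) ↔
        ((r' 1 0 * r 1 1 : ℝ) : ℂ) = (l ^ 2 * (r' 1 1 * r 1 0) : ℝ) := by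
      rcases e with e | e <;> rw [e] <;>
        simp only [Matrix.SpecialLinearGroup.coe_neg, Matrix.neg_apply, SL2_mul_apply, diagSL_00,
          diagSL_01, diagSL_10, diagSL_11, hr, hr'] <;> push_cast <;> constructor <;> intro e
      all_goals
        first
        | (field_simp at e ⊢; linear_combination e)
        | (field_simp at e ⊢; linear_combination -e)
    rw [this, Complex.ofReal_inj]
  constructor
  · rintro ⟨h, hh, hb⟩
    have hB : g' * (g * h)⁻¹ ∈ 𝒢.B.subgroupOf 𝒢.G := hb.1
    have hR : g' * (g * h)⁻¹ ∈ 𝒢.realG := hb.2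
    have hhr : h ∈ 𝒢.realG := by
      have : h = g⁻¹ * (g' * (g * h)⁻¹)⁻¹ * g' := by group
      rw [this]
      exact mul_mem (mul_mem (inv_mem hg) (inv_mem hR)) hg'
    obtain ⟨l, hl, e⟩ := hP.frame_mul_real g hh hhr
    have := (key h l hl (Or.inl e)).1 hB
    have hl' : l ≠ 0 := by exact_mod_cast hl
    have h1 : r 1 0 ≠ 0 := left_ne_zero_of_mul h0
    have h2 : r 1 1 ≠ 0 := right_ne_zero_of_mul h0
    have h3 : r' 1 1 ≠ 0 := fun h3 => by
      rw [h3, zero_mul, mul_zero] at this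
      exact mul_ne_zero (hr1 h3) h2 this
    have h4 : r 1 0 * r 1 1 * (r' 1 0 * r' 1 1) = (l * r' 1 1 * r 1 0) ^ 2 := by
      linear_combination r 1 0 * r' 1 1 * this
    rw [h4]; positivity
  · intro hpos
    have h1 : r 1 0 ≠ 0 := left_ne_zero_of_mul h0
    have h2 : r 1 1 ≠ 0 := right_ne_zero_of_mul h0
    have h3 : r' 1 1 ≠ 0 := fun h3 => by rw [h3] at hpos; simp at hpos
    -- The value that `l²` must take; the sign condition makes it positive.
    set f := (r' 1 0 * r 1 1) / (r' 1 1 * r 1 0) with hf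
    have hfpos : 0 < f := by
      have : f = (r 1 0 * r 1 1 * (r' 1 0 * r' 1 1)) / (r' 1 1 * r 1 0) ^ 2 := by
        rw [hf]; field_simp
      rw [this]; positivity
    have hs : 0 < √f := Real.sqrt_pos.2 hfpos
    obtain ⟨h, hh, hhr, e⟩ := hP.exists_mem_H_real (√f) hs (by exact_mod_cast hs.ne')
    refine ⟨h, hh, (key h _ _ (e g)).2 ?_, ?_⟩
    · rw [Real.sq_sqrt hfpos.le, hf]; field_simp
    · change g' * (g * h)⁻¹ ∈ 𝒢.realG
      exact mul_mem hg' (inv_mem (mul_mem hg hhr))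

end SplitRankOneGroup

/-! ### Openness of orbits and the reflection operator -/

namespace SplitRankOneGroup

variable {N : ℕ} (𝒢 : SplitRankOneGroup N) {P : SL(2, ℂ)} {H : Subgroup 𝒢.G}

lemma mem_realSpan {g : 𝒢.G} (hg : g ∈ 𝒢.realG) (x : 𝒢.G ⧸ H) :
    x ∈ 𝒢.realSpan H (𝒢.realBorelOrbit H (QuotientGroup.mk g)) ↔
      ∃ g' ∈ 𝒢.realG, (QuotientGroup.mk g' : 𝒢.G ⧸ H) = x := by
  constructor
  · rintro ⟨a, ha, -, ⟨b, rfl⟩, rfl⟩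
    have hb : (b : 𝒢.G) ∈ 𝒢.realG := b.2.2
    have ha' : a ∈ 𝒢.realG := ha.2
    exact ⟨a * (b * g), mul_mem ha' (mul_mem hb hg), rfl⟩
  · rintro ⟨g', hg', rfl⟩
    have h : g' * g⁻¹ ∈ 𝒢.realG := mul_mem hg' (inv_mem hg)
    refine ⟨g' * g⁻¹, ⟨(g' * g⁻¹).2, h⟩, _, MulAction.mem_orbit_self _, ?_⟩
    rw [MulAction.Quotient.smul_mk, smul_eq_mul, inv_mul_cancel_right]

lemma mk_mem_realLocus {g : 𝒢.G} (hg : g ∈ 𝒢.realG) :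
    (QuotientGroup.mk g : 𝒢.G ⧸ H) ∈ 𝒢.realLocus H :=
  ⟨g, g, hg.symm, rfl, rfl⟩

lemma isRealBorelOrbit_mk {g : 𝒢.G} (hg : g ∈ 𝒢.realG) :
    𝒢.IsRealBorelOrbit H (𝒢.realBorelOrbit H (QuotientGroup.mk g)) :=
  ⟨_, 𝒢.mk_mem_realLocus hg, rfl⟩

lemma exists_eq_realBorelOrbit {g : 𝒢.G} (hg : g ∈ 𝒢.realG) {O₁ : Set (𝒢.G ⧸ H)}
    (h₁ : 𝒢.IsRealBorelOrbit H O₁)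
    (h₂ : O₁ ⊆ 𝒢.realSpan H (𝒢.realBorelOrbit H (QuotientGroup.mk g))) :
    ∃ g' ∈ 𝒢.realG, O₁ = 𝒢.realBorelOrbit H (QuotientGroup.mk g') := by
  obtain ⟨x, -, rfl⟩ := h₁
  obtain ⟨g', hg', rfl⟩ := (𝒢.mem_realSpan hg x).1 (h₂ (MulAction.mem_orbit_self _))
  exact ⟨g', hg', rfl⟩

lemma realBorelOrbit_subset_realSpan {g g' : 𝒢.G} (hg : g ∈ 𝒢.realG) (hg' : g' ∈ 𝒢.realG) :
    𝒢.realBorelOrbit H (QuotientGroup.mk g') ⊆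
      𝒢.realSpan H (𝒢.realBorelOrbit H (QuotientGroup.mk g)) := by
  rintro - ⟨b, rfl⟩
  exact (𝒢.mem_realSpan hg _).2 ⟨b * g', mul_mem b.2.2 hg', rfl⟩

lemma sg_eq_zero_iff (hP : conjSL P = P) {g : 𝒢.G} (hg : g ∈ 𝒢.realG) :
    𝒢.sg P g = 0 ↔ 𝒢.Yg P g 1 0 = 0 := by
  obtain ⟨ε, hε, r, hr⟩ := 𝒢.exists_real_frame hP hg
  have hε0 : ε ≠ 0 := by rcases hε with rfl | rfl <;> simp
  rw [𝒢.sg_eq hε hr, Yg_10, hr, hr]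
  simp [hε0]

/-- Points of the open orbit are found near every point, by moving along the opposite unipotent
group. -/
lemma exists_near (P : SL(2, ℂ)) {V : Set (𝒢.G ⧸ H)} (hV : IsOpen V) {g : 𝒢.G}
    (hg : (QuotientGroup.mk g : 𝒢.G ⧸ H) ∈ V) (h0 : 𝒢.Yg P g 1 0 = 0) :
    ∃ g', (QuotientGroup.mk g' : 𝒢.G ⧸ H) ∈ V ∧ 𝒢.Yg P g' 1 0 ≠ 0 ∧ (g ∈ 𝒢.realG → g' ∈ 𝒢.realG) := by
  have hφ : ∀ s : ℝ, 𝒢.Yg P (𝒢.φG (lowerSL s) * g) 1 0 =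
      s * (2 * 𝒢.Yg P g 0 0 - s * 𝒢.Yg P g 0 1) := by
    intro s
    have h1 : 𝒢.Yg P (𝒢.φG (lowerSL s) * g) = conjBy (lowerSL s) (𝒢.Yg P g) := by
      rw [Yg_mul]
      rcases 𝒢.slPart_φG (lowerSL s) with h | h <;> rw [h]
      exact conjBy_neg _ _
    have ht : 𝒢.Yg P g 1 1 = -𝒢.Yg P g 0 0 := by
      have := 𝒢.trace_Yg P g
      rw [Matrix.trace_fin_two] at this
      linear_combination this
    rw [h1, conjBy_apply, SL2_inv_00, SL2_inv_10]
    simp only [lowerSL_10, lowerSL_11]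
    rw [ht, h0]; ring
  have hc : Continuous fun s : ℝ => (QuotientGroup.mk (𝒢.φG (lowerSL s) * g) : 𝒢.G ⧸ H) :=
    continuous_quot_mk.comp (𝒢.continuous_φG_lower g)
  have hnhds : ∀ᶠ s : ℝ in nhds 0, (QuotientGroup.mk (𝒢.φG (lowerSL (s : ℂ)) * g) : 𝒢.G ⧸ H) ∈ V := by
    refine hc.continuousAt.eventually_mem (hV.mem_nhds ?_)
    have : 𝒢.φG (lowerSL ((0 : ℝ) : ℂ)) = 1 := by
      have : lowerSL ((0 : ℝ) : ℂ) = 1 := by apply SL2_ext <;> simp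
      rw [this]; exact Subtype.ext (map_one 𝒢.φ)
    rw [this, one_mul]; exact hg
  obtain ⟨δ, hδ, hδV⟩ := Metric.eventually_nhds_iff.1 hnhds
  have hy : 𝒢.Yg P g 0 0 ≠ 0 := fun h => by
    have := 𝒢.Yg_det P g
    rw [h, h0] at this; simp at this
  have hreal : ∀ s : ℝ, g ∈ 𝒢.realG → 𝒢.φG (lowerSL s) * g ∈ 𝒢.realG := fun s h =>
    mul_mem (𝒢.φG_mem_realG (by apply SL2_ext <;> simp [conjSL_apply])) h
  have hδ2 : ((δ / 2 : ℝ) : ℂ) ≠ 0 := by exact_mod_cast (half_pos hδ).ne'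
  -- If both signs of the parameter failed, adding the two equations would give `Y₀₀ = 0`, against
  -- `Y₀₀² = 1`.
  by_cases h1 : 𝒢.Yg P (𝒢.φG (lowerSL (δ / 2 : ℝ)) * g) 1 0 = 0
  · refine ⟨𝒢.φG (lowerSL (-(δ / 2) : ℝ)) * g, hδV ?_, ?_, hreal _⟩
    · rw [Real.dist_eq, sub_zero, abs_neg, abs_of_pos (half_pos hδ)]; exact half_lt_self hδ
    · intro h2
      rw [hφ] at h1 h2
      have e1 := (mul_eq_zero.1 h1).resolve_left hδ2
      have e2 := (mul_eq_zero.1 h2).resolve_left (by rw [Complex.ofReal_neg]; exact neg_ne_zero.2 hδ2)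
      apply hy
      rw [Complex.ofReal_neg] at e2
      linear_combination (e1 + e2) / 4
  · refine ⟨𝒢.φG (lowerSL (δ / 2 : ℝ)) * g, hδV ?_, h1, hreal _⟩
    rw [Real.dist_eq, sub_zero, abs_of_pos (half_pos hδ)]; exact half_lt_self hδ

lemma isOpen_of_Yg (hP : 𝒢.IsTorusFrame (H.map 𝒢.G.subtype) P) {S : Set ℂ} (hS : IsOpen S) (i j : Fin 2) :
    IsOpen {x : 𝒢.G ⧸ H | ∃ g, QuotientGroup.mk g = x ∧ 𝒢.Yg P g i j ∈ S} := by
  rw [← (QuotientGroup.isQuotientMap_mk H).isOpen_preimage]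
  convert hS.preimage (𝒢.continuous_Yg P i j) using 1
  ext g
  constructor
  · rintro ⟨g', h, h'⟩
    rw [hP.Yg_congr h] at h'; exact h'
  · exact fun h => ⟨g, rfl, h⟩

/-- Nonvanishing of `Y₁₀` is an open condition and cuts out a single orbit. A point with `Y₁₀ = 0`
is a limit of points of that orbit, so its own orbit is not open. -/
lemma mk_mem_Omax (hP : 𝒢.IsTorusFrame (H.map 𝒢.G.subtype) P) (g : 𝒢.G) :
    (QuotientGroup.mk g : 𝒢.G ⧸ H) ∈ 𝒢.Omax H ↔ 𝒢.Yg P g 1 0 ≠ 0 := by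
  constructor
  · intro hO h0
    obtain ⟨g', h1, h2, -⟩ := 𝒢.exists_near P hO (MulAction.mem_orbit_self _) h0
    rw [MulAction.mem_orbit_symm, 𝒢.mk_mem_orbit_B_of_ne_zero hP h2] at h1
    exact h1 h0
  · intro h
    change IsOpen (MulAction.orbit (𝒢.B.subgroupOf 𝒢.G) (QuotientGroup.mk g : 𝒢.G ⧸ H))
    convert 𝒢.isOpen_of_Yg hP (isOpen_compl_singleton (x := (0 : ℂ))) 1 0 using 1
    ext x
    obtain ⟨g', rfl⟩ := QuotientGroup.mk_surjective x
    rw [𝒢.mk_mem_orbit_B_of_ne_zero hP h]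
    constructor
    · exact fun h => ⟨g', rfl, h⟩
    · rintro ⟨g'', e, h'⟩
      rw [hP.Yg_congr e] at h'; exact h'

lemma sg_ne_zero_of_isOpenInSpan (hP : 𝒢.IsTorusFrame (H.map 𝒢.G.subtype) P) {g : 𝒢.G}
    (hg : g ∈ 𝒢.realG) (ho : 𝒢.IsOpenInSpan H (𝒢.realBorelOrbit H (QuotientGroup.mk g))) :
    𝒢.sg P g ≠ 0 := by
  intro h0
  obtain ⟨V, hV, e⟩ := ho
  have hgV : (QuotientGroup.mk g : 𝒢.G ⧸ H) ∈ V := by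
    have : (QuotientGroup.mk g : 𝒢.G ⧸ H) ∈ 𝒢.realBorelOrbit H (QuotientGroup.mk g) :=
      MulAction.mem_orbit_self _
    rw [e] at this; exact this.1
  obtain ⟨g', h1, h2, h3⟩ := 𝒢.exists_near P hV hgV ((𝒢.sg_eq_zero_iff hP.real hg).1 h0)
  have h4 : (QuotientGroup.mk g' : 𝒢.G ⧸ H) ∈ 𝒢.realBorelOrbit H (QuotientGroup.mk g) := by
    rw [e]; exact ⟨h1, (𝒢.mem_realSpan hg _).2 ⟨g', h3 hg, rfl⟩⟩
  have h5 : 𝒢.sg P g' ≠ 0 := fun h => h2 ((𝒢.sg_eq_zero_iff hP.real (h3 hg)).1 h)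
  have h6 : (QuotientGroup.mk g : 𝒢.G ⧸ H) ∈ 𝒢.realBorelOrbit H (QuotientGroup.mk g') :=
    MulAction.mem_orbit_symm.1 h4
  rw [𝒢.mk_mem_realBorelOrbit hP (h3 hg) hg h5, h0, mul_zero] at h6
  exact lt_irrefl _ h6

lemma realBorelOrbit_eq (hP : 𝒢.IsTorusFrame (H.map 𝒢.G.subtype) P) {g g' : 𝒢.G}
    (hg : g ∈ 𝒢.realG) (hg' : g' ∈ 𝒢.realG) (h : 0 < 𝒢.sg P g * 𝒢.sg P g') :
    𝒢.realBorelOrbit H (QuotientGroup.mk g') = 𝒢.realBorelOrbit H (QuotientGroup.mk g) :=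
  MulAction.orbit_eq_iff.2 ((𝒢.mk_mem_realBorelOrbit hP hg hg' (left_ne_zero_of_mul h.ne')).2 h)

lemma mem_realBorelOrbit (hP : 𝒢.IsTorusFrame (H.map 𝒢.G.subtype) P) {g : 𝒢.G}
    (hg : g ∈ 𝒢.realG) (h0 : 𝒢.sg P g ≠ 0) (x : 𝒢.G ⧸ H) :
    x ∈ 𝒢.realBorelOrbit H (QuotientGroup.mk g) ↔
      ∃ g' ∈ 𝒢.realG, QuotientGroup.mk g' = x ∧ 0 < 𝒢.sg P g * 𝒢.sg P g' := by
  constructor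
  · intro h
    obtain ⟨g', hg', rfl⟩ := (𝒢.mem_realSpan hg x).1 (𝒢.realBorelOrbit_subset_realSpan hg hg h)
    exact ⟨g', hg', rfl, (𝒢.mk_mem_realBorelOrbit hP hg hg' h0).1 h⟩
  · rintro ⟨g', hg', rfl, h⟩
    exact (𝒢.mk_mem_realBorelOrbit hP hg hg' h0).2 h

/-- If `G(ℝ)` does not lie in the image of the real points of the cover, then
the centraliser of `H` contains a real element which exchanges the two signs. -/
lemma exists_real_swap (hP : 𝒢.IsTorusFrame (H.map 𝒢.G.subtype) P) {g₀ : 𝒢.G} (hg₀ : g₀ ∈ 𝒢.realG)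
    (h₀ : conjSL (𝒢.slPart g₀) = -𝒢.slPart g₀) :
    ∃ t ∈ 𝒢.realG, (∀ h ∈ H, h * t = t * h) ∧ ∀ g, 𝒢.sg P (g * t) = -𝒢.sg P g := by
  obtain ⟨c, hc, e⟩ := 𝒢.slPart_spec g₀
  set A := P * diagSL Complex.I Complex.I_ne_zero * P⁻¹ with hA
  have hcA : conjSL A = -A := by
    have : conjSL (diagSL Complex.I Complex.I_ne_zero) = -diagSL Complex.I Complex.I_ne_zero := by
      apply SL2_ext <;> simp [conjSL_apply]
    rw [hA, map_mul, map_mul, map_inv, hP.real, this]; simp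
  refine ⟨⟨𝒢.φ A * c, 𝒢.G.mul_mem (𝒢.φ_mem_G A) (𝒢.C_le_G hc)⟩, ?_, ?_, ?_⟩
  · have h1 : conjGL N (𝒢.φ (𝒢.slPart g₀) * c) = 𝒢.φ (𝒢.slPart g₀) * c := by rw [← e]; exact hg₀
    rw [map_mul, conj_φ, h₀, ← neg_one_mul, map_mul, mul_assoc] at h1
    change conjGL N (𝒢.φ A * c) = 𝒢.φ A * c
    rw [map_mul, conj_φ, hcA, ← neg_one_mul, map_mul]
    have h2 : ∀ B, 𝒢.φ (-1) * 𝒢.φ B = 𝒢.φ B * 𝒢.φ (-1) := fun B => by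
      rw [← map_mul, ← map_mul]; simp
    rw [← mul_assoc, h2, mul_assoc] at h1
    rw [h2, mul_assoc, mul_left_cancel h1]
  · intro h hh
    obtain ⟨c', hc', e'⟩ := 𝒢.slPart_spec h
    obtain ⟨l, hl, e''⟩ := hP.mem _ c' hc' (by rw [← e']; exact Subgroup.mem_map_of_mem 𝒢.G.subtype hh)
    apply Subtype.ext
    rw [Subgroup.coe_mul, Subgroup.coe_mul, e']
    change _ * (𝒢.φ A * c) = 𝒢.φ A * c * _
    rw [𝒢.φ_mul_mul hc', 𝒢.φ_mul_mul hc, 𝒢.C_comm hc hc', e'', hA, SL2_conj_diag, SL2_conj_diag]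
    congr 5; ring
  · intro g
    rcases 𝒢.frame_mul_of_eq (P := P) (h := ⟨𝒢.φ A * c, _⟩) hc rfl g with h | h <;> rw [sg, h, sg] <;>
      simp only [Matrix.SpecialLinearGroup.coe_neg, Matrix.neg_apply, SL2_mul_apply, diagSL_00,
        diagSL_01, diagSL_10, diagSL_11] <;> simp <;> ring

/-- If the `SL₂`-components of all real points are real, `sg` is half the real part of the
continuous function `Y₁₀`. Otherwise `Y₁₀` does not determine the sign; then right translation by
the element of `exists_real_swap` is a well-defined map of `G/H` which reverses signs, and it
transports the assumed openness of the base orbit. -/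
lemma isOpenInSpan_of_sg_ne_zero (hP : 𝒢.IsTorusFrame (H.map 𝒢.G.subtype) P)
    (ho : 𝒢.IsOpenInSpan H (𝒢.realBorelOrbit H (QuotientGroup.mk 1))) {g : 𝒢.G} (hg : g ∈ 𝒢.realG)
    (h0 : 𝒢.sg P g ≠ 0) : 𝒢.IsOpenInSpan H (𝒢.realBorelOrbit H (QuotientGroup.mk g)) := by
  have h1 := 𝒢.sg_ne_zero_of_isOpenInSpan hP (one_mem _) ho
  by_cases hA : ∃ g₀ ∈ 𝒢.realG, conjSL (𝒢.slPart g₀) = -𝒢.slPart g₀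
  · rcases lt_or_gt_of_ne (mul_ne_zero h1 h0) with hneg | hpos
    · obtain ⟨g₀, hg₀, h₀⟩ := hA
      obtain ⟨t, ht, hcomm, hsg⟩ := 𝒢.exists_real_swap hP hg₀ h₀
      obtain ⟨V, hV, e⟩ := ho
      have hinv : ∀ g₁ g₂ : 𝒢.G, (QuotientGroup.mk g₁ : 𝒢.G ⧸ H) = QuotientGroup.mk g₂ →
          (QuotientGroup.mk (g₁ * t) : 𝒢.G ⧸ H) = QuotientGroup.mk (g₂ * t) := by
        intro g₁ g₂ h
        have hh := QuotientGroup.eq.1 h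
        refine QuotientGroup.eq.2 ?_
        have : (g₁ * t)⁻¹ * (g₂ * t) = g₁⁻¹ * g₂ := by
          rw [mul_inv_rev, mul_assoc, ← mul_assoc g₁⁻¹, hcomm _ hh, inv_mul_cancel_left]
        rwa [this]
      refine ⟨{x | ∃ g', QuotientGroup.mk g' = x ∧ (QuotientGroup.mk (g' * t) : 𝒢.G ⧸ H) ∈ V}, ?_, ?_⟩
      · rw [← (QuotientGroup.isQuotientMap_mk H).isOpen_preimage]
        have hc : Continuous fun g' : 𝒢.G => (QuotientGroup.mk (g' * t) : 𝒢.G ⧸ H) :=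
          continuous_quot_mk.comp (continuous_mul_const t)
        convert hV.preimage hc using 1
        ext g'
        constructor
        · rintro ⟨g'', h, h'⟩
          change (QuotientGroup.mk (g' * t) : 𝒢.G ⧸ H) ∈ V
          rw [← hinv _ _ h]; exact h'
        · exact fun h => ⟨g', rfl, h⟩
      · have key : ∀ g' ∈ 𝒢.realG, (QuotientGroup.mk (g' * t) : 𝒢.G ⧸ H) ∈ V ↔
            0 < 𝒢.sg P g * 𝒢.sg P g' := by
          intro g' hg'
          have h2 := 𝒢.mk_mem_realBorelOrbit hP (one_mem _) (mul_mem hg' ht) h1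
          have h3 : (QuotientGroup.mk (g' * t) : 𝒢.G ⧸ H) ∈
              𝒢.realSpan H (𝒢.realBorelOrbit H (QuotientGroup.mk 1)) :=
            (𝒢.mem_realSpan (one_mem _) _).2 ⟨_, mul_mem hg' ht, rfl⟩
          rw [e, Set.mem_inter_iff, and_iff_left h3, hsg] at h2
          rw [h2]
          constructor <;> intro h4
          · have := mul_pos_of_neg_of_neg hneg (neg_lt_zero.2 h4)
            have h5 : 𝒢.sg P 1 * 𝒢.sg P g * -(𝒢.sg P 1 * -𝒢.sg P g') =
              (𝒢.sg P 1) ^ 2 * (𝒢.sg P g * 𝒢.sg P g') := by ring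
            rw [h5] at this
            exact (mul_pos_iff_of_pos_left (by positivity)).1 this
          · have h5 := mul_neg_of_neg_of_pos hneg h4
            have h6 : 𝒢.sg P 1 * 𝒢.sg P g * (𝒢.sg P g * 𝒢.sg P g') =
              -((𝒢.sg P g) ^ 2 * (𝒢.sg P 1 * -𝒢.sg P g')) := by ring
            rw [h6, neg_lt_zero] at h5
            exact (mul_pos_iff_of_pos_left (by positivity)).1 h5
        ext x
        rw [𝒢.mem_realBorelOrbit hP hg h0, Set.mem_inter_iff, 𝒢.mem_realSpan hg]
        constructor
        · rintro ⟨g', hg', rfl, h⟩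
          exact ⟨⟨g', rfl, (key g' hg').2 h⟩, g', hg', rfl⟩
        · rintro ⟨⟨g'', h, h'⟩, g', hg', rfl⟩
          refine ⟨g', hg', rfl, (key g' hg').1 ?_⟩
          rw [← hinv _ _ h]; exact h'
    · rw [𝒢.realBorelOrbit_eq hP (one_mem _) hg hpos]; exact ho
  · have hsg : ∀ g' ∈ 𝒢.realG, (𝒢.Yg P g' 1 0).re = 2 * 𝒢.sg P g' := by
      intro g' hg'
      have h2 : conjSL (𝒢.slPart g') = 𝒢.slPart g' :=
        (𝒢.conjSL_slPart hg').resolve_right fun h => hA ⟨g', hg', h⟩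
      have h3 : conjSL (𝒢.frame P g') = 𝒢.frame P g' := by rw [frame, map_mul, h2, hP.real]
      have h4 : starRingEnd ℂ (𝒢.frame P g' 1 1) = 𝒢.frame P g' 1 1 := by rw [← conjSL_apply, h3]
      rw [Yg_10, sg, h4, mul_assoc]; simp
    have hS : IsOpen {z : ℂ | 0 < 𝒢.sg P g * z.re} :=
      isOpen_lt continuous_const (continuous_const.mul Complex.continuous_re)
    refine ⟨_, 𝒢.isOpen_of_Yg hP hS 1 0, ?_⟩
    ext x
    rw [𝒢.mem_realBorelOrbit hP hg h0, Set.mem_inter_iff, 𝒢.mem_realSpan hg]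
    constructor
    · rintro ⟨g', hg', rfl, h⟩
      refine ⟨⟨g', rfl, ?_⟩, g', hg', rfl⟩
      change 0 < 𝒢.sg P g * (𝒢.Yg P g' 1 0).re
      rw [hsg g' hg']; linarith
    · rintro ⟨⟨g'', h, h'⟩, g', hg', rfl⟩
      refine ⟨g', hg', rfl, ?_⟩
      rw [hP.Yg_congr h] at h'
      change 0 < 𝒢.sg P g * (𝒢.Yg P g' 1 0).re at h'
      rw [hsg g' hg'] at h'; linarith

/-- The frame `lowerSL x` has second row `(x, 1)`. -/
lemma exists_sg_of_row (hP : conjSL P = P) (x : ℝ) : ∃ g ∈ 𝒢.realG, 𝒢.sg P g = x := by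
  have hR : conjSL (lowerSL x) = lowerSL x := by apply SL2_ext <;> simp [conjSL_apply]
  refine ⟨𝒢.φG (lowerSL x * P⁻¹), 𝒢.φG_mem_realG (by rw [map_mul, map_inv, hR, hP]), ?_⟩
  rw [sg, frame]
  rcases 𝒢.slPart_φG (lowerSL x * P⁻¹) with h | h <;> rw [h] <;> simp

lemma mem_stab_mk (g : 𝒢.G) (h : GL (Fin N) ℂ) : h ∈ 𝒢.stab H (QuotientGroup.mk g) ↔
    (g : GL (Fin N) ℂ)⁻¹ * h * g ∈ H.map 𝒢.G.subtype := by
  constructor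
  · rintro ⟨k, hk, rfl⟩
    refine ⟨g⁻¹ * k * g, ?_, rfl⟩
    have : (QuotientGroup.mk (k * g) : 𝒢.G ⧸ H) = QuotientGroup.mk g := hk
    have := QuotientGroup.eq.1 this.symm
    rwa [← mul_assoc] at this
  · rintro ⟨k, hk, e⟩
    refine ⟨g * k * g⁻¹, ?_, ?_⟩
    · change (QuotientGroup.mk (g * k * g⁻¹ * g) : 𝒢.G ⧸ H) = QuotientGroup.mk g
      refine QuotientGroup.eq.2 ?_
      have : (g * k * g⁻¹ * g)⁻¹ * g = k⁻¹ := by group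
      rw [this]; exact H.inv_mem hk
    · have e' : (k : GL (Fin N) ℂ) = (g : GL (Fin N) ℂ)⁻¹ * h * g := e
      simp only [map_mul, map_inv, Subgroup.coe_subtype]
      rw [e']; group

/-- A unipotent class in a torus of `PGL₂` is trivial: trace and determinant give `l (y + y⁻¹) = 2`
and `l² = 1`, whence `y = l = ±1`, and `upperSL 1` would be the identity. -/
lemma not_isTypeU (hP : 𝒢.IsTorusFrame (H.map 𝒢.G.subtype) P) (x : 𝒢.G ⧸ H) : ¬𝒢.IsTypeU H x := by
  obtain ⟨g, rfl⟩ := QuotientGroup.mk_surjective x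
  rintro ⟨δ, h1, -⟩
  obtain ⟨k, hk, A, c, hc, l, hl, e, hM⟩ := h1 (upperSL 1 : SL(2, ℂ)) (by simp) (by simp) (by simp)
  rw [𝒢.mem_stab_mk] at hk
  obtain ⟨c', hc', e'⟩ := 𝒢.slPart_spec g
  have e1 : (g : GL (Fin N) ℂ)⁻¹ * k * g = 𝒢.φ ((𝒢.slPart g)⁻¹ * A * 𝒢.slPart g) * c := by
    rw [e, e', mul_inv_rev, map_mul, map_mul, map_inv]
    have := 𝒢.C_central c' hc' ((𝒢.slPart g)⁻¹ * A * 𝒢.slPart g)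
    have h2 := 𝒢.C_central c hc (𝒢.slPart g)
    have h3 := 𝒢.C_comm hc hc'
    simp only [map_mul, map_inv] at this
    calc _ = c'⁻¹ * ((𝒢.φ (𝒢.slPart g))⁻¹ * 𝒢.φ A * (c * 𝒢.φ (𝒢.slPart g))) * c' := by group
      _ = c'⁻¹ * ((𝒢.φ (𝒢.slPart g))⁻¹ * 𝒢.φ A * 𝒢.φ (𝒢.slPart g)) * (c * c') := by rw [h2]; group
      _ = c'⁻¹ * (((𝒢.φ (𝒢.slPart g))⁻¹ * 𝒢.φ A * 𝒢.φ (𝒢.slPart g)) * c') * c := by rw [h3]; group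
      _ = _ := by rw [← this]; group
  obtain ⟨y, hy, e2⟩ := hP.mem _ c hc (e1 ▸ hk)
  have e3 : A = 𝒢.frame P g * diagSL y hy * (𝒢.frame P g)⁻¹ := by
    have := congrArg (fun u => 𝒢.slPart g * u * (𝒢.slPart g)⁻¹) e2
    simp only [mul_assoc, mul_inv_cancel, mul_one, mul_inv_cancel_left] at this
    rw [this, frame]; group
  have hM' : ((δ⁻¹ : GL (Fin 2) ℂ) : Matrix (Fin 2) (Fin 2) ℂ) * (upperSL 1 : SL(2, ℂ)) * δ =
      l • (A : Matrix (Fin 2) (Fin 2) ℂ) := hM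
  have hdet := congrArg Matrix.det hM'
  have htr := congrArg Matrix.trace hM'
  rw [Matrix.det_units_conj', Matrix.det_smul, A.2, (upperSL 1).2] at hdet
  rw [Matrix.trace_units_conj', Matrix.trace_smul, e3, Matrix.SpecialLinearGroup.coe_mul,
    Matrix.SpecialLinearGroup.coe_mul, Matrix.trace_mul_cycle, ← Matrix.SpecialLinearGroup.coe_mul,
    inv_mul_cancel, Matrix.SpecialLinearGroup.coe_one, one_mul, Matrix.trace_fin_two,
    Matrix.trace_fin_two] at htr
  simp only [upperSL_00, upperSL_11, diagSL_00, diagSL_11, smul_eq_mul, Fintype.card_fin, mul_one] at htr hdet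
  have hyl : y = l := by
    have : (y - l) ^ 2 = 0 := by
      field_simp at htr
      have h5 : y ^ 2 + 1 = 2 * l * y := by linear_combination (y ^ 2 + 1) * hdet - l * htr
      linear_combination h5 - hdet
    exact sub_eq_zero.1 (pow_eq_zero_iff two_ne_zero |>.1 this)
  have hA : l • (A : Matrix (Fin 2) (Fin 2) ℂ) = 1 := by
    subst hyl
    rw [e3]
    rcases mul_self_eq_one_iff.1 (show y * y = 1 by linear_combination -hdet) with rfl | rfl
    · have : diagSL 1 hy = 1 := by apply SL2_ext <;> simp
      rw [this]; simp
    · have : diagSL (-1) hy = -1 := by apply SL2_ext <;> simp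
      rw [this]; simp
  rw [hA] at hM'
  have hU : ((upperSL 1 : SL(2, ℂ)) : Matrix (Fin 2) (Fin 2) ℂ) = 1 := by
    have h6 : (δ : Matrix (Fin 2) (Fin 2) ℂ) * ((δ⁻¹ : GL (Fin 2) ℂ) : Matrix (Fin 2) (Fin 2) ℂ) = 1 :=
      Units.mul_inv δ
    calc ((upperSL 1 : SL(2, ℂ)) : Matrix (Fin 2) (Fin 2) ℂ)
        = (δ * (δ⁻¹ : GL (Fin 2) ℂ)) * (upperSL 1 : SL(2, ℂ)) * (δ * (δ⁻¹ : GL (Fin 2) ℂ)) := by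
          rw [h6, one_mul, mul_one]
      _ = δ * ((δ⁻¹ : GL (Fin 2) ℂ) * (upperSL 1 : SL(2, ℂ)) * δ) * (δ⁻¹ : GL (Fin 2) ℂ) := by
          simp only [mul_assoc]
      _ = 1 := by rw [hM', mul_one, h6]
  simpa using congrFun (congrFun hU 0) 1

lemma reflectionOperator_eq {O₁ O₂ : Set (𝒢.G ⧸ H)} (h : 𝒢.IsReflectionPartner H O₁ O₂)
    (hu : ∀ O₃, 𝒢.IsReflectionPartner H O₁ O₃ → O₃ = O₂) : 𝒢.reflectionOperator H O₁ = O₂ := by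
  have hex : ∃! O₂, 𝒢.IsReflectionPartner H O₁ O₂ := ⟨O₂, h, hu⟩
  rw [reflectionOperator, dif_pos hex]
  exact hu _ hex.choose_spec.1


lemma exists_open_orbit (hP : 𝒢.IsTorusFrame (H.map 𝒢.G.subtype) P)
    (ho : 𝒢.IsOpenInSpan H (𝒢.realBorelOrbit H (QuotientGroup.mk 1))) :
    ∃ g₁ ∈ 𝒢.realG, 𝒢.sg P 1 * 𝒢.sg P g₁ < 0 := by
  have h1 := 𝒢.sg_ne_zero_of_isOpenInSpan hP (one_mem _) ho
  obtain ⟨g₁, hg₁, e⟩ := 𝒢.exists_sg_of_row hP.real (-𝒢.sg P 1)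
  refine ⟨g₁, hg₁, ?_⟩
  rw [e]
  have : 0 < 𝒢.sg P 1 ^ 2 := by positivity
  linarith

lemma realBorelOrbit_ne (hP : 𝒢.IsTorusFrame (H.map 𝒢.G.subtype) P) {g g' : 𝒢.G}
    (hg : g ∈ 𝒢.realG) (hg' : g' ∈ 𝒢.realG) (h : 𝒢.sg P g * 𝒢.sg P g' < 0) :
    𝒢.realBorelOrbit H (QuotientGroup.mk g') ≠ 𝒢.realBorelOrbit H (QuotientGroup.mk g) := by
  intro e
  have : (QuotientGroup.mk g' : 𝒢.G ⧸ H) ∈ 𝒢.realBorelOrbit H (QuotientGroup.mk g) := by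
    rw [← e]; exact MulAction.mem_orbit_self _
  exact lt_asymm h ((𝒢.mk_mem_realBorelOrbit hP hg hg' (left_ne_zero_of_mul h.ne)).1 this)

lemma open_orbits (hP : 𝒢.IsTorusFrame (H.map 𝒢.G.subtype) P)
    (ho : 𝒢.IsOpenInSpan H (𝒢.realBorelOrbit H (QuotientGroup.mk 1))) {g g' : 𝒢.G}
    (hg : g ∈ 𝒢.realG) (hg' : g' ∈ 𝒢.realG) (h : 𝒢.sg P g * 𝒢.sg P g' < 0)
    (O₁ : Set (𝒢.G ⧸ H)) :
    (𝒢.IsRealBorelOrbit H O₁ ∧ O₁ ⊆ 𝒢.realSpan H (𝒢.realBorelOrbit H (QuotientGroup.mk g)) ∧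
        𝒢.IsOpenInSpan H O₁) ↔
      (O₁ = 𝒢.realBorelOrbit H (QuotientGroup.mk g) ∨
        O₁ = 𝒢.realBorelOrbit H (QuotientGroup.mk g')) := by
  constructor
  · rintro ⟨h₁, h₂, h₃⟩
    obtain ⟨g'', hg'', rfl⟩ := 𝒢.exists_eq_realBorelOrbit hg h₁ h₂
    have h0 := 𝒢.sg_ne_zero_of_isOpenInSpan hP hg'' h₃
    rcases lt_or_gt_of_ne (mul_ne_zero (left_ne_zero_of_mul h.ne) h0) with h4 | h4
    · right
      refine 𝒢.realBorelOrbit_eq hP hg' hg'' ?_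
      have h5 := mul_pos_of_neg_of_neg h h4
      have h6 : 𝒢.sg P g * 𝒢.sg P g' * (𝒢.sg P g * 𝒢.sg P g'') =
        𝒢.sg P g ^ 2 * (𝒢.sg P g' * 𝒢.sg P g'') := by ring
      rw [h6] at h5
      exact pos_of_mul_pos_right h5 (sq_nonneg _)
    · exact Or.inl (𝒢.realBorelOrbit_eq hP hg hg'' h4)
  · rintro (rfl | rfl)
    · exact ⟨𝒢.isRealBorelOrbit_mk hg, 𝒢.realBorelOrbit_subset_realSpan hg hg,
        𝒢.isOpenInSpan_of_sg_ne_zero hP ho hg (left_ne_zero_of_mul h.ne)⟩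
    · exact ⟨𝒢.isRealBorelOrbit_mk hg', 𝒢.realBorelOrbit_subset_realSpan hg hg',
        𝒢.isOpenInSpan_of_sg_ne_zero hP ho hg' (right_ne_zero_of_mul h.ne)⟩

/-- The clause for type (U) never applies, so a partner of an open orbit must be open, and only one
other open orbit exists. -/
lemma reflectionOperator_realBorelOrbit (hP : 𝒢.IsTorusFrame (H.map 𝒢.G.subtype) P)
    (ho : 𝒢.IsOpenInSpan H (𝒢.realBorelOrbit H (QuotientGroup.mk 1))) {g g' : 𝒢.G}
    (hg : g ∈ 𝒢.realG) (hg' : g' ∈ 𝒢.realG) (h : 𝒢.sg P g * 𝒢.sg P g' < 0) :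
    𝒢.reflectionOperator H (𝒢.realBorelOrbit H (QuotientGroup.mk g)) =
      𝒢.realBorelOrbit H (QuotientGroup.mk g') := by
  have key := 𝒢.open_orbits hP ho hg hg' h
  have hg0 := ((key _).2 (Or.inl rfl)).2.2
  obtain ⟨h₁, h₂, h₃⟩ := (key _).2 (Or.inr rfl)
  refine 𝒢.reflectionOperator_eq ⟨h₁, h₂, 𝒢.realBorelOrbit_ne hP hg hg' h, Or.inr ⟨fun _ => hg0, fun _ => h₃⟩⟩ ?_
  rintro O₃ ⟨k₁, k₂, k₃, k₄⟩
  have k₅ := (k₄.resolve_left fun ⟨x, _, hx⟩ => 𝒢.not_isTypeU hP x hx).2 hg0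
  exact ((key O₃).1 ⟨k₁, k₂, k₅⟩).resolve_left k₃

end SplitRankOneGroup

lemma conjGL_mem_of_isRealAlgebraic {N : ℕ} {K : Subgroup (GL (Fin N) ℂ)} (hK : IsRealAlgebraic K)
    {k : GL (Fin N) ℂ} (hk : k ∈ K) : conjGL N k ∈ K := by
  obtain ⟨S, hS⟩ := hK
  rw [hS] at hk ⊢
  intro f hf
  have h := conj_aeval f (fun ij : Fin N × Fin N => (k : Matrix (Fin N) (Fin N) ℂ) ij.1 ij.2)
  rw [hk f hf, map_zero] at h
  exact h.symm

/-! ### Covectors, `𝔥^⊥`, `𝔰^⊥` and `𝔞*` -/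

namespace SplitRankOneGroup

variable {N : ℕ} (𝒢 : SplitRankOneGroup N) {P : SL(2, ℂ)} {H : Subgroup 𝒢.G}

lemma Ad_coe_dφ_add (g : 𝒢.G) {a : Matrix (Fin 2) (Fin 2) ℂ} (ha : a.trace = 0)
    {z : Matrix (Fin N) (Fin N) ℂ} (hz : z ∈ 𝒢.lieC) :
    Ad (g : GL (Fin N) ℂ) (𝒢.dφ a + z) = 𝒢.dφ (conjBy (𝒢.slPart g) a) + z := by
  obtain ⟨c, hc, e⟩ := 𝒢.slPart_spec g
  rw [e, 𝒢.Ad_dφ_add hc ha hz]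

lemma Ad_mem_lieG {g : GL (Fin N) ℂ} (hg : g ∈ 𝒢.G) {ξ : Matrix (Fin N) (Fin N) ℂ}
    (hξ : ξ ∈ lieAlg (𝒢.G : Set (GL (Fin N) ℂ))) : Ad g ξ ∈ lieAlg (𝒢.G : Set (GL (Fin N) ℂ)) :=
  Ad_mem_lieAlg (fun _ hk => 𝒢.G.mul_mem (𝒢.G.mul_mem hg hk) (𝒢.G.inv_mem hg)) hξ

variable {𝒢} in
-- Conjugation by `φ(P)⁻¹` carries `H` into `T`, whose Lie algebra is known.
lemma IsTorusFrame.exists_of_mem_lieAlg (hP : 𝒢.IsTorusFrame (H.map 𝒢.G.subtype) P)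
    {κ : Matrix (Fin N) (Fin N) ℂ} (hκ : κ ∈ lieAlg (H.map 𝒢.G.subtype : Set (GL (Fin N) ℂ))) :
    ∃ t : ℂ, ∃ w ∈ 𝒢.lieC, κ = 𝒢.dφ (t • conjBy P slH) + w := by
  have h1 : Ad (𝒢.φ P)⁻¹ κ ∈ lieAlg (𝒢.T : Set (GL (Fin N) ℂ)) := by
    refine Ad_mem_lieAlg (fun k hk => ?_) hκ
    obtain ⟨A, c, hc, rfl⟩ := 𝒢.mem_G.1 (Subgroup.map_subtype_le H hk)
    obtain ⟨l, hl, rfl⟩ := hP.mem A c hc hk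
    refine 𝒢.mem_T.2 ⟨diagSL l hl, by simp, by simp, c, hc, ?_⟩
    rw [inv_inv, mul_assoc, mul_assoc, 𝒢.C_central c hc, map_mul, map_mul, map_inv]
    rw [← 𝒢.C_central c hc (diagSL l hl)]
    have := 𝒢.C_central c hc P
    calc _ = 𝒢.φ (diagSL l hl) * ((𝒢.φ P)⁻¹ * (𝒢.φ P * c)) := by group
      _ = _ := by rw [𝒢.C_central c hc (diagSL l hl)]; group
  obtain ⟨t, w, hw, e⟩ := 𝒢.exists_of_mem_lieT h1
  refine ⟨t, w, hw, ?_⟩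
  have h2 : κ = Ad (𝒢.φ P) (Ad (𝒢.φ P)⁻¹ κ) := (Ad_Ad_inv _ _).symm
  have h3 : (t • conjBy P slH) = conjBy P (t • slH) := by simp [conjBy]
  have h4 := 𝒢.Ad_dφ_add (A := P) 𝒢.C.one_mem (a := t • slH) (by simp) hw
  rw [mul_one] at h4
  rw [h2, e, h4, h3]

variable {β : LinearMap.BilinForm ℂ (Matrix (Fin N) (Fin N) ℂ)}

lemma isCovectorAt_mk (hβ : 𝒢.IsInvariantInnerProduct β) (g : 𝒢.G) (ξ : Matrix (Fin N) (Fin N) ℂ) :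
    𝒢.IsCovectorAt H β (QuotientGroup.mk g) ξ ↔ Ad (g : GL (Fin N) ℂ)⁻¹ ξ ∈ 𝒢.hPerp H β := by
  have hK : ∀ η, η ∈ lieAlg (H.map 𝒢.G.subtype : Set (GL (Fin N) ℂ)) →
      η ∈ lieAlg (𝒢.G : Set (GL (Fin N) ℂ)) := fun η h => lieAlg_mono (Subgroup.map_subtype_le H) h
  constructor
  · rintro ⟨h1, h2⟩
    refine ⟨𝒢.Ad_mem_lieG (𝒢.G.inv_mem g.2) h1, fun η hη => ?_⟩
    rw [← h2 (Ad (g : GL (Fin N) ℂ) η) (Ad_mem_lieAlg (fun k hk => ?_) hη),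
      ← hβ.invariant _ g.2 _ (𝒢.Ad_mem_lieG (𝒢.G.inv_mem g.2) h1) _ (hK η hη), Ad_Ad_inv]
    refine (𝒢.mem_stab_mk g _).2 ?_
    have : (g : GL (Fin N) ℂ)⁻¹ * (g * k * (g : GL (Fin N) ℂ)⁻¹) * g = k := by group
    rw [this]; exact hk
  · rintro ⟨h1, h2⟩
    have h3 : ξ ∈ lieAlg (𝒢.G : Set (GL (Fin N) ℂ)) := by
      rw [← Ad_Ad_inv (g : GL (Fin N) ℂ) ξ]; exact 𝒢.Ad_mem_lieG g.2 h1
    refine ⟨h3, fun η hη => ?_⟩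
    have h4 : Ad (g : GL (Fin N) ℂ)⁻¹ η ∈ lieAlg (H.map 𝒢.G.subtype : Set (GL (Fin N) ℂ)) := by
      refine Ad_mem_lieAlg (fun k hk => ?_) hη
      rw [inv_inv]; exact (𝒢.mem_stab_mk g k).1 hk
    rw [← h2 _ h4]
    conv_lhs => rw [← Ad_Ad_inv (g : GL (Fin N) ℂ) ξ, ← Ad_Ad_inv (g : GL (Fin N) ℂ) η]
    exact hβ.invariant _ g.2 _ h1 _ (hK _ h4)

lemma isCovectorAt_smul (hβ : 𝒢.IsInvariantInnerProduct β) (g : 𝒢.G) (x : 𝒢.G ⧸ H)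
    {ξ : Matrix (Fin N) (Fin N) ℂ} (h : 𝒢.IsCovectorAt H β x ξ) :
    𝒢.IsCovectorAt H β (g • x) (Ad (g : GL (Fin N) ℂ) ξ) := by
  obtain ⟨k, rfl⟩ := QuotientGroup.mk_surjective x
  rw [MulAction.Quotient.smul_mk, smul_eq_mul, 𝒢.isCovectorAt_mk hβ, Subgroup.coe_mul, mul_inv_rev,
    Ad_mul, Ad_inv_Ad, ← 𝒢.isCovectorAt_mk hβ]
  exact h

/-- Centre and derived algebra are orthogonal and the form on `𝔰𝔩₂` is a multiple of the trace form,
so `𝔥` sees only the diagonal entry of `b` in the frame `P`. -/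
lemma mem_hPerp (hβ : 𝒢.IsInvariantInnerProduct β) (hP : 𝒢.IsTorusFrame (H.map 𝒢.G.subtype) P)
    {b : Matrix (Fin 2) (Fin 2) ℂ} (hb : b.trace = 0) {z : Matrix (Fin N) (Fin N) ℂ} (hz : z ∈ 𝒢.lieC) :
    𝒢.dφ (conjBy P b) + z ∈ 𝒢.hPerp H β ↔
      ∀ t : ℂ, ∀ w ∈ 𝒢.lieC,
        𝒢.dφ (t • conjBy P slH) + w ∈ lieAlg (H.map 𝒢.G.subtype : Set (GL (Fin N) ℂ)) →
          β (𝒢.dφ slH) (𝒢.dφ slH) * (b 0 0 * t) + β z w = 0 := by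
  have key : ∀ t : ℂ, ∀ w ∈ 𝒢.lieC, β (𝒢.dφ (conjBy P b) + z) (𝒢.dφ (t • conjBy P slH) + w) =
      β (𝒢.dφ slH) (𝒢.dφ slH) * (b 0 0 * t) + β z w := by
    intro t w hw
    rw [map_smul, map_add, map_add, LinearMap.add_apply, LinearMap.add_apply, map_smul, map_smul,
      hβ.lieC_dφ (by simp) hz, hβ.dφ_lieC (by simpa using hb) hw, hβ.inv_dφ P hb trace_slH,
      hβ.dφ_dφ hb trace_slH]
    simp [slH]; ring
  constructor
  · rintro ⟨-, h⟩ t w hw hm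
    rw [← key t w hw]; exact h _ hm
  · intro h
    refine ⟨𝒢.dφ_add_mem_lieG (by simpa using hb) hz, fun η hη => ?_⟩
    obtain ⟨t, w, hw, rfl⟩ := hP.exists_of_mem_lieAlg hη
    rw [key t w hw]; exact h t w hw hη

/-- Transported to the base point, `a slH` has diagonal frame entry `a Y₀₀`, and `mem_hPerp` depends
on no other entry. -/
lemma isCovectorAt_cartan (hβ : 𝒢.IsInvariantInnerProduct β)
    (hP : 𝒢.IsTorusFrame (H.map 𝒢.G.subtype) P) (g : 𝒢.G) (a : ℂ)
    {z : Matrix (Fin N) (Fin N) ℂ} (hz : z ∈ 𝒢.lieC) :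
    𝒢.IsCovectorAt H β (QuotientGroup.mk g) (𝒢.dφ (a • slH) + z) ↔
      𝒢.dφ (conjBy P ((a * 𝒢.Yg P g 0 0) • slH)) + z ∈ 𝒢.hPerp H β := by
  rw [𝒢.isCovectorAt_mk hβ]
  have h1 : Ad (g : GL (Fin N) ℂ)⁻¹ (𝒢.dφ (a • slH) + z) =
      𝒢.dφ (conjBy P (conjBy (𝒢.frame P g)⁻¹ (a • slH))) + z := by
    rw [← conjBy_mul]
    have : P * (𝒢.frame P g)⁻¹ = (𝒢.slPart g)⁻¹ := by rw [frame]; group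
    rw [this]
    have h2 : 𝒢.dφ (a • slH) + z =
        Ad (g : GL (Fin N) ℂ) (𝒢.dφ (conjBy (𝒢.slPart g)⁻¹ (a • slH)) + z) := by
      rw [𝒢.Ad_coe_dφ_add g (by simp) hz, ← conjBy_mul, mul_inv_cancel]; simp [conjBy]
    rw [h2, Ad_inv_Ad]
  rw [h1, 𝒢.mem_hPerp hβ hP (by simp) hz, 𝒢.mem_hPerp hβ hP (by simp) hz]
  have h3 : conjBy (𝒢.frame P g)⁻¹ (a • slH) 0 0 = ((a * 𝒢.Yg P g 0 0) • slH) 0 0 := by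
    rw [conjBy_apply, inv_inv, Yg_00, SL2_inv_00, SL2_inv_01]; simp [slH]; ring
  rw [h3]

/-- `𝔥` contains `P slH P⁻¹` up to a central term, so elements of `𝔰` are orthogonal to `P slH P⁻¹`;
they are orthogonal to the centre anyway. -/
lemma dφ_conjBy_slH_mem_sPerp (hβ : 𝒢.IsInvariantInnerProduct β) (hP : 𝒢.IsTorusFrame (H.map 𝒢.G.subtype) P)
    (hH : IsRealAlgebraic (H.map 𝒢.G.subtype)) {a : ℂ} {z : Matrix (Fin N) (Fin N) ℂ} (hz : z ∈ 𝒢.lieC)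
    (h : 𝒢.dφ (conjBy P (a • slH)) + z ∈ 𝒢.hPerp H β) :
    𝒢.dφ (conjBy P (a • slH)) + z ∈ 𝒢.sPerp H β := by
  refine ⟨h, ?_⟩
  rintro η ⟨⟨hη, hη'⟩, hr⟩
  obtain ⟨b, hb, rfl⟩ := 𝒢.exists_of_mem_lieRange hr
  obtain ⟨w, hw, hw'⟩ := hP.exists_mem_lieAlg hH
  have h1 := hη' _ hw'
  rw [map_add, hβ.dφ_lieC hb hw, add_zero] at h1
  have h2 : conjBy P (a • slH) = a • conjBy P slH := by simp [conjBy]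
  rw [map_add, LinearMap.add_apply, hβ.lieC_dφ hb hz, add_zero,
    hβ.symm _ (𝒢.dφ_mem_lieG (by simp)) _ (𝒢.dφ_mem_lieG hb), h2, map_smul, map_smul, h1, smul_zero]

/-- The frame vectors `P slE P⁻¹` and `P slF P⁻¹` lie in `𝔰`, and pairing with them kills the
off-diagonal entries. -/
lemma exists_of_mem_sPerp (hβ : 𝒢.IsInvariantInnerProduct β) (hP : 𝒢.IsTorusFrame (H.map 𝒢.G.subtype) P)
    {ξ : Matrix (Fin N) (Fin N) ℂ} (h : ξ ∈ 𝒢.sPerp H β) :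
    ∃ a : ℂ, ∃ z ∈ 𝒢.lieC, ξ = 𝒢.dφ (conjBy P (a • slH)) + z := by
  obtain ⟨⟨h1, h2⟩, h3⟩ := h
  obtain ⟨b, hb, z, hz, rfl⟩ := 𝒢.exists_of_mem_lieG h1
  obtain ⟨b, rfl⟩ : ∃ b', b = conjBy P b' := ⟨conjBy P⁻¹ b, by rw [← conjBy_mul]; simp [conjBy]⟩
  rw [trace_conjBy] at hb
  have key : ∀ e : Matrix (Fin 2) (Fin 2) ℂ, e.trace = 0 → e 0 0 = 0 →
      (b 0 1 * e 1 0 + b 1 0 * e 0 1) = 0 := by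
    intro e he h0
    have hs : 𝒢.dφ (conjBy P e) ∈ 𝒢.sSpace H β := by
      refine ⟨?_, 𝒢.dφ_mem_lieAlg_range (by simpa using he)⟩
      have := (𝒢.mem_hPerp (β := β) hβ hP he 𝒢.lieC.zero_mem).2 (by
        intro t w _ _; rw [h0]; simp)
      rwa [add_zero] at this
    have h4 := h3 _ hs
    rw [map_add, LinearMap.add_apply, hβ.lieC_dφ (by simpa using he) hz, hβ.inv_dφ P hb he, hβ.dφ_dφ hb he, h0] at h4
    have h5 := hβ.slH_slH_ne_zero
    simpa [h5] using h4
  have k1 := key slE (by simp) (by simp [slE])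
  have k2 := key slF (by simp) (by simp [slF])
  simp [slE, slF] at k1 k2
  refine ⟨b 0 0, z, hz, ?_⟩
  conv_lhs => rw [eq_slE_slH_slF hb, k1, k2]
  simp

lemma sα_cartan (a : ℂ) {z : Matrix (Fin N) (Fin N) ℂ} (hz : z ∈ 𝒢.lieC) :
    𝒢.sα (𝒢.dφ (a • slH) + z) = 𝒢.dφ ((-a) • slH) + z := by
  have h1 := 𝒢.Ad_dφ_add (A := weylSL) 𝒢.C.one_mem (a := a • slH) (by simp) hz
  rw [mul_one] at h1
  have h2 : conjBy weylSL (a • slH) = (-a) • slH := by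
    have : conjBy weylSL (a • slH) = a • conjBy weylSL slH := by simp [conjBy]
    rw [this, conjBy_weyl_slH]; simp
  rw [h2] at h1
  exact h1

lemma sα_sα {ζ : Matrix (Fin N) (Fin N) ℂ} (hζ : ζ ∈ lieAlg (𝒢.T : Set (GL (Fin N) ℂ))) :
    𝒢.sα (𝒢.sα ζ) = ζ := by
  obtain ⟨a, z, hz, rfl⟩ := 𝒢.exists_of_mem_lieT hζ
  rw [𝒢.sα_cartan _ hz, 𝒢.sα_cartan _ hz, neg_neg]

/-- At the base point `t` agrees with some `u` of `U`, so `u⁻¹ t` lies in `H`, over a torus element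
that is upper triangular. Its lower left entry is a multiple of `P₁₀ P₁₁ (l - l⁻¹)`, so `l = ±1`;
then `u = 1` because `t` is diagonal. -/
lemma mem_T0 (hP : 𝒢.IsTorusFrame (H.map 𝒢.G.subtype) P) (h1 : 𝒢.Yg P 1 1 0 ≠ 0)
    {t : GL (Fin N) ℂ} (ht : t ∈ 𝒢.T0 H) :
    t ∈ H.map 𝒢.G.subtype ∧ ∃ c ∈ 𝒢.C, t = 𝒢.φ 1 * c ∨ t = 𝒢.φ (-1) * c := by
  obtain ⟨hT, hG, h⟩ := ht
  obtain ⟨⟨u, hu⟩, e⟩ := h _ ((𝒢.mk_mem_Omax hP 1).2 h1)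
  have hh : u⁻¹ * ⟨t, hG⟩ ∈ H := by
    have := QuotientGroup.eq.1 e
    have h2 : (u * 1)⁻¹ * ((⟨t, hG⟩ : 𝒢.G) * 1) ∈ H := this
    rwa [mul_one, mul_one] at h2
  obtain ⟨A, hA, hA', c, hc, et⟩ := 𝒢.mem_T.1 hT
  obtain ⟨B, hB, hB', hB'', eu⟩ := 𝒢.mem_U.1 (Subgroup.mem_subgroupOf.1 hu)
  have e1 : ((u⁻¹ * ⟨t, hG⟩ : 𝒢.G) : GL (Fin N) ℂ) = 𝒢.φ (B⁻¹ * A) * c := by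
    rw [Subgroup.coe_mul, Subgroup.coe_inv, eu, map_mul, map_inv, mul_assoc, ← et]
  obtain ⟨l, hl, e2⟩ := hP.mem _ c hc (by rw [← e1]; exact Subgroup.mem_map_of_mem 𝒢.G.subtype hh)
  have hPP : P 1 0 ≠ 0 ∧ P 1 1 ≠ 0 := by
    rw [Yg_10_ne_zero] at h1
    rcases 𝒢.slPart_one with h3 | h3 <;> simpa [frame, h3] using h1
  have e3 : (B⁻¹ * A) 1 0 = 0 := by
    rw [SL2_mul_apply, SL2_inv_10, SL2_inv_11, hA, hB]; ring
  have hll : l = l⁻¹ := by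
    rw [e2] at e3
    simp only [SL2_mul_apply, SL2_inv_00, SL2_inv_10, diagSL_00, diagSL_01, diagSL_10, diagSL_11] at e3
    have : P 1 0 * P 1 1 * (l - l⁻¹) = 0 := by linear_combination e3
    rcases mul_eq_zero.1 this with h4 | h4
    · exact absurd h4 (mul_ne_zero hPP.1 hPP.2)
    · exact sub_eq_zero.1 h4
  have hl2 : l * l = 1 := by
    nth_rewrite 2 [hll]; exact mul_inv_cancel₀ hl
  have e4 : B⁻¹ * A = 1 ∨ B⁻¹ * A = -1 := by
    rw [e2]
    rcases mul_self_eq_one_iff.1 hl2 with rfl | rfl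
    · left
      have : diagSL 1 hl = 1 := by apply SL2_ext <;> simp
      rw [this]; simp
    · right
      have : diagSL (-1) hl = -1 := by apply SL2_ext <;> simp
      rw [this]; simp
  have hB01 : B 0 1 = 0 := by
    have h5 : A = B * (B⁻¹ * A) := by group
    rcases e4 with e4 | e4 <;> rw [e4] at h5 <;> rw [h5] at hA' <;> simpa using hA'
  have hB1 : B = 1 := by apply SL2_ext <;> simp [*]
  rw [hB1, map_one] at eu
  have hu1 : u = 1 := Subtype.ext eu
  rw [hu1, inv_one, one_mul] at hh
  rw [hB1, inv_one, one_mul] at e4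
  exact ⟨⟨_, hh, rfl⟩, c, hc, by rcases e4 with rfl | rfl <;> [left; right] <;> exact et⟩

lemma lieAlg_T0 (hP : 𝒢.IsTorusFrame (H.map 𝒢.G.subtype) P) (h1 : 𝒢.Yg P 1 1 0 ≠ 0)
    {τ : Matrix (Fin N) (Fin N) ℂ} (hτ : τ ∈ lieAlg (𝒢.T0 H)) :
    τ ∈ lieAlg (H.map 𝒢.G.subtype : Set (GL (Fin N) ℂ)) ∧ τ ∈ 𝒢.lieC := by
  refine ⟨lieAlg_mono (fun t ht => (𝒢.mem_T0 hP h1 ht).1) hτ, fun s => ?_⟩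
  obtain ⟨t, ht, e⟩ := hτ (s / 2)
  obtain ⟨-, c, hc, h⟩ := 𝒢.mem_T0 hP h1 ht
  refine ⟨c * c, 𝒢.C.mul_mem hc hc, ?_⟩
  have : t * t = c * c := by
    rcases h with rfl | rfl <;> rw [𝒢.φ_mul_mul hc] <;> simp
  rw [exp_half_sq, ← e, ← Units.val_mul, this]

lemma dφ_slH_add_mem_aStar (hβ : 𝒢.IsInvariantInnerProduct β)
    (hP : 𝒢.IsTorusFrame (H.map 𝒢.G.subtype) P) (h1 : 𝒢.Yg P 1 1 0 ≠ 0) (a : ℂ)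
    {z : Matrix (Fin N) (Fin N) ℂ} (hz : z ∈ 𝒢.lieC) :
    𝒢.dφ (a • slH) + z ∈ 𝒢.aStar H β ↔ ∀ τ ∈ lieAlg (𝒢.T0 H), β z τ = 0 := by
  have key : ∀ τ ∈ lieAlg (𝒢.T0 H), β (𝒢.dφ (a • slH) + z) τ = β z τ := fun τ hτ => by
    rw [map_add, LinearMap.add_apply, hβ.dφ_lieC (by simp) (𝒢.lieAlg_T0 hP h1 hτ).2, zero_add]
  constructor
  · rintro ⟨-, h⟩ τ hτ
    rw [← key τ hτ]; exact h τ hτ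
  · exact fun h => ⟨𝒢.mem_lieT hz, fun τ hτ => by rw [key τ hτ]; exact h τ hτ⟩

/-- Membership in `𝔞*` depends on the central component only, and `s_α` fixes it. Hence the
condition involving `s_α 𝔞*` in `aPr` is empty here. -/
lemma sα_image_aStar (hβ : 𝒢.IsInvariantInnerProduct β)
    (hP : 𝒢.IsTorusFrame (H.map 𝒢.G.subtype) P) (h1 : 𝒢.Yg P 1 1 0 ≠ 0) :
    𝒢.sα '' 𝒢.aStar H β = 𝒢.aStar H β := by
  have key : ∀ ζ ∈ 𝒢.aStar H β, 𝒢.sα ζ ∈ 𝒢.aStar H β := by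
    intro ζ hζ
    obtain ⟨a, z, hz, rfl⟩ := 𝒢.exists_of_mem_lieT hζ.1
    rw [𝒢.sα_cartan _ hz]
    exact (𝒢.dφ_slH_add_mem_aStar hβ hP h1 _ hz).2 ((𝒢.dφ_slH_add_mem_aStar hβ hP h1 _ hz).1 hζ)
  apply Set.Subset.antisymm
  · rintro - ⟨ζ, hζ, rfl⟩; exact key ζ hζ
  · exact fun ζ hζ => ⟨_, key ζ hζ, 𝒢.sα_sα hζ.1⟩

lemma sα_ne_iff (a : ℂ) {z : Matrix (Fin N) (Fin N) ℂ} (hz : z ∈ 𝒢.lieC) :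
    𝒢.sα (𝒢.dφ (a • slH) + z) ≠ 𝒢.dφ (a • slH) + z ↔ a ≠ 0 := by
  rw [𝒢.sα_cartan a hz, not_iff_not]
  constructor
  · intro h
    have := congrFun (congrFun (𝒢.dφ_add_inj (by simp) (by simp) hz hz h).1 0) 0
    simp [slH] at this
    exact neg_eq_self.1 this
  · rintro rfl; simp

/-- `dφ slH` lies in `𝔞*` and is moved by `s_α`, so the coroot condition in `aPr` is a genuine one.
-/
lemma ne_zero_of_mem_aPr (hβ : 𝒢.IsInvariantInnerProduct β)
    (hP : 𝒢.IsTorusFrame (H.map 𝒢.G.subtype) P) (h1 : 𝒢.Yg P 1 1 0 ≠ 0) {a : ℂ}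
    {z : Matrix (Fin N) (Fin N) ℂ} (hz : z ∈ 𝒢.lieC) (h : 𝒢.dφ (a • slH) + z ∈ 𝒢.aPr H β) : a ≠ 0 := by
  refine (𝒢.sα_ne_iff a hz).1 (h.2.1 ⟨𝒢.dφ ((1 : ℂ) • slH) + 0, ?_, ?_⟩)
  · exact (𝒢.dφ_slH_add_mem_aStar hβ hP h1 _ 𝒢.lieC.zero_mem).2 (by simp)
  · exact (𝒢.sα_ne_iff 1 𝒢.lieC.zero_mem).2 one_ne_zero

end SplitRankOneGroup

lemma conjM_slE : conjM slE = slE := by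
  ext i j; fin_cases i <;> fin_cases j <;> simp [slE]

/-! ### The simple reflection on cells when `𝔰^⊥ ⊆ 𝔱_⊥` -/

namespace SplitRankOneGroup

variable {N : ℕ} (𝒢 : SplitRankOneGroup N) {P : SL(2, ℂ)} {H : Subgroup 𝒢.G}
  {β : LinearMap.BilinForm ℂ (Matrix (Fin N) (Fin N) ℂ)}

lemma weyl_mem_realG : 𝒢.φG weylSL ∈ 𝒢.realG :=
  𝒢.φG_mem_realG (by apply SL2_ext <;> simp [conjSL_apply])

lemma upper_mem_realG (s : ℝ) : 𝒢.φG (upperSL s) ∈ 𝒢.realG :=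
  𝒢.φG_mem_realG (by apply SL2_ext <;> simp [conjSL_apply])

lemma upper_mem_realPts_B (s : ℝ) : 𝒢.φG (upperSL s) ∈ 𝒢.realPts 𝒢.B := by
  refine 𝒢.mem_realPts.2 ⟨(𝒢.mem_B_iff _).2 ?_, 𝒢.upper_mem_realG s⟩
  rcases 𝒢.slPart_φG (upperSL s) with h | h <;> simp [h]

lemma smul_mem_realBorelOrbit {b : 𝒢.G} (hb : b ∈ 𝒢.realPts 𝒢.B) {x y : 𝒢.G ⧸ H} :
    b • x ∈ 𝒢.realBorelOrbit H y ↔ x ∈ 𝒢.realBorelOrbit H y := by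
  rw [realBorelOrbit, ← MulAction.orbit_eq_iff, ← MulAction.orbit_eq_iff]
  change MulAction.orbit (𝒢.realPts 𝒢.B) ((⟨b, hb⟩ : 𝒢.realPts 𝒢.B) • x) = _ ↔ _
  rw [MulAction.orbit_smul]

/-- The effect of the simple reflection on the sign invariant. -/
lemma sg_weyl (hP : conjSL P = P) {g : 𝒢.G} (hg : g ∈ 𝒢.realG) :
    ((4 * (𝒢.sg P g * 𝒢.sg P (𝒢.φG weylSL * g)) : ℝ) : ℂ) = 𝒢.Yg P g 0 0 ^ 2 - 1 := by
  obtain ⟨ε, hε, r, hr⟩ := 𝒢.exists_real_frame hP hg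
  have h1 : 𝒢.frame P (𝒢.φG weylSL * g) = weylSL * 𝒢.frame P g ∨
      𝒢.frame P (𝒢.φG weylSL * g) = -(weylSL * 𝒢.frame P g) := by
    rcases 𝒢.frame_mul P (𝒢.φG weylSL) g with h | h <;>
      rcases 𝒢.slPart_φG weylSL with h' | h' <;> rw [h, h'] <;> simp
  have h2 : 𝒢.sg P (𝒢.φG weylSL * g) = r 0 0 * r 0 1 := by
    rcases h1 with h | h
    · rw [𝒢.sg_eq hε (r := fun i j => if i = 0 then -r 1 j else r 0 j)]
      · simp
      · intro i j
        rw [h, SL2_mul_apply, hr, hr]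
        fin_cases i <;> simp
    · rw [𝒢.sg_eq hε (r := fun i j => if i = 0 then r 1 j else -r 0 j)]
      · simp
      · intro i j
        rw [h, Matrix.SpecialLinearGroup.coe_neg, Matrix.neg_apply, SL2_mul_apply, hr, hr]
        fin_cases i <;> simp
  have h3 := SL2_det (𝒢.frame P g)
  rw [𝒢.sg_eq hε hr, h2, Yg_00]
  rw [hr, hr, hr, hr] at h3 ⊢
  have h4 : ε ^ 4 = 1 := by rcases hε with rfl | rfl <;> simp
  push_cast
  linear_combination (-4 * (r 1 0 : ℂ) * r 1 1 * r 0 0 * r 0 1) * h4 -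
    (ε ^ 2 * (r 0 0 * r 1 1 - r 0 1 * r 1 0) + 1) * h3

/-- A real element of `ζ + 𝔲` is conjugate to `ζ` by a real unipotent element. -/
lemma exists_unipotent {ξ : Matrix (Fin N) (Fin N) ℂ} {a : ℂ} (ha : a ≠ 0)
    {z : Matrix (Fin N) (Fin N) ℂ} (hz : z ∈ 𝒢.lieC) (hξ : IsRealMatrix ξ)
    (hζ : IsRealMatrix (𝒢.dφ (a • slH) + z))
    (h : ξ - (𝒢.dφ (a • slH) + z) ∈ lieAlg (𝒢.U : Set (GL (Fin N) ℂ))) :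
    ∃ s : ℝ, ξ = Ad (𝒢.φG (upperSL s) : GL (Fin N) ℂ) (𝒢.dφ (a • slH) + z) := by
  obtain ⟨c, hc⟩ := 𝒢.exists_of_mem_lieU h
  rw [isRealMatrix_iff] at hξ hζ
  have hcr : starRingEnd ℂ c = c := by
    have h1 : conjM (𝒢.dφ (c • slE)) = 𝒢.dφ (c • slE) := by rw [← hc, map_sub, hξ, hζ]
    rw [conjM_dφ, conjM_smul, conjM_slE] at h1
    simpa [slE] using congrFun (congrFun (𝒢.dφ_inj (by simp) (by simp) h1) 0) 1
  have har : starRingEnd ℂ a = a := by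
    rw [map_add, conjM_dφ, conjM_smul, conjM_slH] at hζ
    have h1 := (𝒢.dφ_add_inj (by simp) (by simp) (𝒢.conjM_mem_lieC hz) hz hζ).1
    simpa [slH] using congrFun (congrFun h1 0) 0
  have hs : starRingEnd ℂ (-c / (2 * a)) = -c / (2 * a) := by
    rw [map_div₀, map_neg, map_mul, hcr, har, map_ofNat]
  -- Conjugation of `a slH` by `upperSL s` adds `-2 a s · slE`, which has to be `c · slE`; `c` and
  -- `a` are real, so `s` is.
  refine ⟨(-c / (2 * a)).re, ?_⟩
  rw [Complex.conj_eq_iff_re.1 hs]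
  have h1 := 𝒢.Ad_dφ_add (A := upperSL (-c / (2 * a))) 𝒢.C.one_mem (a := a • slH) (by simp) hz
  rw [mul_one] at h1
  have h2 : conjBy (upperSL (-c / (2 * a))) (a • slH) = a • slH + c • slE := by
    have : conjBy (upperSL (-c / (2 * a))) (a • slH) = a • conjBy (upperSL (-c / (2 * a))) slH := by
      simp [conjBy]
    rw [this, conjBy_upper_slH, smul_sub, smul_smul, sub_eq_add_neg, ← neg_smul]
    congr 2; field_simp
  change ξ = Ad (𝒢.φ (upperSL (-c / (2 * a)))) _
  rw [h1, h2, map_add, ← hc]; abel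

lemma isRealMatrix_Ad {g : 𝒢.G} (hg : g ∈ 𝒢.realG) {ξ : Matrix (Fin N) (Fin N) ℂ} (hξ : IsRealMatrix ξ) :
    IsRealMatrix (Ad (g : GL (Fin N) ℂ) ξ) := by
  rw [isRealMatrix_iff] at hξ ⊢
  have : conjGL N g = g := hg
  rw [conjM_Ad, this, hξ]

lemma sα_mem_lieT {ζ : Matrix (Fin N) (Fin N) ℂ} (hζ : ζ ∈ lieAlg (𝒢.T : Set (GL (Fin N) ℂ))) :
    𝒢.sα ζ ∈ lieAlg (𝒢.T : Set (GL (Fin N) ℂ)) := by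
  obtain ⟨a, z, hz, rfl⟩ := 𝒢.exists_of_mem_lieT hζ
  rw [𝒢.sα_cartan _ hz]; exact 𝒢.mem_lieT hz

lemma mem_tildeUPr_self {O : Set (𝒢.G ⧸ H)} {x : 𝒢.G ⧸ H} {ζ : Matrix (Fin N) (Fin N) ℂ}
    (hx : x ∈ 𝒢.realLocus H) (hcov : 𝒢.IsCovectorAt H β x ζ) (hζ : IsRealMatrix ζ)
    (hζT : ζ ∈ lieAlg (𝒢.T : Set (GL (Fin N) ℂ)))
    (hpr : ζ ∈ 𝒢.aPr H β ∨ ζ ∈ 𝒢.sα '' 𝒢.aPr H β) (hxO : x ∈ O) :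
    (x, ζ, ζ) ∈ 𝒢.tildeUPr H β O := by
  refine ⟨⟨hx, hcov, hζ, hζT, hζ, fun _ _ => rfl, hpr⟩, hxO, ?_⟩
  change ζ - ζ ∈ _
  rw [sub_self]; exact zero_mem_lieAlg _

/-- After a real unipotent translation the covector is `ζ` itself, over a point `kH`. Under the
inclusion assumed, `y = 0` there, so `n_α k` has the opposite sign and supplies a point of the other
cell. -/
lemma sαTilde_mem_cell (hβ : 𝒢.IsInvariantInnerProduct β) (hP : 𝒢.IsTorusFrame (H.map 𝒢.G.subtype) P)
    (hH : IsRealAlgebraic (H.map 𝒢.G.subtype)) (h1 : 𝒢.Yg P 1 1 0 ≠ 0)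
    (hs : 𝒢.sPerp H β ⊆ 𝒢.tPerp H β) {g₁ g₂ : 𝒢.G} (hg₁ : g₁ ∈ 𝒢.realG) (hg₂ : g₂ ∈ 𝒢.realG)
    (h : 𝒢.sg P g₁ * 𝒢.sg P g₂ < 0)
    {p} (hp : p ∈ 𝒢.cell H β (𝒢.realBorelOrbit H (QuotientGroup.mk g₁))) :
    𝒢.sαTilde H p ∈ 𝒢.cell H β (𝒢.realBorelOrbit H (QuotientGroup.mk g₂)) := by
  obtain ⟨g, hg, ⟨x, ξ, ζ⟩, ⟨⟨-, hcov, hξ, hζT, hζ, -, hpr⟩, hx, hu⟩, rfl⟩ := hp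
  dsimp only at hcov hξ hζT hζ hpr hx hu
  obtain ⟨a, z, hz, rfl⟩ := 𝒢.exists_of_mem_lieT hζT
  have ha : a ≠ 0 := by
    rcases hpr with hpr | ⟨ζ', hpr, e⟩
    · exact 𝒢.ne_zero_of_mem_aPr hβ hP h1 hz hpr
    · have e' : ζ' = 𝒢.dφ ((-a) • slH) + z := by
        rw [← 𝒢.sα_sα hpr.1.1, e, 𝒢.sα_cartan _ hz]
      rw [e'] at hpr
      exact neg_ne_zero.1 (𝒢.ne_zero_of_mem_aPr hβ hP h1 hz hpr)
  obtain ⟨s, hs'⟩ := 𝒢.exists_unipotent ha hz hξ hζ hu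
  set ζ := 𝒢.dφ (a • slH) + z with hζdef
  set u := 𝒢.φG (upperSL s) with hudef
  set n := 𝒢.φG weylSL with hn
  have huB := 𝒢.upper_mem_realPts_B s
  have huR := 𝒢.upper_mem_realG s
  -- the point below which the covector lies in the Cartan subspace
  have hx' : u⁻¹ • x ∈ 𝒢.realBorelOrbit H (QuotientGroup.mk g₁) :=
    (𝒢.smul_mem_realBorelOrbit (inv_mem huB)).2 hx
  obtain ⟨k, hk, e, hkpos⟩ := (𝒢.mem_realBorelOrbit hP hg₁ (left_ne_zero_of_mul h.ne) _).1 hx'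
  have hcov' : 𝒢.IsCovectorAt H β (QuotientGroup.mk k) ζ := by
    have := 𝒢.isCovectorAt_smul hβ u⁻¹ x hcov
    rwa [← e, hs', Subgroup.coe_inv, Ad_inv_Ad] at this
  -- At the base point `ζ` becomes an element of `𝔰^⊥` with derived part `a y · P slH P⁻¹`. By the
  -- inclusion it is central, so that part vanishes.
  have hy : 𝒢.Yg P k 0 0 = 0 := by
    have h2 := hs (𝒢.dφ_conjBy_slH_mem_sPerp hβ hP hH hz ((𝒢.isCovectorAt_cartan hβ hP k a hz).1 hcov'))
    have h3 : 𝒢.dφ (conjBy P ((a * 𝒢.Yg P k 0 0) • slH)) ∈ 𝒢.lieC := by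
      have := 𝒢.lieC.sub_mem (𝒢.mem_lieC.2 h2.1) hz
      rwa [add_sub_cancel_right] at this
    have h4 := 𝒢.dφ_mem_lieC (by simp) h3
    have h5 : (a * 𝒢.Yg P k 0 0) • slH = 0 := by
      have := congrArg (conjBy P⁻¹) h4
      rw [← conjBy_mul, inv_mul_cancel] at this
      simpa [conjBy] using this
    have h6 := congrFun (congrFun h5 0) 0
    simpa [slH, ha] using h6
  have hsw := 𝒢.sg_weyl hP.real hk
  rw [hy] at hsw
  have hsw' : 4 * (𝒢.sg P k * 𝒢.sg P (n * k)) = -1 := by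
    have : ((4 * (𝒢.sg P k * 𝒢.sg P (n * k)) : ℝ) : ℂ) = ((-1 : ℝ) : ℂ) := by rw [hsw]; norm_num
    exact_mod_cast this
  have hnk : n * k ∈ 𝒢.realG := mul_mem 𝒢.weyl_mem_realG hk
  have hnO : (QuotientGroup.mk (n * k) : 𝒢.G ⧸ H) ∈ 𝒢.realBorelOrbit H (QuotientGroup.mk g₂) := by
    rw [𝒢.mk_mem_realBorelOrbit hP hg₂ hnk (right_ne_zero_of_mul h.ne)]
    have h2 : 𝒢.sg P k * 𝒢.sg P (n * k) < 0 := by linarith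
    have h3 := mul_pos_of_neg_of_neg (mul_neg_of_pos_of_neg hkpos h2) h
    have h4 : 𝒢.sg P g₁ * 𝒢.sg P k * (𝒢.sg P k * 𝒢.sg P (n * k)) * (𝒢.sg P g₁ * 𝒢.sg P g₂) =
      (𝒢.sg P g₁ * 𝒢.sg P k) ^ 2 * (𝒢.sg P g₂ * 𝒢.sg P (n * k)) := by ring
    rw [h4] at h3
    exact pos_of_mul_pos_right h3 (sq_nonneg _)
  have hsα : 𝒢.sα ζ = Ad (n : GL (Fin N) ℂ) ζ := rfl
  have hcov'' : 𝒢.IsCovectorAt H β (QuotientGroup.mk (n * k)) (Ad (n : GL (Fin N) ℂ) ζ) :=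
    𝒢.isCovectorAt_smul hβ n (QuotientGroup.mk k) hcov'
  rw [← hsα] at hcov''
  have hsr : IsRealMatrix (𝒢.sα ζ) := by
    rw [hsα]; exact 𝒢.isRealMatrix_Ad 𝒢.weyl_mem_realG hζ
  have hnew : (QuotientGroup.mk (n * k), 𝒢.sα ζ, 𝒢.sα ζ) ∈
      𝒢.tildeUPr H β (𝒢.realBorelOrbit H (QuotientGroup.mk g₂)) := by
    refine 𝒢.mem_tildeUPr_self (𝒢.mk_mem_realLocus hnk) hcov''
      hsr (𝒢.sα_mem_lieT hζT) ?_ hnO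
    rcases hpr with hpr | ⟨ζ', hpr, e⟩
    · exact Or.inr ⟨_, hpr, rfl⟩
    · refine Or.inl ?_
      rw [← e, 𝒢.sα_sα hpr.1.1]; exact hpr
  have hg' : g ∈ 𝒢.realG := hg.2
  have hr : g * (u * n⁻¹) ∈ 𝒢.realG := mul_mem hg' (mul_mem huR (inv_mem 𝒢.weyl_mem_realG))
  -- Undoing `n`, then applying `u` and `g`, returns to the original point and covector; the third
  -- component stays `s_α ζ`.
  refine ⟨g * (u * n⁻¹), ⟨(g * (u * n⁻¹)).2, hr⟩, _, hnew, ?_⟩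
  have e1 : g • x = (g * (u * n⁻¹)) • (QuotientGroup.mk (n * k) : 𝒢.G ⧸ H) := by
    have : (QuotientGroup.mk (n * k) : 𝒢.G ⧸ H) = n • (QuotientGroup.mk k : 𝒢.G ⧸ H) := rfl
    rw [this, e, smul_smul, smul_smul]
    congr 1; group
  have e2 : Ad (g : GL (Fin N) ℂ) ξ = Ad ((g * (u * n⁻¹) : 𝒢.G) : GL (Fin N) ℂ) (𝒢.sα ζ) := by
    rw [Subgroup.coe_mul, Subgroup.coe_mul, Subgroup.coe_inv, Ad_mul, Ad_mul, hsα, Ad_inv_Ad, ← hs']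
  exact Prod.ext e1 (Prod.ext e2 rfl)

lemma sαTilde_sαTilde {O : Set (𝒢.G ⧸ H)} {p} (hp : p ∈ 𝒢.cell H β O) :
    𝒢.sαTilde H (𝒢.sαTilde H p) = p := by
  obtain ⟨g, -, ⟨x, ξ, ζ⟩, ⟨⟨-, -, -, hζ, -⟩, -⟩, rfl⟩ := hp
  exact Prod.ext rfl (Prod.ext rfl (𝒢.sα_sα hζ))

lemma sαTilde_image_cell (hβ : 𝒢.IsInvariantInnerProduct β) (hP : 𝒢.IsTorusFrame (H.map 𝒢.G.subtype) P)
    (hH : IsRealAlgebraic (H.map 𝒢.G.subtype)) (h1 : 𝒢.Yg P 1 1 0 ≠ 0)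
    (hs : 𝒢.sPerp H β ⊆ 𝒢.tPerp H β) {g₁ g₂ : 𝒢.G} (hg₁ : g₁ ∈ 𝒢.realG) (hg₂ : g₂ ∈ 𝒢.realG)
    (h : 𝒢.sg P g₁ * 𝒢.sg P g₂ < 0) :
    𝒢.sαTilde H '' 𝒢.cell H β (𝒢.realBorelOrbit H (QuotientGroup.mk g₁)) =
      𝒢.cell H β (𝒢.realBorelOrbit H (QuotientGroup.mk g₂)) := by
  apply Set.Subset.antisymm
  · rintro - ⟨p, hp, rfl⟩
    exact 𝒢.sαTilde_mem_cell hβ hP hH h1 hs hg₁ hg₂ h hp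
  · intro p hp
    exact ⟨_, 𝒢.sαTilde_mem_cell hβ hP hH h1 hs hg₂ hg₁ (by rwa [mul_comm]) hp, 𝒢.sαTilde_sαTilde hp⟩

end SplitRankOneGroup

lemma conj_one_half : starRingEnd ℂ (1 / 2) = 1 / 2 := by
  rw [map_div₀, map_one, map_ofNat]

/-! ### A counterexample point when `𝔰^⊥ ⊄ 𝔱_⊥` -/

namespace SplitRankOneGroup

variable {N : ℕ} (𝒢 : SplitRankOneGroup N) {P : SL(2, ℂ)} {H : Subgroup 𝒢.G}
  {β : LinearMap.BilinForm ℂ (Matrix (Fin N) (Fin N) ℂ)}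

lemma conj_Yg (hP : conjSL P = P) {g : 𝒢.G} (hg : g ∈ 𝒢.realG) :
    starRingEnd ℂ (𝒢.Yg P g 0 0) = 𝒢.Yg P g 0 0 ∧ starRingEnd ℂ (𝒢.Yg P g 1 0) = 𝒢.Yg P g 1 0 := by
  obtain ⟨ε, hε, r, hr⟩ := 𝒢.exists_real_frame hP hg
  simp only [Yg_00, Yg_10, hr, map_mul, map_add, Complex.conj_ofReal, map_ofNat]
  rcases hε with rfl | rfl <;> simp

/-- `H` is defined over `ℝ`, so `𝔥` is stable under conjugation; `P slH P⁻¹` is real and `β`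
commutes with conjugation. -/
lemma conjBy_slH_add_conjM_mem_hPerp (hβ : 𝒢.IsInvariantInnerProduct β)
    (hP : 𝒢.IsTorusFrame (H.map 𝒢.G.subtype) P) (hH : IsRealAlgebraic (H.map 𝒢.G.subtype))
    {w : Matrix (Fin N) (Fin N) ℂ} (hw : w ∈ 𝒢.lieC) (h : 𝒢.dφ (conjBy P slH) + w ∈ 𝒢.hPerp H β) :
    𝒢.dφ (conjBy P slH) + conjM w ∈ 𝒢.hPerp H β := by
  rw [𝒢.mem_hPerp hβ hP trace_slH (𝒢.conjM_mem_lieC hw)]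
  rw [𝒢.mem_hPerp hβ hP trace_slH hw] at h
  intro t v hv hm
  have hPr : conjM (conjBy P slH) = conjBy P slH := by
    have h0 : ∀ A : SL(2, ℂ), conjM (A : Matrix (Fin 2) (Fin 2) ℂ) = (conjSL A : Matrix (Fin 2) (Fin 2) ℂ) := by
      intro A; ext i j; rw [conjM_apply, conjSL_apply]
    rw [conjBy, map_mul, map_mul, h0, h0, map_inv, hP.real, conjM_slH]
  have h1 := conjM_mem_lieAlg (fun k hk => conjGL_mem_of_isRealAlgebraic hH hk) hm
  rw [map_add, conjM_dφ, conjM_smul, hPr] at h1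
  have h2 := congrArg (starRingEnd ℂ) (h _ _ (𝒢.conjM_mem_lieC hv) h1)
  have h3 : starRingEnd ℂ (β (𝒢.dφ slH) (𝒢.dφ slH)) = β (𝒢.dφ slH) (𝒢.dφ slH) := by
    rw [← hβ.conj (𝒢.dφ_mem_lieG trace_slH) (𝒢.dφ_mem_lieG trace_slH), conjM_dφ, conjM_slH]
  rw [map_add, map_mul, map_mul, h3, Complex.conj_conj,
    ← hβ.conj (𝒢.lieC_le_lieG hw) (𝒢.lieC_le_lieG (𝒢.conjM_mem_lieC hv)), conjM_conjM, map_zero] at h2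
  simpa [slH] using h2

lemma exists_real_of_not_subset (hβ : 𝒢.IsInvariantInnerProduct β)
    (hP : 𝒢.IsTorusFrame (H.map 𝒢.G.subtype) P) (hH : IsRealAlgebraic (H.map 𝒢.G.subtype))
    (hs : ¬𝒢.sPerp H β ⊆ 𝒢.tPerp H β) :
    ∃ w ∈ 𝒢.lieC, conjM w = w ∧ 𝒢.dφ (conjBy P slH) + w ∈ 𝒢.hPerp H β := by
  obtain ⟨ξ, hξ, hξt⟩ := Set.not_subset.1 hs
  obtain ⟨a, z, hz, rfl⟩ := 𝒢.exists_of_mem_sPerp hβ hP hξ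
  -- With `a = 0` the vector would be central and orthogonal to `𝔥`, hence in `𝔱_⊥`.
  have ha : a ≠ 0 := by
    rintro rfl
    apply hξt
    have h0 : 𝒢.dφ (conjBy P ((0 : ℂ) • slH)) + z = z := by simp [conjBy]
    rw [h0] at hξ ⊢
    exact ⟨hz, fun z₀ hz₀ => hξ.1.2 z₀ hz₀.1⟩
  have h1 : 𝒢.dφ (conjBy P slH) + a⁻¹ • z ∈ 𝒢.hPerp H β := by
    rw [𝒢.mem_hPerp hβ hP trace_slH (𝒢.lieC.smul_mem _ hz)]
    intro t v hv hm
    have := (𝒢.mem_hPerp hβ hP (by simp) hz).1 hξ.1 t v hv hm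
    rw [map_smul, LinearMap.smul_apply, smul_eq_mul]
    simp [slH] at this ⊢
    field_simp
    linear_combination this
  have hw := 𝒢.lieC.smul_mem a⁻¹ hz
  have h2 := 𝒢.conjBy_slH_add_conjM_mem_hPerp hβ hP hH hw h1
  set w := a⁻¹ • z
  -- Averaging with the conjugate makes the central part real and keeps the coefficient of `P slH
  -- P⁻¹` equal to `1`.
  refine ⟨(1 / 2 : ℂ) • (w + conjM w), 𝒢.lieC.smul_mem _ (𝒢.lieC.add_mem hw (𝒢.conjM_mem_lieC hw)), ?_, ?_⟩
  · rw [conjM_smul, map_add, conjM_conjM, add_comm w, conj_one_half]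
  · rw [𝒢.mem_hPerp hβ hP trace_slH
      (𝒢.lieC.smul_mem _ (𝒢.lieC.add_mem hw (𝒢.conjM_mem_lieC hw)))]
    intro t v hv hm
    have e1 := (𝒢.mem_hPerp hβ hP trace_slH hw).1 h1 t v hv hm
    have e2 := (𝒢.mem_hPerp hβ hP trace_slH (𝒢.conjM_mem_lieC hw)).1 h2 t v hv hm
    rw [map_smul, LinearMap.smul_apply, map_add, LinearMap.add_apply, smul_eq_mul]
    linear_combination (e1 + e2) / 2

/-- The coefficient `½` puts the flat at `y = 2`, since `a y` must equal `1`. What matters later is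
that `y` is real with `y² > 1`. -/
lemma isCovectorAt_half (hβ : 𝒢.IsInvariantInnerProduct β)
    (hP : 𝒢.IsTorusFrame (H.map 𝒢.G.subtype) P) (hH : IsRealAlgebraic (H.map 𝒢.G.subtype))
    {w : Matrix (Fin N) (Fin N) ℂ} (hw : w ∈ 𝒢.lieC) (h : 𝒢.dφ (conjBy P slH) + w ∈ 𝒢.hPerp H β)
    (g : 𝒢.G) :
    𝒢.IsCovectorAt H β (QuotientGroup.mk g) (𝒢.dφ ((1 / 2 : ℂ) • slH) + w) ↔ 𝒢.Yg P g 0 0 = 2 := by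
  rw [𝒢.isCovectorAt_cartan hβ hP g _ hw]
  constructor
  · intro h'
    obtain ⟨v, hv, hm⟩ := hP.exists_mem_lieAlg hH
    rw [← one_smul ℂ (conjBy P slH)] at hm
    have e1 := (𝒢.mem_hPerp hβ hP trace_slH hw).1 h 1 v hv hm
    have e2 := (𝒢.mem_hPerp hβ hP (by simp) hw).1 h' 1 v hv hm
    have h0 := hβ.slH_slH_ne_zero
    have hb : slH 0 0 = 1 := by simp [slH]
    simp only [Matrix.smul_apply, smul_eq_mul, hb, mul_one] at e1 e2
    apply mul_left_cancel₀ h0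
    linear_combination 2 * (e2 - e1)
  · intro hy
    rw [hy]
    simpa using h

/-- Equal `Y` means that the frames differ by a diagonal matrix on the right, which `H` realises up
to an element of `C`. -/
lemma exists_C_smul_of_Yg_eq (hP : 𝒢.IsTorusFrame (H.map 𝒢.G.subtype) P) {g g' : 𝒢.G}
    (h : 𝒢.Yg P g' = 𝒢.Yg P g) :
    ∃ c : 𝒢.G, (c : GL (Fin N) ℂ) ∈ 𝒢.C ∧ (QuotientGroup.mk g' : 𝒢.G ⧸ H) = c • QuotientGroup.mk g := by
  set D := (𝒢.frame P g)⁻¹ * 𝒢.frame P g' with hD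
  have h1 : conjBy D slH = slH := by
    rw [hD, conjBy_mul]
    have h2 : conjBy (𝒢.frame P g') slH = conjBy (𝒢.frame P g) slH := h
    rw [h2, ← conjBy_mul, inv_mul_cancel]; simp [conjBy]
  have d0 := congrFun (congrFun h1 0) 0
  have d1 := congrFun (congrFun h1 0) 1
  have d2 := congrFun (congrFun h1 1) 0
  have dd := SL2_det D
  simp only [conjBy_apply, SL2_inv_00, SL2_inv_01, SL2_inv_10, SL2_inv_11] at d0 d1 d2
  simp [slH] at d0 d1 d2
  have k0 : D 0 0 * D 1 1 = 1 := by linear_combination (d0 + dd) / 2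
  have k00 : D 0 0 ≠ 0 := left_ne_zero_of_mul_eq_one k0
  have k11 : D 1 1 ≠ 0 := right_ne_zero_of_mul_eq_one k0
  have k01 : D 0 1 = 0 := by
    have : D 0 0 * D 0 1 = 0 := by linear_combination -d1 / 2
    exact (mul_eq_zero.1 this).resolve_left k00
  have k10 : D 1 0 = 0 := by
    have : D 1 0 * D 1 1 = 0 := by linear_combination d2 / 2
    exact (mul_eq_zero.1 this).resolve_right k11
  have hDd : D = diagSL (D 0 0) k00 := by
    apply SL2_ext
    · simp
    · simpa using k01
    · simpa using k10
    · rw [diagSL_11]; exact eq_inv_of_mul_eq_one_right k0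
  obtain ⟨c, hc, hm⟩ := hP.exists_mem (D 0 0) k00
  rw [← hDd] at hm
  obtain ⟨k, hk, ek⟩ := Subgroup.mem_map.1 hm
  obtain ⟨c₁, hc₁, e₁⟩ := 𝒢.slPart_spec g
  obtain ⟨c₂, hc₂, e₂⟩ := 𝒢.slPart_spec g'
  have hsl : 𝒢.slPart g' = 𝒢.slPart g * (P * D * P⁻¹) := by
    rw [hD, frame, frame]; group
  have hcC : c₂ * (c₁ * c)⁻¹ ∈ 𝒢.C := 𝒢.C.mul_mem hc₂ (𝒢.C.inv_mem (𝒢.C.mul_mem hc₁ hc))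
  refine ⟨⟨c₂ * (c₁ * c)⁻¹, 𝒢.C_le_G hcC⟩, hcC, ?_⟩
  have hg' : g' = ⟨c₂ * (c₁ * c)⁻¹, 𝒢.C_le_G hcC⟩ * g * k := by
    apply Subtype.ext
    have ek' : (k : GL (Fin N) ℂ) = 𝒢.φ (P * D * P⁻¹) * c := ek
    have e₃ := 𝒢.φ_mul_mul (A := 𝒢.slPart g) (B := P * D * P⁻¹) (c' := c) hc₁
    rw [← e₁, ← ek', ← hsl, ← 𝒢.C_central _ (𝒢.C.mul_mem hc₁ hc)] at e₃
    rw [mul_assoc, Subgroup.coe_mul, Subgroup.coe_mul, e₃, e₂, ← 𝒢.C_central c₂ hc₂]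
    group
  have : (QuotientGroup.mk g' : 𝒢.G ⧸ H) =
      QuotientGroup.mk (⟨c₂ * (c₁ * c)⁻¹, 𝒢.C_le_G hcC⟩ * g) := by
    refine (QuotientGroup.eq.2 ?_).symm
    rw [hg', inv_mul_cancel_left]; exact hk
  exact this

lemma Yg_11 (g : 𝒢.G) : 𝒢.Yg P g 1 1 = -𝒢.Yg P g 0 0 := by
  have := 𝒢.trace_Yg P g
  rw [Matrix.trace_fin_two] at this
  linear_combination this

lemma Yg_00_mul_of_mem_T {t : 𝒢.G} (ht : (t : GL (Fin N) ℂ) ∈ 𝒢.T) (g : 𝒢.G) :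
    𝒢.Yg P (t * g) 0 0 = 𝒢.Yg P g 0 0 := by
  obtain ⟨h1, h2⟩ := (𝒢.mem_T_iff t).1 ht
  have hd := SL2_det (𝒢.slPart t)
  rw [Yg_mul, conjBy_apply, SL2_inv_00, SL2_inv_10]
  rw [h2] at hd ⊢
  rw [h1] at hd ⊢
  linear_combination 𝒢.Yg P g 0 0 * hd

/-- Away from the ramification, the fibres of `y` are orbits of the torus. -/
lemma mk_mem_orbit_T (hP : 𝒢.IsTorusFrame (H.map 𝒢.G.subtype) P) {g g' : 𝒢.G}
    (h : 𝒢.Yg P g 0 0 = 𝒢.Yg P g' 0 0) (h1 : 𝒢.Yg P g 0 0 ^ 2 ≠ 1) :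
    (QuotientGroup.mk g' : 𝒢.G ⧸ H) ∈ MulAction.orbit (𝒢.T.subgroupOf 𝒢.G) (QuotientGroup.mk g : 𝒢.G ⧸ H) := by
  have hd := 𝒢.Yg_det P g
  have hd' := 𝒢.Yg_det P g'
  have hpq : 𝒢.Yg P g 0 1 * 𝒢.Yg P g 1 0 ≠ 0 := fun h0 => h1 (by rw [h0] at hd; simpa using hd)
  have hpq' : 𝒢.Yg P g' 0 1 * 𝒢.Yg P g' 1 0 ≠ 0 := fun h0 =>
    h1 (by rw [h0] at hd'; rw [h]; simpa using hd')
  have hp := left_ne_zero_of_mul hpq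
  have hp' := left_ne_zero_of_mul hpq'
  -- Conjugation by `diag(d, d⁻¹)` scales `Y₀₁` by `d²`. Once this entry agrees, `Y₁₀` is determined
  -- by `Y₀₀² + Y₀₁ Y₁₀ = 1`.
  obtain ⟨d, hd2⟩ := IsAlgClosed.exists_pow_nat_eq (𝒢.Yg P g' 0 1 / 𝒢.Yg P g 0 1) two_pos
  have hd0 : d ≠ 0 := by
    rintro rfl
    rw [zero_pow two_ne_zero, eq_comm, div_eq_zero_iff] at hd2
    simp [hp, hp'] at hd2
  have hY : 𝒢.Yg P g' = 𝒢.Yg P (𝒢.φG (diagSL d hd0) * g) := by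
    have e1 : 𝒢.Yg P (𝒢.φG (diagSL d hd0) * g) = conjBy (diagSL d hd0) (𝒢.Yg P g) := by
      rw [Yg_mul]
      rcases 𝒢.slPart_φG (diagSL d hd0) with h | h <;> rw [h]
      exact conjBy_neg _ _
    have hd3 : d ^ 2 * 𝒢.Yg P g 0 1 = 𝒢.Yg P g' 0 1 := by rw [hd2]; field_simp
    rw [e1]
    ext i j
    fin_cases i <;> fin_cases j <;>
      simp only [Fin.zero_eta, Fin.mk_one, conjBy_apply, SL2_inv_00, SL2_inv_01, SL2_inv_10, SL2_inv_11,
        diagSL_00, diagSL_01, diagSL_10, diagSL_11, Yg_11, ← h]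
    · field_simp; ring
    · linear_combination -hd3
    · have hh : 𝒢.Yg P g 0 0 ^ 2 = 𝒢.Yg P g' 0 0 ^ 2 := by rw [h]
      field_simp
      apply mul_left_cancel₀ hp
      linear_combination hd' - hd + hh + 𝒢.Yg P g' 1 0 * hd3
    · field_simp; ring
  obtain ⟨c, hc, e⟩ := 𝒢.exists_C_smul_of_Yg_eq hP hY
  have ht : (c * 𝒢.φG (diagSL d hd0) : 𝒢.G) ∈ 𝒢.T.subgroupOf 𝒢.G := by
    refine Subgroup.mul_mem _ (Subgroup.mem_subgroupOf.2 ?_) (Subgroup.mem_subgroupOf.2 ?_)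
    · exact (le_sup_right : 𝒢.C ≤ 𝒢.T) hc
    · exact 𝒢.mem_T.2 ⟨diagSL d hd0, by simp, by simp, 1, 𝒢.C.one_mem, by simp [φG]⟩
  refine ⟨⟨_, ht⟩, ?_⟩
  rw [e]
  change (c * 𝒢.φG (diagSL d hd0)) • (QuotientGroup.mk g : 𝒢.G ⧸ H) = _
  rw [mul_smul]; rfl

/-- The flat is the level set `y = 2`. As `y² ≠ 1` there, it lies in the open orbit and is one torus
orbit; as a fibre of a continuous function it is closed. -/
lemma half_mem_aPr (hβ : 𝒢.IsInvariantInnerProduct β)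
    (hP : 𝒢.IsTorusFrame (H.map 𝒢.G.subtype) P) (hH : IsRealAlgebraic (H.map 𝒢.G.subtype))
    (h1 : 𝒢.Yg P 1 1 0 ≠ 0)
    {w : Matrix (Fin N) (Fin N) ℂ} (hw : w ∈ 𝒢.lieC) (h : 𝒢.dφ (conjBy P slH) + w ∈ 𝒢.hPerp H β)
    {g₀ : 𝒢.G} (hg₀ : 𝒢.Yg P g₀ 0 0 = 2) :
    𝒢.dφ ((1 / 2 : ℂ) • slH) + w ∈ 𝒢.aPr H β := by
  have hflat : ∀ g : 𝒢.G, (QuotientGroup.mk g : 𝒢.G ⧸ H) ∈ 𝒢.flat H β (𝒢.dφ ((1 / 2 : ℂ) • slH) + w) ↔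
      𝒢.Yg P g 0 0 = 2 := by
    intro g
    have h2 := 𝒢.isCovectorAt_half hβ hP hH hw h g
    constructor
    · exact fun h3 => h2.1 h3.2
    · intro h3
      refine ⟨(𝒢.mk_mem_Omax hP g).2 fun h0 => ?_, h2.2 h3⟩
      have := 𝒢.Yg_det P g
      rw [h3, h0] at this; norm_num at this
  refine ⟨?_, fun _ => (𝒢.sα_ne_iff _ hw).2 (by norm_num), fun h' => absurd (𝒢.sα_image_aStar hβ hP h1) h',
    ⟨QuotientGroup.mk g₀, ?_⟩, ?_⟩
  · refine (𝒢.dφ_slH_add_mem_aStar hβ hP h1 _ hw).2 fun τ hτ => ?_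
    obtain ⟨hK, hC⟩ := 𝒢.lieAlg_T0 hP h1 hτ
    have := h.2 τ hK
    rwa [map_add, LinearMap.add_apply, hβ.dφ_lieC (by simp) hC, zero_add] at this
  · ext x
    obtain ⟨g, rfl⟩ := QuotientGroup.mk_surjective x
    rw [hflat]
    constructor
    · intro hg
      exact 𝒢.mk_mem_orbit_T hP (hg₀.trans hg.symm) (by rw [hg₀]; norm_num)
    · rintro ⟨⟨t, ht⟩, e⟩
      have e' : (QuotientGroup.mk (t * g₀) : 𝒢.G ⧸ H) = QuotientGroup.mk g := e
      rw [← hP.Yg_congr e', 𝒢.Yg_00_mul_of_mem_T ht, hg₀]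
  · rw [← isOpen_compl_iff]
    convert 𝒢.isOpen_of_Yg hP (isOpen_compl_singleton (x := (2 : ℂ))) 0 0 using 1
    ext x
    obtain ⟨g, rfl⟩ := QuotientGroup.mk_surjective x
    rw [Set.mem_compl_iff, hflat]
    constructor
    · exact fun hg => ⟨g, rfl, hg⟩
    · rintro ⟨g', e, hg'⟩
      rw [hP.Yg_congr e] at hg'; exact hg'

/-- `upperSL s` sends `y` to `y + s Y₁₀`, so the real unipotent orbit of the base point already
reaches `y = 2`. -/
lemma exists_upper_Yg (hP : conjSL P = P) (h1 : 𝒢.Yg P 1 1 0 ≠ 0) :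
    ∃ s : ℝ, 𝒢.Yg P (𝒢.φG (upperSL s)) 0 0 = 2 := by
  obtain ⟨hy, hq⟩ := 𝒢.conj_Yg hP (one_mem _)
  refine ⟨((2 - 𝒢.Yg P 1 0 0) / 𝒢.Yg P 1 1 0).re, ?_⟩
  rw [Complex.conj_eq_iff_re.1 (by rw [map_div₀, map_sub, hy, hq, map_ofNat])]
  set s := (2 - 𝒢.Yg P 1 0 0) / 𝒢.Yg P 1 1 0 with hs
  have e1 : 𝒢.Yg P (𝒢.φG (upperSL s)) = conjBy (upperSL s) (𝒢.Yg P 1) := by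
    have := 𝒢.Yg_mul P (𝒢.φG (upperSL s)) 1
    rw [mul_one] at this
    rw [this]
    rcases 𝒢.slPart_φG (upperSL s) with h | h <;> rw [h]
    exact conjBy_neg _ _
  rw [e1, conjBy_apply, SL2_inv_00, SL2_inv_10]
  simp only [upperSL_00, upperSL_01, upperSL_10, upperSL_11]
  have : s * 𝒢.Yg P 1 1 0 = 2 - 𝒢.Yg P 1 0 0 := by rw [hs]; field_simp
  linear_combination this

lemma mem_T_of_commute {r : 𝒢.G} {a : ℂ} (ha : a ≠ 0) {z : Matrix (Fin N) (Fin N) ℂ} (hz : z ∈ 𝒢.lieC)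
    (h : Ad (r : GL (Fin N) ℂ) (𝒢.dφ (a • slH) + z) = 𝒢.dφ (a • slH) + z) :
    (r : GL (Fin N) ℂ) ∈ 𝒢.T := by
  rw [𝒢.Ad_coe_dφ_add r (by simp) hz] at h
  have h1 := (𝒢.dφ_add_inj (by simp) (by simp) hz hz h).1
  have d0 := congrFun (congrFun h1 0) 0
  have d1 := congrFun (congrFun h1 0) 1
  have d2 := congrFun (congrFun h1 1) 0
  have dd := SL2_det (𝒢.slPart r)
  simp only [conjBy_apply, SL2_inv_00, SL2_inv_01, SL2_inv_10, SL2_inv_11] at d0 d1 d2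
  simp [slH] at d0 d1 d2
  rw [mem_T_iff]
  set D := 𝒢.slPart r
  have k0 : D 0 0 * D 1 1 = 1 := by
    apply mul_left_cancel₀ ha
    linear_combination (d0 + a * dd) / 2
  have k00 : D 0 0 ≠ 0 := left_ne_zero_of_mul_eq_one k0
  have k11 : D 1 1 ≠ 0 := right_ne_zero_of_mul_eq_one k0
  constructor
  · have : (a * D 1 1) * D 1 0 = 0 := by linear_combination d2 / 2
    exact (mul_eq_zero.1 this).resolve_left (mul_ne_zero ha k11)
  · have : (a * D 0 0) * D 0 1 = 0 := by linear_combination -d1 / 2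
    exact (mul_eq_zero.1 this).resolve_left (mul_ne_zero ha k00)

/-- A single inclusion of cells suffices. Otherwise `(kH, ζ, ζ)` with `y(k) = 2` lies in the first
cell, and its image can lie in the second only if some `n_α r⁻¹ k`, with `r` in the real torus, has
changed sign; but there `y² - 1 = 3`. -/
lemma sPerp_subset_of_image_cell (hβ : 𝒢.IsInvariantInnerProduct β)
    (hP : 𝒢.IsTorusFrame (H.map 𝒢.G.subtype) P) (hH : IsRealAlgebraic (H.map 𝒢.G.subtype))
    {g₁ : 𝒢.G} (hg₁ : g₁ ∈ 𝒢.realG) (h : 𝒢.sg P 1 * 𝒢.sg P g₁ < 0)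
    (himg : 𝒢.sαTilde H '' 𝒢.cell H β (𝒢.realBorelOrbit H (QuotientGroup.mk 1)) ⊆
      𝒢.cell H β (𝒢.realBorelOrbit H (QuotientGroup.mk g₁))) :
    𝒢.sPerp H β ⊆ 𝒢.tPerp H β := by
  by_contra hs
  have hsg1 := left_ne_zero_of_mul h.ne
  have h1 : 𝒢.Yg P 1 1 0 ≠ 0 := fun h0 => hsg1 ((𝒢.sg_eq_zero_iff hP.real (one_mem _)).2 h0)
  obtain ⟨w, hw, hwr, hwP⟩ := 𝒢.exists_real_of_not_subset hβ hP hH hs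
  obtain ⟨s, hs2⟩ := 𝒢.exists_upper_Yg hP.real h1
  set k := 𝒢.φG (upperSL s) with hk
  have hkR : k ∈ 𝒢.realG := 𝒢.upper_mem_realG s
  have hkO : (QuotientGroup.mk k : 𝒢.G ⧸ H) ∈ 𝒢.realBorelOrbit H (QuotientGroup.mk 1) := by
    have := (𝒢.smul_mem_realBorelOrbit (𝒢.upper_mem_realPts_B s)).2
      (MulAction.mem_orbit_self (M := 𝒢.realPts 𝒢.B) (QuotientGroup.mk 1 : 𝒢.G ⧸ H))
    rwa [MulAction.Quotient.smul_mk, smul_eq_mul, mul_one] at this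
  have hsgk : 0 < 𝒢.sg P 1 * 𝒢.sg P k := (𝒢.mk_mem_realBorelOrbit hP (one_mem _) hkR hsg1).1 hkO
  have hζr : IsRealMatrix (𝒢.dφ ((1 / 2 : ℂ) • slH) + w) := by
    rw [isRealMatrix_iff, map_add, conjM_dφ, conjM_smul, conjM_slH, hwr, conj_one_half]
  have hcov := (𝒢.isCovectorAt_half hβ hP hH hw hwP k).2 hs2
  have haPr := 𝒢.half_mem_aPr hβ hP hH h1 hw hwP hs2
  have hmem := 𝒢.mem_tildeUPr_self (𝒢.mk_mem_realLocus hkR) hcov hζr (𝒢.mem_lieT hw) (Or.inl haPr) hkO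
  have hone : (1 : 𝒢.G) ∈ 𝒢.realPts 𝒢.G := one_mem _
  have hcell := himg ⟨_, ⟨1, hone, _, hmem, rfl⟩, rfl⟩
  obtain ⟨g, hg, ⟨x, ξ, ζ'⟩, ⟨⟨-, -, hξr, -, hζ'r, -, -⟩, hxO, hu⟩, e⟩ := hcell
  dsimp only at hξr hxO hu hζ'r
  simp only [sαTilde, one_smul, OneMemClass.coe_one, Ad_one, Prod.mk.injEq] at e
  obtain ⟨ex, eξ, rfl⟩ := e
  rw [𝒢.sα_cartan _ hw] at hu hζ'r
  obtain ⟨t, ht⟩ := 𝒢.exists_unipotent (by norm_num) hw hξr hζ'r hu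
  set u := 𝒢.φG (upperSL t) with hudef
  set n := 𝒢.φG weylSL with hn
  have huB := 𝒢.upper_mem_realPts_B t
  have huR : u ∈ 𝒢.realG := 𝒢.upper_mem_realG t
  have hgR : g ∈ 𝒢.realG := hg.2
  set r := g * u * n with hr
  have hrR : r ∈ 𝒢.realG := mul_mem (mul_mem hgR huR) 𝒢.weyl_mem_realG
  have hsα : Ad (n : GL (Fin N) ℂ) (𝒢.dφ ((1 / 2 : ℂ) • slH) + w) = 𝒢.dφ ((-(1 / 2) : ℂ) • slH) + w :=
    𝒢.sα_cartan _ hw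
  -- Comparing the covectors shows that `r = g u n` fixes the regular element `ζ`, so it belongs to
  -- the torus.
  have hrT : (r : GL (Fin N) ℂ) ∈ 𝒢.T := by
    refine 𝒢.mem_T_of_commute (a := 1 / 2) (by norm_num) hw ?_
    rw [hr, Subgroup.coe_mul, Subgroup.coe_mul, Ad_mul, Ad_mul, hsα, ← ht, ← eξ]
  have hrT' : ((r⁻¹ : 𝒢.G) : GL (Fin N) ℂ) ∈ 𝒢.T := 𝒢.T.inv_mem hrT
  have hrB : r⁻¹ ∈ 𝒢.realPts 𝒢.B :=
    𝒢.mem_realPts.2 ⟨(𝒢.mem_B_iff _).2 ((𝒢.mem_T_iff _).1 hrT').1, inv_mem hrR⟩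
  -- the point `r⁻¹ k` lies in the first orbit, as does its image under the reflection
  have hr1 : r⁻¹ * k ∈ 𝒢.realG := mul_mem (inv_mem hrR) hkR
  have hr2 : n * (r⁻¹ * k) ∈ 𝒢.realG := mul_mem 𝒢.weyl_mem_realG hr1
  have hsw := 𝒢.sg_weyl hP.real hr1
  rw [𝒢.Yg_00_mul_of_mem_T hrT', hs2] at hsw
  -- The torus preserves `y`, so the product of the two signs is governed by `2² - 1`.
  have hsw' : 4 * (𝒢.sg P (r⁻¹ * k) * 𝒢.sg P (n * (r⁻¹ * k))) = 3 := by
    have : ((4 * (𝒢.sg P (r⁻¹ * k) * 𝒢.sg P (n * (r⁻¹ * k))) : ℝ) : ℂ) = ((3 : ℝ) : ℂ) := by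
      rw [hsw]; norm_num
    exact_mod_cast this
  have hrk : 0 < 𝒢.sg P 1 * 𝒢.sg P (r⁻¹ * k) := by
    rw [← 𝒢.mk_mem_realBorelOrbit (H := H) hP (one_mem _) hr1 hsg1]
    exact (𝒢.smul_mem_realBorelOrbit hrB).2 hkO
  have hx : (QuotientGroup.mk (n * (r⁻¹ * k)) : 𝒢.G ⧸ H) = u⁻¹ • x := by
    have : (QuotientGroup.mk (n * (r⁻¹ * k)) : 𝒢.G ⧸ H) = (n * r⁻¹) • (QuotientGroup.mk k : 𝒢.G ⧸ H) := by
      rw [MulAction.Quotient.smul_mk, smul_eq_mul, mul_assoc]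
    rw [this, ex, smul_smul]
    congr 1
    rw [hr]; group
  have hO' : (QuotientGroup.mk (n * (r⁻¹ * k)) : 𝒢.G ⧸ H) ∈ 𝒢.realBorelOrbit H (QuotientGroup.mk g₁) := by
    rw [hx]; exact (𝒢.smul_mem_realBorelOrbit (inv_mem huB)).2 hxO
  rw [𝒢.mk_mem_realBorelOrbit hP hg₁ hr2 (right_ne_zero_of_mul h.ne)] at hO'
  have h3 : 𝒢.sg P 1 * 𝒢.sg P (r⁻¹ * k) * (𝒢.sg P g₁ * 𝒢.sg P (n * (r⁻¹ * k))) =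
    𝒢.sg P 1 * 𝒢.sg P g₁ * (𝒢.sg P (r⁻¹ * k) * 𝒢.sg P (n * (r⁻¹ * k))) := by ring
  have h4 := mul_pos hrk hO'
  rw [h3] at h4
  have h5 := mul_neg_of_neg_of_pos h (show 0 < 𝒢.sg P (r⁻¹ * k) * 𝒢.sg P (n * (r⁻¹ * k)) by linarith)
  exact lt_asymm h4 h5

end SplitRankOneGroup

end

theorem mainTheorem8 {N : ℕ} (𝒢 : SplitRankOneGroup N)
    (H : Subgroup 𝒢.G) (hH : IsRealAlgebraic (H.map 𝒢.G.subtype))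
    (β : LinearMap.BilinForm ℂ (Matrix (Fin N) (Fin N) ℂ)) (hβ : 𝒢.IsInvariantInnerProduct β)
    (O : Set (𝒢.G ⧸ H)) (hO : O = 𝒢.realBorelOrbit H (QuotientGroup.mk 1))
    (hOopen : 𝒢.IsOpenInSpan H O)
    (hT2 : 𝒢.IsTypeT2 H (QuotientGroup.mk 1)) :
    ∃ O' : Set (𝒢.G ⧸ H),
      O' ≠ O ∧
      (∀ O₁ : Set (𝒢.G ⧸ H),
        (𝒢.IsRealBorelOrbit H O₁ ∧ O₁ ⊆ 𝒢.realSpan H O ∧ 𝒢.IsOpenInSpan H O₁) ↔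
          (O₁ = O ∨ O₁ = O')) ∧
      𝒢.reflectionOperator H O = O' ∧
      𝒢.reflectionOperator H O' = O ∧
      ((𝒢.sαTilde H '' 𝒢.cell H β O = 𝒢.cell H β O' ∧
          𝒢.sαTilde H '' 𝒢.cell H β O' = 𝒢.cell H β O) ↔
        𝒢.sPerp H β ⊆ 𝒢.tPerp H β) := by
  subst hO
  obtain ⟨P, hP⟩ := 𝒢.exists_torusFrame H hT2
  obtain ⟨g₁, hg₁, h⟩ := 𝒢.exists_open_orbit hP hOopen
  have h' : 𝒢.sg P g₁ * 𝒢.sg P 1 < 0 := by rwa [mul_comm]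
  have h1 : 𝒢.Yg P 1 1 0 ≠ 0 := fun h0 =>
    left_ne_zero_of_mul h.ne ((𝒢.sg_eq_zero_iff hP.real (one_mem _)).2 h0)
  refine ⟨𝒢.realBorelOrbit H (QuotientGroup.mk g₁), 𝒢.realBorelOrbit_ne hP (one_mem _) hg₁ h,
    𝒢.open_orbits hP hOopen (one_mem _) hg₁ h,
    𝒢.reflectionOperator_realBorelOrbit hP hOopen (one_mem _) hg₁ h,
    𝒢.reflectionOperator_realBorelOrbit hP hOopen hg₁ (one_mem _) h',
    fun hc => 𝒢.sPerp_subset_of_image_cell hβ hP hH hg₁ h hc.1.subset, fun hs => ?_⟩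
  exact ⟨𝒢.sαTilde_image_cell hβ hP hH h1 hs (one_mem _) hg₁ h,
    𝒢.sαTilde_image_cell hβ hP hH h1 hs hg₁ (one_mem _) h'⟩
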